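/- Manifolds are finite-dimensional, smooth, without boundary, Hausdorff and second countable. Let $\Sigma\rightrightarrows P$ be a symplectic groupoid: a Lie groupoid with source $\alpha$, target $\beta$, identity map $1\colon P\to\Sigma$ and product $hg$ defined when $\alpha h=\beta g$, together with a symplectic form $\omega$ on $\Sigma$ such that $\{(hg,h,g)\mid \alpha h=\beta g\}$ is Lagrangian in $\overline{\Sigma}\times\Sigma\times\Sigma$, the bar denoting reversal of $\omega$. Put $\langle\omega^\flat(X),Y\rangle=-\omega(X,Y)$, let $\sharp$ be the inverse of $\omega^\flat$, and give $\Sigma$ the Poisson structure $\{f_1,f_2\}=\omega((df_1)^\sharp,(df_2)^\sharp)$. Let $A\Sigma$ be the vector bundle on $P$ with fibres $A_m\Sigma=\ker T_{1_m}(\alpha)$, $q\colon A^*\Sigma\to P$ its dual bundle, $p\colon TP\to P$ the tangent bundle, and define $$w\colon TP\to A^*\Sigma,\qquad \langle w(x),Y\rangle=-\omega(T(1)(x),Y)\quad (x\in T_mP,\ Y\in A_m\Sigma).$$ For a section $X$ of $A\Sigma$ let $\overrightarrow{X}(g)=T(R_g)(X(\beta g))$ be the corresponding right-invariant vector field on $\Sigma$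 and $\ell_X\colon A^*\Sigma\to\mathbb R$, $\ell_X(\phi)=\langle\phi,X(q\phi)\rangle$; for $f\in C^\infty(P)$ let $\ell_{df}\colon TP\to\mathbb R$, $\ell_{df}(v)=df(v)$. Then there are unique structures as follows: 1. a Poisson structure on $P$ for which $\beta\colon\Sigma\to P$ is a Poisson map; 2. a Poisson structure on $TP$ (the tangent lift of that on $P$) with $$\{\ell_{df_1},\ell_{df_2}\}=\ell_{d\{f_1,f_2\}},\quad \{\ell_{df_1},f_2\circ p\}=\{f_1,f_2\}\circ p,\quad \{f_1\circ p,f_2\circ p\}=0 ;$$ 3. a Lie algebroid structure on $A\Sigma$ with anchor $a=T(\beta)|_{A\Sigma}$ and $\overrightarrow{[X,Y]}=[\overrightarrow{X},\overrightarrow{Y}]$; 4. a Poisson structure on $A^*\Sigma$ (the Lie-Poisson structure dual to $A\Sigma$) with $$\{\ell_X,\ell_Y\}=\ell_{[X,Y]},\quad \{\ell_X,f\circ q\}=a(X)(f)\circ q,\quad \{f_1\circ q,f_2\circ q\}=0 .$$ With these structures, $-w\colon TP\to A^*\Sigma$ is a diffeomorphism and a Poisson map, i.e. $\{F_1\circ(-w),F_2\circ(-w)\}=\{F_1,F_2\}\circ(-w)$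 for all $F_1,F_2\in C^\infty(A^*\Sigma)$. -/

import Mathlib

open Bundle Set Filter Topology
open scoped Manifold ContDiff

set_option linter.unusedSectionVars false

noncomputable section

/-- A Poisson structure on a manifold `M`: a Lie algebra bracket on the real vector space of smooth
functions which is a derivation in its second argument. -/
structure PoissonStructure {E H : Type*} [NormedAddCommGroup E] [NormedSpace ℝ E]
    [TopologicalSpace H] (I : ModelWithCorners ℝ E H) (M : Type*) [TopologicalSpace M]
    [ChartedSpace H M] where
  bracket : C^∞⟮I, M; ℝ⟯ →ₗ[ℝ] C^∞⟮I, M; ℝ⟯ →ₗ[ℝ] C^∞⟮I, M; ℝ⟯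
  bracket_self : ∀ f, bracket f f = 0
  jacobi : ∀ f g h,
    bracket f (bracket g h) + bracket g (bracket h f) + bracket h (bracket f g) = 0
  leibniz : ∀ f g h, bracket f (g * h) = g * bracket f h + bracket f g * h

/-- A smooth map `μ` is a Poisson map if `{f ∘ μ, g ∘ μ} = {f, g} ∘ μ`. -/
def IsPoissonMap {E H E' H' : Type*} [NormedAddCommGroup E] [NormedSpace ℝ E]
    [TopologicalSpace H] {I : ModelWithCorners ℝ E H} {M : Type*} [TopologicalSpace M]
    [ChartedSpace H M] [NormedAddCommGroup E'] [NormedSpace ℝ E']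
    [TopologicalSpace H'] {I' : ModelWithCorners ℝ E' H'} {M' : Type*} [TopologicalSpace M']
    [ChartedSpace H' M'] (π₁ : PoissonStructure I M) (π₂ : PoissonStructure I' M')
    (μ : C^∞⟮I, M; I', M'⟯) : Prop :=
  ∀ f g : C^∞⟮I', M'; ℝ⟯,
    π₁.bracket (f.comp μ) (g.comp μ) = (π₂.bracket f g).comp μ

section
variable {E F : Type*} [NormedAddCommGroup E] [NormedSpace ℝ E] [FiniteDimensional ℝ E]
  [NormedAddCommGroup F] [NormedSpace ℝ F] [FiniteDimensional ℝ F]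
  {M : Type*} [TopologicalSpace M] [ChartedSpace E M] [IsManifold 𝓘(ℝ, E) ∞ M]

/-- The derivative `v f` of a real function `f` along a tangent vector `v`. -/
def dirDeriv (f : M → ℝ) (x : M) (v : TangentSpace 𝓘(ℝ, E) x) : ℝ :=
  mfderiv 𝓘(ℝ, E) 𝓘(ℝ, ℝ) f x v

variable (E M) in
/-- A symplectic form on `M`: a smooth, alternating, nondegenerate and closed 2-form. Closedness is
expressed by the invariant formula for the exterior derivative,
`dω(X,Y,Z) = X ω(Y,Z) + Y ω(Z,X) + Z ω(X,Y) - ω([X,Y],Z) - ω([Y,Z],X) - ω([Z,X],Y)`. -/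
structure SymplecticForm where
  form : ∀ x : M, TangentSpace 𝓘(ℝ, E) x →L[ℝ] TangentSpace 𝓘(ℝ, E) x →L[ℝ] ℝ
  contMDiff : ContMDiff 𝓘(ℝ, E) (𝓘(ℝ, E).prod 𝓘(ℝ, E →L[ℝ] E →L[ℝ] ℝ)) ∞
    (fun x ↦ TotalSpace.mk' (E →L[ℝ] E →L[ℝ] ℝ) x (form x))
  alternating : ∀ x v, form x v v = 0
  nondegenerate : ∀ x v, (∀ u, form x v u = 0) → v = 0
  closed : ∀ (X Y Z : Cₛ^∞⟮𝓘(ℝ, E); E, (TangentSpace 𝓘(ℝ, E) : M → Type _)⟯) (x : M),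
    dirDeriv (fun y ↦ form y (Y y) (Z y)) x (X x)
      + dirDeriv (fun y ↦ form y (Z y) (X y)) x (Y x)
      + dirDeriv (fun y ↦ form y (X y) (Y y)) x (Z x)
      - form x (VectorField.mlieBracket 𝓘(ℝ, E) X Y x) (Z x)
      - form x (VectorField.mlieBracket 𝓘(ℝ, E) Y Z x) (X x)
      - form x (VectorField.mlieBracket 𝓘(ℝ, E) Z X x) (Y x) = 0

/-- The isomorphism `ω♭ : T M → T* M`, with the sign convention `⟨ω♭(u), v⟩ = -ω(u, v)`.
Its inverse `(Ω.flat x).symm` is the sharp map `♯`. -/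
def SymplecticForm.flat (Ω : SymplecticForm E M) (x : M) :
    TangentSpace 𝓘(ℝ, E) x ≃ₗ[ℝ] (TangentSpace 𝓘(ℝ, E) x →L[ℝ] ℝ) :=
  haveI : FiniteDimensional ℝ (TangentSpace 𝓘(ℝ, E) x) := inferInstanceAs (FiniteDimensional ℝ E)
  haveI : T2Space (TangentSpace 𝓘(ℝ, E) x) := inferInstanceAs (T2Space E)
  LinearEquiv.ofInjectiveOfFinrankEq (-(Ω.form x)).toLinearMap
    ((injective_iff_map_eq_zero _).2 fun v hv ↦ Ω.nondegenerate x v fun u ↦ by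
      have := DFunLike.congr_fun hv u
      simpa using this)
    (by
      rw [← (LinearMap.toContinuousLinearMap (𝕜 := ℝ)
        (E := TangentSpace 𝓘(ℝ, E) x) (F' := ℝ)).finrank_eq]
      exact Subspace.dual_finrank_eq.symm)

theorem SymplecticForm.flat_apply (Ω : SymplecticForm E M) (x : M)
    (u v : TangentSpace 𝓘(ℝ, E) x) : Ω.flat x u v = -Ω.form x u v := rfl

end

/-- A Lie groupoid `S ⇉ P` with manifold of arrows `S` (modelled on `F`) and manifold of objects `P`
(modelled on `E`). The product `mul h g` is meaningful only for composable pairs, i.e. when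
`source h = target g`; its values elsewhere are arbitrary and no condition is imposed on them.
Smoothness of the multiplication is smoothness on the embedded submanifold of composable pairs.
Surjectivity of `source` and `target`, and the fact that `one` is an injective immersion, follow
from `source_one` and `target_one`. -/
structure LieGroupoid (E F : Type*) [NormedAddCommGroup E] [NormedSpace ℝ E]
    [NormedAddCommGroup F] [NormedSpace ℝ F]
    (S P : Type*) [TopologicalSpace S] [ChartedSpace F S] [TopologicalSpace P]
    [ChartedSpace E P] where
  source : C^∞⟮𝓘(ℝ, F), S; 𝓘(ℝ, E), P⟯
  target : C^∞⟮𝓘(ℝ, F), S; 𝓘(ℝ, E), P⟯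
  one : C^∞⟮𝓘(ℝ, E), P; 𝓘(ℝ, F), S⟯
  mul : S → S → S
  source_submersion : ∀ g, Function.Surjective (mfderiv 𝓘(ℝ, F) 𝓘(ℝ, E) source g)
  target_submersion : ∀ g, Function.Surjective (mfderiv 𝓘(ℝ, F) 𝓘(ℝ, E) target g)
  contMDiffOn_mul : ContMDiffOn (𝓘(ℝ, F).prod 𝓘(ℝ, F)) 𝓘(ℝ, F) ∞
    (fun p : S × S ↦ mul p.1 p.2) {p | source p.1 = target p.2}
  source_mul : ∀ h g, source h = target g → source (mul h g) = source g
  target_mul : ∀ h g, source h = target g → target (mul h g) = target h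
  source_one : ∀ m, source (one m) = m
  target_one : ∀ m, target (one m) = m
  mul_assoc : ∀ h g f, source h = target g → source g = target f →
    mul h (mul g f) = mul (mul h g) f
  one_mul : ∀ g, mul (one (target g)) g = g
  mul_one : ∀ g, mul g (one (source g)) = g
  exists_inv : ∀ g, ∃ g', source g' = target g ∧ target g' = source g ∧
    mul g' g = one (source g) ∧ mul g g' = one (target g)

namespace LieGroupoid

variable {E F : Type*} [NormedAddCommGroup E] [NormedSpace ℝ E] [FiniteDimensional ℝ E]
  [NormedAddCommGroup F] [NormedSpace ℝ F] [FiniteDimensional ℝ F]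
  {S P : Type*} [TopologicalSpace S] [ChartedSpace F S] [IsManifold 𝓘(ℝ, F) ∞ S]
  [TopologicalSpace P] [ChartedSpace E P] [IsManifold 𝓘(ℝ, E) ∞ P]

/-- The fibre `ker (T(source)) ∩ T_{1_m} S` over `m` of the Lie algebroid, as a subspace. -/
def vert (G : LieGroupoid E F S P) (m : P) : Submodule ℝ (TangentSpace 𝓘(ℝ, F) (G.one m)) :=
  LinearMap.ker (mfderiv 𝓘(ℝ, F) 𝓘(ℝ, E) G.source (G.one m)).toLinearMap

/-- The fibres of the Lie algebroid `A S` of the Lie groupoid: `A_m S = ker T_{1_m}(source)`. -/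
abbrev A (G : LieGroupoid E F S P) (m : P) : Type _ := G.vert m

variable (E F) in
/-- The model fibre of `A S`; the rank of `A S` is `dim S - dim P`. -/
abbrev AModel : Type := Fin (Module.finrank ℝ F - Module.finrank ℝ E) → ℝ

variable (G : LieGroupoid E F S P)

/-! The smooth vector bundle structure on `A S`. Near `p₀` one reads the tangent spaces `T_{1_p} S` in
the trivialization of `T S` around `1_{p₀}`, and identifies `A_p S` with the model fibre by a linear
map `F → (model fibre)` chosen at `p₀`. -/

/-- The source map in the charts around `1_{p₀}` and `p₀`. -/
def locSource (p₀ : P) : F → E :=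
  extChartAt 𝓘(ℝ, E) p₀ ∘ G.source ∘ (extChartAt 𝓘(ℝ, F) (G.one p₀)).symm

/-- The points `p` at which both charts are available. -/
def locDom (p₀ : P) : Set P :=
  (chartAt E p₀).source ∩ G.one ⁻¹' (chartAt F (G.one p₀)).source

/-- The derivative of the source map at `1_p`, in the charts around `1_{p₀}` and `p₀`. -/
def D (p₀ p : P) : F →L[ℝ] E :=
  fderiv ℝ (G.locSource p₀) (extChartAt 𝓘(ℝ, F) (G.one p₀) (G.one p))

/-- The trivialization of `T S` around `1_{p₀}` on `T_{1_p} S`. -/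
def frame (p₀ p : P) : TangentSpace 𝓘(ℝ, F) (G.one p) →L[ℝ] F :=
  (trivializationAt F (TangentSpace 𝓘(ℝ, F) : S → Type _) (G.one p₀)).continuousLinearMapAt ℝ
    (G.one p)

/-- The inverse of `frame`. -/
def frameSymm (p₀ p : P) : F →L[ℝ] TangentSpace 𝓘(ℝ, F) (G.one p) :=
  (trivializationAt F (TangentSpace 𝓘(ℝ, F) : S → Type _) (G.one p₀)).symmL ℝ (G.one p)

theorem frame_frameSymm {p₀ p : P} (hp : p ∈ G.locDom p₀) (y : F) :
    G.frame p₀ p (G.frameSymm p₀ p y) = y :=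
  Trivialization.continuousLinearMapAt_symmL _ (by simpa using hp.2) y

theorem frameSymm_frame {p₀ p : P} (hp : p ∈ G.locDom p₀) (u : TangentSpace 𝓘(ℝ, F) (G.one p)) :
    G.frameSymm p₀ p (G.frame p₀ p u) = u :=
  Trivialization.symmL_continuousLinearMapAt _ (by simpa using hp.2) u

theorem isOpen_locDom (p₀ : P) : IsOpen (G.locDom p₀) :=
  (chartAt E p₀).open_source.inter
    ((chartAt F (G.one p₀)).open_source.preimage G.one.contMDiff.continuous)

/-- The domain of `locSource`. -/
def locOpen (p₀ : P) : Set F :=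
  (chartAt F (G.one p₀)).target ∩ (extChartAt 𝓘(ℝ, F) (G.one p₀)).symm ⁻¹'
    (G.source ⁻¹' (chartAt E p₀).source)

theorem isOpen_locOpen (p₀ : P) : IsOpen (G.locOpen p₀) := by
  have h := (continuousOn_extChartAt_symm (I := 𝓘(ℝ, F)) (G.one p₀)).isOpen_inter_preimage
    (isOpen_extChartAt_target (I := 𝓘(ℝ, F)) (G.one p₀))
    ((chartAt E p₀).open_source.preimage G.source.contMDiff.continuous)
  simpa [locOpen] using h

theorem mapsTo_locOpen (p₀ : P) {p : P} (hp : p ∈ G.locDom p₀) :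
    extChartAt 𝓘(ℝ, F) (G.one p₀) (G.one p) ∈ G.locOpen p₀ := by
  have h1 : G.one p ∈ (extChartAt 𝓘(ℝ, F) (G.one p₀)).source := by
    simpa using hp.2
  refine ⟨by simpa using (extChartAt 𝓘(ℝ, F) (G.one p₀)).map_source h1, ?_⟩
  simp only [mem_preimage]
  rw [(extChartAt 𝓘(ℝ, F) (G.one p₀)).left_inv h1, G.source_one]
  exact hp.1

theorem contDiffOn_locSource (p₀ : P) : ContDiffOn ℝ ∞ (G.locSource p₀) (G.locOpen p₀) := by
  rw [← contMDiffOn_iff_contDiffOn]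
  have h1 : ContMDiffOn 𝓘(ℝ, F) 𝓘(ℝ, F) ∞ (extChartAt 𝓘(ℝ, F) (G.one p₀)).symm (G.locOpen p₀) :=
    (contMDiffOn_extChartAt_symm (G.one p₀)).mono fun x hx ↦ by simpa using hx.1
  have h2 := G.source.contMDiff.comp_contMDiffOn h1
  exact (contMDiffOn_extChartAt (x := p₀)).comp h2 fun x hx ↦ hx.2

theorem contMDiffOn_D (p₀ : P) :
    ContMDiffOn 𝓘(ℝ, E) 𝓘(ℝ, F →L[ℝ] E) ∞ (G.D p₀) (G.locDom p₀) := by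
  have h1 : ContDiffOn ℝ ∞ (fderiv ℝ (G.locSource p₀)) (G.locOpen p₀) :=
    (G.contDiffOn_locSource p₀).fderiv_of_isOpen (G.isOpen_locOpen p₀) (by simp)
  have h2 : ContMDiffOn 𝓘(ℝ, E) 𝓘(ℝ, F) ∞
      (fun p ↦ extChartAt 𝓘(ℝ, F) (G.one p₀) (G.one p)) (G.locDom p₀) :=
    (contMDiffOn_extChartAt (x := G.one p₀)).comp G.one.contMDiff.contMDiffOn fun x hx ↦ hx.2
  exact (contMDiffOn_iff_contDiffOn.2 h1).comp h2 fun x hx ↦ G.mapsTo_locOpen p₀ hx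

theorem D_frame {p₀ p : P} (hp : p ∈ G.locDom p₀) (u : TangentSpace 𝓘(ℝ, F) (G.one p)) :
    G.D p₀ p (G.frame p₀ p u) =
      (mfderiv 𝓘(ℝ, E) 𝓘(ℝ, E) (extChartAt 𝓘(ℝ, E) p₀) (G.source (G.one p)))
        (mfderiv 𝓘(ℝ, F) 𝓘(ℝ, E) G.source (G.one p) u) := by
  have hF : G.one p ∈ (chartAt F (G.one p₀)).source := hp.2
  have hFe : G.one p ∈ (extChartAt 𝓘(ℝ, F) (G.one p₀)).source := by simpa using hF
  have hE : G.source (G.one p) ∈ (chartAt E p₀).source := by rw [G.source_one]; exact hp.1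
  have hD : HasFDerivAt (G.locSource p₀) (G.D p₀ p)
      (extChartAt 𝓘(ℝ, F) (G.one p₀) (G.one p)) := by
    have hm := G.mapsTo_locOpen p₀ hp
    exact (((G.contDiffOn_locSource p₀).contDiffAt
      ((G.isOpen_locOpen p₀).mem_nhds hm)).differentiableAt (by simp)).hasFDerivAt
  have hφ : MDifferentiableAt 𝓘(ℝ, F) 𝓘(ℝ, F) (extChartAt 𝓘(ℝ, F) (G.one p₀)) (G.one p) :=
    mdifferentiableAt_extChartAt hF
  have hψ : MDifferentiableAt 𝓘(ℝ, E) 𝓘(ℝ, E) (extChartAt 𝓘(ℝ, E) p₀) (G.source (G.one p)) :=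
    mdifferentiableAt_extChartAt hE
  have hs : MDifferentiableAt 𝓘(ℝ, F) 𝓘(ℝ, E) G.source (G.one p) :=
    G.source.contMDiff.mdifferentiableAt (by simp)
  have h1 := hD.hasMFDerivAt.comp (G.one p) hφ.hasMFDerivAt
  have h2 := hψ.hasMFDerivAt.comp (G.one p) hs.hasMFDerivAt
  have heq : (G.locSource p₀ ∘ extChartAt 𝓘(ℝ, F) (G.one p₀)) =ᶠ[𝓝 (G.one p)]
      (extChartAt 𝓘(ℝ, E) p₀ ∘ G.source) := by
    filter_upwards [(isOpen_extChartAt_source (I := 𝓘(ℝ, F)) (G.one p₀)).mem_nhds hFe] with x hx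
    simp only [locSource, Function.comp_apply]
    rw [(extChartAt 𝓘(ℝ, F) (G.one p₀)).left_inv hx]
  have h3 := hasMFDerivAt_unique (h2.congr_of_eventuallyEq heq) h1
  have h4 := DFunLike.congr_fun h3 u
  have h5 : G.frame p₀ p u = mfderiv 𝓘(ℝ, F) 𝓘(ℝ, F) (extChartAt 𝓘(ℝ, F) (G.one p₀)) (G.one p) u := by
    rw [frame, TangentBundle.continuousLinearMapAt_trivializationAt hF]
    rfl
  rw [h5]
  exact h4.symm

theorem mem_vert_iff {p₀ p : P} (hp : p ∈ G.locDom p₀) (u : TangentSpace 𝓘(ℝ, F) (G.one p)) :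
    u ∈ G.vert p ↔ G.D p₀ p (G.frame p₀ p u) = 0 := by
  have hE : G.source (G.one p) ∈ (chartAt E p₀).source := by rw [G.source_one]; exact hp.1
  rw [G.D_frame hp]
  have hinj : Function.Injective
      (mfderiv 𝓘(ℝ, E) 𝓘(ℝ, E) (extChartAt 𝓘(ℝ, E) p₀) (G.source (G.one p))) :=
    (isInvertible_mfderiv_extChartAt (by simpa using hE)).injective
  constructor
  · intro h
    have h' : mfderiv 𝓘(ℝ, F) 𝓘(ℝ, E) G.source (G.one p) u = 0 := h
    rw [h']
    exact map_zero _
  · intro h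
    exact hinj (h.trans (map_zero _).symm)

theorem mem_locDom (p₀ : P) : p₀ ∈ G.locDom p₀ :=
  ⟨mem_chart_source E p₀, mem_chart_source F (G.one p₀)⟩

theorem D_surjective (p₀ : P) : Function.Surjective (G.D p₀ p₀) := by
  have hp := G.mem_locDom p₀
  have hE : G.source (G.one p₀) ∈ (chartAt E p₀).source := by rw [G.source_one]; exact hp.1
  intro y
  obtain ⟨v, hv⟩ := (isInvertible_mfderiv_extChartAt (I := 𝓘(ℝ, E)) (x := p₀)
    (y := G.source (G.one p₀)) (by simpa using hE)).surjective y
  obtain ⟨u, hu⟩ := G.source_submersion (G.one p₀) v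
  refine ⟨G.frame p₀ p₀ u, ?_⟩
  rw [G.D_frame hp, hu]
  exact hv

theorem exists_complement (p₀ : P) : ∃ q : F →L[ℝ] AModel E F,
    ((G.D p₀ p₀).prod q).IsInvertible := by
  set K := LinearMap.ker (G.D p₀ p₀).toLinearMap
  have hs : LinearMap.range (G.D p₀ p₀).toLinearMap = ⊤ :=
    LinearMap.range_eq_top.2 (G.D_surjective p₀)
  have hrank : Module.finrank ℝ E + Module.finrank ℝ K = Module.finrank ℝ F := by
    rw [← LinearMap.finrank_range_add_finrank_ker (G.D p₀ p₀).toLinearMap, hs, finrank_top]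
  have hK : Module.finrank ℝ K = Module.finrank ℝ (AModel E F) := by
    rw [Module.finrank_fin_fun]; omega
  obtain ⟨r, hr⟩ := LinearMap.exists_leftInverse_of_injective K.subtype K.ker_subtype
  let c := LinearEquiv.ofFinrankEq K (AModel E F) hK
  refine ⟨LinearMap.toContinuousLinearMap (c.toLinearMap ∘ₗ r), ?_⟩
  set T := (G.D p₀ p₀).prod (LinearMap.toContinuousLinearMap (c.toLinearMap ∘ₗ r))
  have hT : Function.Injective T.toLinearMap := by
    rw [injective_iff_map_eq_zero]
    intro v hv
    have h1 : G.D p₀ p₀ v = 0 := congrArg Prod.fst hv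
    have h2 : c (r v) = 0 := congrArg Prod.snd hv
    have h3 : r v = 0 := by simpa using h2
    have h4 := LinearMap.congr_fun hr ⟨v, h1⟩
    simp only [LinearMap.comp_apply, Submodule.subtype_apply, LinearMap.id_apply, h3] at h4
    exact (congrArg Subtype.val h4).symm
  have hd : Module.finrank ℝ F = Module.finrank ℝ (E × AModel E F) := by
    rw [Module.finrank_prod, Module.finrank_fin_fun]; omega
  exact ⟨(LinearEquiv.ofInjectiveOfFinrankEq T.toLinearMap hT hd).toContinuousLinearEquiv, by
    ext v <;> rfl⟩

/-- A linear map which restricts to an isomorphism from `A_{p₀} S`, read in `F`, to the model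
fibre. -/
def compl (p₀ : P) : F →L[ℝ] AModel E F := (G.exists_complement p₀).choose

/-- The map `F → E × (model fibre)` given by the derivative of the source and by `compl`. -/
def DQ (p₀ p : P) : F →L[ℝ] E × AModel E F := (G.D p₀ p).prod (G.compl p₀)

theorem contMDiffOn_DQ (p₀ : P) :
    ContMDiffOn 𝓘(ℝ, E) 𝓘(ℝ, F →L[ℝ] E × AModel E F) ∞ (G.DQ p₀) (G.locDom p₀) := by
  have h := ((contMDiffOn_const (c := ContinuousLinearMap.inl ℝ E (AModel E F))).clm_comp
    (G.contMDiffOn_D p₀)).add (contMDiffOn_const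
      (c := (ContinuousLinearMap.inr ℝ E (AModel E F)).comp (G.compl p₀)))
  refine h.congr fun p _ ↦ ?_
  ext v <;> simp [DQ]

/-- The domain of the local trivialization of `A S` around `p₀`. -/
def base (p₀ : P) : Set P := {p | p ∈ G.locDom p₀ ∧ (G.DQ p₀ p).IsInvertible}

theorem mem_base (p₀ : P) : p₀ ∈ G.base p₀ :=
  ⟨G.mem_locDom p₀, (G.exists_complement p₀).choose_spec⟩

theorem isOpen_base (p₀ : P) : IsOpen (G.base p₀) := by
  have h := (G.contMDiffOn_DQ p₀).continuousOn.isOpen_inter_preimage (G.isOpen_locDom p₀)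
    (ContinuousLinearEquiv.isOpen (𝕜 := ℝ) (E := F) (F := E × AModel E F))
  exact h

theorem contMDiffOn_inverse (p₀ : P) :
    ContMDiffOn 𝓘(ℝ, E) 𝓘(ℝ, E × AModel E F →L[ℝ] F) ∞ (fun p ↦ (G.DQ p₀ p).inverse)
      (G.base p₀) := by
  intro p hp
  obtain ⟨e, he⟩ := hp.2
  have h1 : ContDiffAt ℝ ∞ ContinuousLinearMap.inverse (G.DQ p₀ p) := by
    rw [← he]; exact contDiffAt_map_inverse e
  exact h1.contMDiffAt.comp_contMDiffWithinAt p
    ((G.contMDiffOn_DQ p₀ p hp.1).mono fun x hx ↦ hx.1)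

/-- The inverse of the local trivialization of `A S` around `p₀`. -/
def lift (p₀ p : P) : AModel E F →L[ℝ] TangentSpace 𝓘(ℝ, F) (G.one p) :=
  (G.frameSymm p₀ p).comp ((G.DQ p₀ p).inverse.comp (ContinuousLinearMap.inr ℝ E (AModel E F)))

theorem lift_mem {p₀ p : P} (hp : p ∈ G.base p₀) (y : AModel E F) : G.lift p₀ p y ∈ G.vert p := by
  rw [G.mem_vert_iff hp.1]
  simp only [lift, ContinuousLinearMap.comp_apply]
  rw [G.frame_frameSymm hp.1]
  have := hp.2.self_apply_inverse (0, y)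
  exact congrArg Prod.fst this

theorem compl_lift {p₀ p : P} (hp : p ∈ G.base p₀) (y : AModel E F) :
    G.compl p₀ (G.frame p₀ p (G.lift p₀ p y)) = y := by
  simp only [lift, ContinuousLinearMap.comp_apply]
  rw [G.frame_frameSymm hp.1]
  exact congrArg Prod.snd (hp.2.self_apply_inverse (0, y))

theorem lift_compl {p₀ p : P} (hp : p ∈ G.base p₀) (u : G.A p) :
    G.lift p₀ p (G.compl p₀ (G.frame p₀ p u)) = u := by
  have h0 : G.D p₀ p (G.frame p₀ p u) = 0 := (G.mem_vert_iff hp.1 u.1).1 u.2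
  have h1 : ContinuousLinearMap.inr ℝ E (AModel E F) (G.compl p₀ (G.frame p₀ p u)) =
      G.DQ p₀ p (G.frame p₀ p u) := Prod.ext h0.symm rfl
  simp only [lift, ContinuousLinearMap.comp_apply]
  rw [h1, hp.2.inverse_apply_self, G.frameSymm_frame hp.1]

open Classical in
/-- The local trivialization of `A S` around `p₀`. -/
def pretriv (p₀ : P) : Pretrivialization (AModel E F) (π (AModel E F) G.A) where
  toFun z := (z.1, G.compl p₀ (G.frame p₀ z.1 z.2))
  invFun z := if h : z.1 ∈ G.base p₀ then ⟨z.1, ⟨G.lift p₀ z.1 z.2, G.lift_mem h z.2⟩⟩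
    else ⟨z.1, 0⟩
  source := TotalSpace.proj ⁻¹' G.base p₀
  target := G.base p₀ ×ˢ univ
  map_source' z hz := ⟨hz, mem_univ _⟩
  map_target' z hz := by
    have h : z.1 ∈ G.base p₀ := hz.1
    simp only [h, dif_pos]
    exact h
  left_inv' z hz := by
    have h : z.1 ∈ G.base p₀ := hz
    simp only [h, dif_pos]
    exact congrArg (TotalSpace.mk z.1) (Subtype.ext (G.lift_compl h z.2))
  right_inv' z hz := by
    have h : z.1 ∈ G.base p₀ := hz.1
    exact (congrArg (fun z : TotalSpace (AModel E F) G.A ↦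
      (z.1, G.compl p₀ (G.frame p₀ z.1 z.2))) (dif_pos h)).trans (Prod.ext rfl (G.compl_lift h z.2))
  open_target := (G.isOpen_base p₀).prod isOpen_univ
  baseSet := G.base p₀
  open_baseSet := G.isOpen_base p₀
  source_eq := rfl
  target_eq := rfl
  proj_toFun z _ := rfl

theorem pretriv_symm {p₀ p : P} (hp : p ∈ G.base p₀) (y : AModel E F) :
    ((G.pretriv p₀).symm p y : TangentSpace 𝓘(ℝ, F) (G.one p)) = G.lift p₀ p y := by
  have h1 : (⟨p, (G.pretriv p₀).symm p y⟩ : TotalSpace (AModel E F) G.A) =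
      ⟨p, ⟨G.lift p₀ p y, G.lift_mem hp y⟩⟩ := by
    rw [(G.pretriv p₀).mk_symm (show p ∈ (G.pretriv p₀).baseSet from hp)]
    exact dif_pos hp
  have h2 := (TotalSpace.mk_inj).1 h1
  rw [h2]

/-- The transition functions between the local trivializations. -/
def transition (p₀ p₁ p : P) : AModel E F →L[ℝ] AModel E F :=
  (G.compl p₁).comp ((G.frame p₁ p).comp (G.lift p₀ p))

theorem contMDiffOn_transition (p₀ p₁ : P) :
    ContMDiffOn 𝓘(ℝ, E) 𝓘(ℝ, AModel E F →L[ℝ] AModel E F) ∞ (G.transition p₀ p₁)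
      (G.base p₀ ∩ G.base p₁) := by
  have h1 : ContMDiffOn 𝓘(ℝ, E) 𝓘(ℝ, F →L[ℝ] F) ∞
      (fun p ↦ (G.frame p₁ p).comp (G.frameSymm p₀ p)) (G.base p₀ ∩ G.base p₁) := by
    have h2 := (contMDiffOn_coordChangeL (IB := 𝓘(ℝ, F)) (n := ∞)
      (trivializationAt F (TangentSpace 𝓘(ℝ, F) : S → Type _) (G.one p₀))
      (trivializationAt F (TangentSpace 𝓘(ℝ, F) : S → Type _) (G.one p₁))).comp
      (G.one.contMDiff.contMDiffOn (s := G.base p₀ ∩ G.base p₁))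
      fun p hp ↦ ⟨by simpa using hp.1.1.2, by simpa using hp.2.1.2⟩
    refine h2.congr fun p hp ↦ ?_
    ext v
    simp only [Function.comp_apply, ContinuousLinearMap.comp_apply, ContinuousLinearEquiv.coe_coe]
    rw [Trivialization.coordChangeL_apply _ _
      (show _ from ⟨by simpa using hp.1.1.2, by simpa using hp.2.1.2⟩)]
    rw [frame, Trivialization.continuousLinearMapAt_apply,
      Trivialization.coe_linearMapAt_of_mem _ (by simpa using hp.2.1.2), frameSymm,
      Trivialization.symmL_apply _ (by simpa using hp.1.1.2)]
  have h3 : ContMDiffOn 𝓘(ℝ, E) 𝓘(ℝ, AModel E F →L[ℝ] AModel E F) ∞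
      (fun p ↦ (G.compl p₁).comp (((G.frame p₁ p).comp (G.frameSymm p₀ p)).comp
        ((G.DQ p₀ p).inverse.comp (ContinuousLinearMap.inr ℝ E (AModel E F)))))
      (G.base p₀ ∩ G.base p₁) :=
    contMDiffOn_const.clm_comp (h1.clm_comp
      (((G.contMDiffOn_inverse p₀).mono inter_subset_left).clm_comp contMDiffOn_const))
  exact h3

theorem transition_apply {p₀ p₁ p : P} (hp : p ∈ G.base p₀) (v : AModel E F) :
    G.transition p₀ p₁ p v = ((G.pretriv p₁) ⟨p, (G.pretriv p₀).symm p v⟩).2 := by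
  show _ = G.compl p₁ (G.frame p₁ p ((G.pretriv p₀).symm p v))
  rw [G.pretriv_symm hp]
  rfl

theorem isInducing_pretriv (p₀ : P) :
    IsInducing (G.pretriv p₀ ∘ (TotalSpace.mk p₀ : G.A p₀ → TotalSpace (AModel E F) G.A)) := by
  have hp := G.mem_base p₀
  have h1 : Continuous fun u : G.A p₀ ↦ G.compl p₀ (G.frame p₀ p₀ u) :=
    (G.compl p₀).continuous.comp ((G.frame p₀ p₀).continuous.comp continuous_subtype_val)
  have h2 : Continuous fun y : AModel E F ↦ (⟨G.lift p₀ p₀ y, G.lift_mem hp y⟩ : G.A p₀) :=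
    (G.lift p₀ p₀).continuous.subtype_mk _
  let e : G.A p₀ ≃ₜ AModel E F :=
    { toFun := fun u ↦ G.compl p₀ (G.frame p₀ p₀ u)
      invFun := fun y ↦ ⟨G.lift p₀ p₀ y, G.lift_mem hp y⟩
      left_inv := fun u ↦ Subtype.ext (G.lift_compl hp u)
      right_inv := fun y ↦ G.compl_lift hp y
      continuous_toFun := h1
      continuous_invFun := h2 }
  exact (isInducing_const_prod (x := p₀)).2 e.isInducing

/-- The local trivializations make `A S` into a vector bundle. -/
def prebundle : VectorPrebundle ℝ (AModel E F) G.A where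
  pretrivializationAtlas := range G.pretriv
  pretrivialization_linear' := by
    rintro _ ⟨p₀, rfl⟩
    exact ⟨fun p _ ↦ ((G.compl p₀).toLinearMap ∘ₗ (G.frame p₀ p).toLinearMap ∘ₗ
      (G.vert p).subtype).isLinear⟩
  pretrivializationAt := G.pretriv
  mem_base_pretrivializationAt := G.mem_base
  pretrivialization_mem_atlas p := ⟨p, rfl⟩
  exists_coordChange := by
    rintro _ ⟨p₀, rfl⟩ _ ⟨p₁, rfl⟩
    exact ⟨G.transition p₀ p₁, (G.contMDiffOn_transition p₀ p₁).continuousOn,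
      fun b hb v ↦ G.transition_apply hb.1 v⟩
  totalSpaceMk_isInducing := G.isInducing_pretriv

instance : G.prebundle.IsContMDiff 𝓘(ℝ, E) ∞ where
  exists_contMDiffCoordChange := by
    rintro _ ⟨p₀, rfl⟩ _ ⟨p₁, rfl⟩
    exact ⟨G.transition p₀ p₁, G.contMDiffOn_transition p₀ p₁,
      fun b hb v ↦ G.transition_apply hb.1 v⟩

instance : TopologicalSpace (TotalSpace (AModel E F) G.A) := G.prebundle.totalSpaceTopology
instance : FiberBundle (AModel E F) G.A := G.prebundle.toFiberBundle
instance : VectorBundle ℝ (AModel E F) G.A := G.prebundle.toVectorBundle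
instance : ContMDiffVectorBundle ∞ (AModel E F) G.A 𝓘(ℝ, E) :=
  G.prebundle.contMDiffVectorBundle 𝓘(ℝ, E)

end LieGroupoid

/-- The Poisson structure associated with a symplectic form: `{f, g} = ω((df)♯, (dg)♯)`. -/
def SymplecticForm.IsAssociatedPoisson {E M : Type*} [NormedAddCommGroup E] [NormedSpace ℝ E]
    [FiniteDimensional ℝ E] [TopologicalSpace M] [ChartedSpace E M] [IsManifold 𝓘(ℝ, E) ∞ M]
    (Ω : SymplecticForm E M) (π₁ : PoissonStructure 𝓘(ℝ, E) M) : Prop :=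
  ∀ (f g : C^∞⟮𝓘(ℝ, E), M; ℝ⟯) (x : M),
    π₁.bracket f g x = Ω.form x
      ((Ω.flat x).symm (mfderiv 𝓘(ℝ, E) 𝓘(ℝ, ℝ) f x))
      ((Ω.flat x).symm (mfderiv 𝓘(ℝ, E) 𝓘(ℝ, ℝ) g x))

section Lagrangian

variable {E H : Type*} [NormedAddCommGroup E] [NormedSpace ℝ E] [TopologicalSpace H]
  (I : ModelWithCorners ℝ E H) {M : Type*} [TopologicalSpace M] [ChartedSpace H M]

/-- The tangent vectors at `x` to a subset `L` of a manifold: the velocities at time `0` of smooth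
curves in `L` through `x`. If `L` is an embedded submanifold, this is the tangent space `T_x L`. -/
def tangentVectors (L : Set M) (x : M) : Set (TangentSpace I x) :=
  {v | ∃ c : ℝ → M, ContMDiffAt 𝓘(ℝ, ℝ) I ∞ c 0 ∧ (∀ᶠ t in 𝓝 0, c t ∈ L) ∧
    (⟨x, v⟩ : TangentBundle I M) =
      ⟨c 0, mfderiv 𝓘(ℝ, ℝ) I c 0 (1 : ℝ)⟩}

/-- An embedded submanifold `L` of a manifold with a 2-form `σ` is Lagrangian if it is isotropic,
i.e. `σ(u, v) = 0` for all `u, v ∈ T_x L`, and `dim L = (1/2) dim M`. -/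
def IsLagrangian (σ : ∀ x : M, TangentSpace I x → TangentSpace I x → ℝ) (L : Set M) : Prop :=
  ∀ x ∈ L, (∀ u ∈ tangentVectors I L x, ∀ v ∈ tangentVectors I L x, σ x u v = 0) ∧
    2 * Module.finrank ℝ (Submodule.span ℝ (tangentVectors I L x)) = Module.finrank ℝ E

end Lagrangian

section LieAlgebroid

variable {E : Type*} [NormedAddCommGroup E] [NormedSpace ℝ E] {M : Type*} [TopologicalSpace M]
  [ChartedSpace E M] [IsManifold 𝓘(ℝ, E) ∞ M]

variable (E) in
/-- A Lie algebroid structure on a smooth vector bundle `A` over `M`: a real Lie algebra bracket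
on the smooth sections of `A` and a smooth vector bundle map `anchor : A → T M` over `M`, such that
`[X, f Y] = f [X, Y] + (anchor X)(f) Y` and `anchor [X, Y] = [anchor X, anchor Y]`. -/
structure LieAlgebroid (F : Type*) [NormedAddCommGroup F] [NormedSpace ℝ F]
    (A : M → Type*) [TopologicalSpace (TotalSpace F A)] [∀ m, AddCommGroup (A m)]
    [∀ m, Module ℝ (A m)] [∀ m, TopologicalSpace (A m)] [FiberBundle F A] [VectorBundle ℝ F A]
    [ContMDiffVectorBundle ∞ F A 𝓘(ℝ, E)] where
  bracket : Cₛ^∞⟮𝓘(ℝ, E); F, A⟯ →ₗ[ℝ] Cₛ^∞⟮𝓘(ℝ, E); F, A⟯ →ₗ[ℝ] Cₛ^∞⟮𝓘(ℝ, E); F, A⟯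
  anchor : ∀ m : M, A m →L[ℝ] TangentSpace 𝓘(ℝ, E) m
  contMDiff_anchor : ContMDiff 𝓘(ℝ, E) (𝓘(ℝ, E).prod 𝓘(ℝ, F →L[ℝ] E)) ∞
    (fun m ↦ TotalSpace.mk' (F →L[ℝ] E) (E := fun m ↦ A m →L[ℝ] TangentSpace 𝓘(ℝ, E) m)
      m (anchor m))
  bracket_self : ∀ X, bracket X X = 0
  jacobi : ∀ X Y Z,
    bracket X (bracket Y Z) + bracket Y (bracket Z X) + bracket Z (bracket X Y) = 0
  leibniz : ∀ (X Y Z : Cₛ^∞⟮𝓘(ℝ, E); F, A⟯) (f : C^∞⟮𝓘(ℝ, E), M; ℝ⟯),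
    (∀ m, Z m = f m • Y m) →
      ∀ m, bracket X Z m = f m • bracket X Y m + dirDeriv f m (anchor m (X m)) • Y m
  anchor_bracket : ∀ (X Y : Cₛ^∞⟮𝓘(ℝ, E); F, A⟯) (m : M),
    anchor m (bracket X Y m) =
      VectorField.mlieBracket 𝓘(ℝ, E) (fun p ↦ anchor p (X p)) (fun p ↦ anchor p (Y p)) m

variable {F : Type*} [NormedAddCommGroup F] [NormedSpace ℝ F]
  {A : M → Type*} [TopologicalSpace (TotalSpace F A)] [∀ m, AddCommGroup (A m)]
  [∀ m, Module ℝ (A m)] [∀ m, TopologicalSpace (A m)] [FiberBundle F A] [VectorBundle ℝ F A]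
  [ContMDiffVectorBundle ∞ F A 𝓘(ℝ, E)]

variable (F A) in
/-- The total space of the dual vector bundle `A*`. -/
abbrev DualBundle : Type _ := TotalSpace (F →L[ℝ] ℝ) (fun m : M ↦ A m →L[ℝ] ℝ)

/-- The fibrewise linear function `ℓ_X` on `A*` given by a section `X` of `A`:
`ℓ_X(φ) = ⟨φ, X(q φ)⟩`, where `q` is the bundle projection. -/
def linearFunction (X : Cₛ^∞⟮𝓘(ℝ, E); F, A⟯) :
    C^∞⟮𝓘(ℝ, E).prod 𝓘(ℝ, F →L[ℝ] ℝ), DualBundle F A; ℝ⟯ where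
  val φ := φ.2 (X φ.1)
  property := by
    have hproj : ContMDiff (𝓘(ℝ, E).prod 𝓘(ℝ, F →L[ℝ] ℝ)) 𝓘(ℝ, E) ∞
        (fun φ : DualBundle F A ↦ φ.1) :=
      contMDiff_proj (fun m : M ↦ A m →L[ℝ] ℝ)
    have h : ContMDiff (𝓘(ℝ, E).prod 𝓘(ℝ, F →L[ℝ] ℝ)) (𝓘(ℝ, E).prod 𝓘(ℝ, ℝ)) ∞
        (fun φ : DualBundle F A ↦
          TotalSpace.mk' ℝ (E := Bundle.Trivial M ℝ) φ.1 (φ.2 (X φ.1))) :=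
      ContMDiff.clm_bundle_apply (F₁ := F) (E₁ := A) (E₂ := Bundle.Trivial M ℝ)
        (b := fun φ : DualBundle F A ↦ φ.1) (ϕ := fun φ ↦ φ.2) (v := fun φ ↦ X φ.1)
        contMDiff_id (X.contMDiff.comp hproj)
    intro φ
    have h1 := (contMDiffAt_totalSpace.1 (h φ)).2
    exact h1

/-- The pullback `f ∘ q` of a function on the base of `A*`. -/
def pullbackFunction (f : C^∞⟮𝓘(ℝ, E), M; ℝ⟯) :
    C^∞⟮𝓘(ℝ, E).prod 𝓘(ℝ, F →L[ℝ] ℝ), DualBundle F A; ℝ⟯ :=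
  f.comp ⟨fun φ : DualBundle F A ↦ φ.1, contMDiff_proj (fun m : M ↦ A m →L[ℝ] ℝ)⟩

/-- The Lie-Poisson structure on `A*` corresponding to a Lie algebroid `A`:
`{ℓ_X, ℓ_Y} = ℓ_[X,Y]`, `{ℓ_X, f ∘ q} = (anchor X)(f) ∘ q` and `{f ∘ q, g ∘ q} = 0`. -/
def IsLiePoisson (L : LieAlgebroid E F A)
    (π₁ : PoissonStructure (𝓘(ℝ, E).prod 𝓘(ℝ, F →L[ℝ] ℝ)) (DualBundle F A)) : Prop :=
  (∀ X Y, π₁.bracket (linearFunction X) (linearFunction Y) = linearFunction (L.bracket X Y)) ∧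
  (∀ X f (φ : DualBundle F A), π₁.bracket (linearFunction X) (pullbackFunction f) φ =
    dirDeriv f φ.1 (L.anchor φ.1 (X φ.1))) ∧
  (∀ f g, π₁.bracket (pullbackFunction f) (pullbackFunction g) = 0)

/-- The fibrewise linear function `ℓ_df` on `T M` given by `v ↦ df(v)`. -/
def differentialFunction (f : C^∞⟮𝓘(ℝ, E), M; ℝ⟯) :
    C^∞⟮𝓘(ℝ, E).tangent, TangentBundle 𝓘(ℝ, E) M; ℝ⟯ where
  val v := mfderiv 𝓘(ℝ, E) 𝓘(ℝ, ℝ) f v.1 v.2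
  property := by
    have h1 : ContMDiff 𝓘(ℝ, E).tangent 𝓘(ℝ, ℝ).tangent ∞ (tangentMap 𝓘(ℝ, E) 𝓘(ℝ, ℝ) f) :=
      f.contMDiff.contMDiff_tangentMap (by simp)
    exact (contMDiff_snd_tangentBundle_modelSpace ℝ 𝓘(ℝ, ℝ)).comp h1

/-- The pullback `f ∘ p` of a function on `M` to `T M`. -/
def tangentPullback (f : C^∞⟮𝓘(ℝ, E), M; ℝ⟯) :
    C^∞⟮𝓘(ℝ, E).tangent, TangentBundle 𝓘(ℝ, E) M; ℝ⟯ :=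
  f.comp ⟨fun v : TangentBundle 𝓘(ℝ, E) M ↦ v.1, contMDiff_proj (TangentSpace 𝓘(ℝ, E))⟩

/-- The tangent lift to `T M` of a Poisson structure on `M`: `{ℓ_df, ℓ_dg} = ℓ_d{f,g}`,
`{ℓ_df, g ∘ p} = {f, g} ∘ p` and `{f ∘ p, g ∘ p} = 0`. -/
def IsTangentLift (π₁ : PoissonStructure 𝓘(ℝ, E) M)
    (π₂ : PoissonStructure 𝓘(ℝ, E).tangent (TangentBundle 𝓘(ℝ, E) M)) : Prop :=
  (∀ f g, π₂.bracket (differentialFunction f) (differentialFunction g) =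
    differentialFunction (π₁.bracket f g)) ∧
  (∀ f g, π₂.bracket (differentialFunction f) (tangentPullback g) =
    tangentPullback (π₁.bracket f g)) ∧
  (∀ f g, π₂.bracket (tangentPullback f) (tangentPullback g) = 0)

end LieAlgebroid

namespace LieGroupoid

variable {E F : Type*} [NormedAddCommGroup E] [NormedSpace ℝ E] [FiniteDimensional ℝ E]
  [NormedAddCommGroup F] [NormedSpace ℝ F] [FiniteDimensional ℝ F]
  {S P : Type*} [TopologicalSpace S] [ChartedSpace F S] [IsManifold 𝓘(ℝ, F) ∞ S]
  [TopologicalSpace P] [ChartedSpace E P] [IsManifold 𝓘(ℝ, E) ∞ P]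
  (G : LieGroupoid E F S P)

/-- The right-invariant vector field `g ↦ T(R_g)(X(target g))` of a section `X` of `A S`, where
`R_g : h ↦ h g` is defined on the source fibre `source⁻¹(target g)`. The derivative is taken within
this submanifold, and is applied to a vector tangent to it. (It is a tangent vector at the point
`1 g`, which is equal to `g`.) -/
def rightInvariant (X : Cₛ^∞⟮𝓘(ℝ, E); AModel E F, G.A⟯) (g : S) : TangentSpace 𝓘(ℝ, F) g :=
  mfderivWithin 𝓘(ℝ, F) 𝓘(ℝ, F) (fun h ↦ G.mul h g) (G.source ⁻¹' {G.target g})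
    (G.one (G.target g)) (X (G.target g) : TangentSpace 𝓘(ℝ, F) (G.one (G.target g)))

/-- `L` is the Lie algebroid of the Lie groupoid: the right-invariant vector field of `[X, Y]` is the
Lie bracket of the right-invariant vector fields of `X` and `Y`, and the anchor is the restriction
of `T(target)`. (The values of the latter at `A_m S` are tangent vectors at `target (1_m) = m`.) -/
def IsLieAlgebroidOf (L : LieAlgebroid E (AModel E F) G.A) : Prop :=
  (∀ X Y g, G.rightInvariant (L.bracket X Y) g =
    VectorField.mlieBracket 𝓘(ℝ, F) (G.rightInvariant X) (G.rightInvariant Y) g) ∧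
  (∀ (m : P) (u : G.A m),
    L.anchor m u = mfderiv 𝓘(ℝ, F) 𝓘(ℝ, E) G.target (G.one m) (u : TangentSpace 𝓘(ℝ, F) (G.one m)))

/-- The graph `{(hg, h, g) | source h = target g}` of the multiplication. -/
def mulGraph : Set (S × S × S) :=
  {z | G.source z.2.1 = G.target z.2.2 ∧ z.1 = G.mul z.2.1 z.2.2}

end LieGroupoid

/-- The symplectic form `-pr₁*ω + pr₂*ω + pr₃*ω` of the product of three copies of `S`, the first one
with reversed symplectic structure. -/
def SymplecticForm.barProduct {F S : Type*} [NormedAddCommGroup F] [NormedSpace ℝ F]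
    [TopologicalSpace S] [ChartedSpace F S] [IsManifold 𝓘(ℝ, F) ∞ S] (Ω : SymplecticForm F S)
    (z : S × S × S)
    (u v : TangentSpace (𝓘(ℝ, F).prod (𝓘(ℝ, F).prod 𝓘(ℝ, F))) z) : ℝ :=
  -Ω.form z.1 u.1 v.1 + Ω.form z.2.1 u.2.1 v.2.1 + Ω.form z.2.2 u.2.2 v.2.2

/-- A symplectic groupoid: a Lie groupoid `S ⇉ P` with a symplectic form on `S` such that the graph
of the multiplication is Lagrangian in `S⁻ × S × S`. -/
structure SymplecticGroupoid (E F : Type*) [NormedAddCommGroup E] [NormedSpace ℝ E]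
    [NormedAddCommGroup F] [NormedSpace ℝ F]
    (S P : Type*) [TopologicalSpace S] [ChartedSpace F S] [IsManifold 𝓘(ℝ, F) ∞ S]
    [TopologicalSpace P] [ChartedSpace E P] extends LieGroupoid E F S P where
  form : SymplecticForm F S
  isLagrangian : IsLagrangian (𝓘(ℝ, F).prod (𝓘(ℝ, F).prod 𝓘(ℝ, F))) form.barProduct
    toLieGroupoid.mulGraph

namespace SymplecticGroupoid

variable {E F : Type*} [NormedAddCommGroup E] [NormedSpace ℝ E] [FiniteDimensional ℝ E]
  [NormedAddCommGroup F] [NormedSpace ℝ F] [FiniteDimensional ℝ F]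
  {S P : Type*} [TopologicalSpace S] [ChartedSpace F S] [IsManifold 𝓘(ℝ, F) ∞ S]
  [TopologicalSpace P] [ChartedSpace E P] [IsManifold 𝓘(ℝ, E) ∞ P]
  (G : SymplecticGroupoid E F S P)

/-- The map `w : T P → A* S`, `w(x) = -ω(T(1)(x), ·)` restricted to `A S`. -/
def w (x : TangentBundle 𝓘(ℝ, E) P) :
    DualBundle (LieGroupoid.AModel E F) G.toLieGroupoid.A :=
  ⟨x.1, -((G.form.form (G.one x.1) (mfderiv 𝓘(ℝ, E) 𝓘(ℝ, F) G.one x.1 x.2)).comp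
    (G.toLieGroupoid.vert x.1).subtypeL)⟩

/-- The map `-w : T P → A* S`. -/
def negW (x : TangentBundle 𝓘(ℝ, E) P) :
    DualBundle (LieGroupoid.AModel E F) G.toLieGroupoid.A :=
  ⟨(G.w x).1, -(G.w x).2⟩

end SymplecticGroupoid

/-- `a` satisfies `p`, and is the only object that does. -/
def IsTheUnique {α : Type*} (p : α → Prop) (a : α) : Prop := p a ∧ ∀ b, p b → b = a

end

/-!
Write `α`, `β` for the source and target maps, and `X_F` for the Hamiltonian vector field of a
function `F` on `S`, so that `ω(v, X_F) = v F`.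

The graph of the multiplication being Lagrangian makes `ω` multiplicative: the value of `ω` on the
velocities of two products of curves is the sum of its values on the velocities of the factors
(`SymplecticGroupoid.form_mul`). Products of curves with identities show that the identities are
isotropic, that at an identity the tangent spaces to the `α`-fibre and to the `β`-fibre are
orthogonal, and that `ω(v, T(R_g) u) = ω(T(1 ∘ β)(v), u)` for `u ∈ A_m S`. By the first two facts
`(x, u) ↦ ω(T(1)(x), u)` is a perfect pairing of `T_m P` and `A_m S`
(`SymplecticGroupoid.pairing_surjective`), so that `-w` is bijective. By the third, the vector
fields `X_{f ∘ β}` are right-invariant, hence given by sections `H_f` of `A S`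
(`SymplecticGroupoid.rightInvariantField_hamiltonianSection`). They control everything else:

* `{f ∘ β, g ∘ β}` is constant along the `β`-fibres, which gives the Poisson structure on `P`.
* `⟨-w(x), H_f⟩ = ω(T(1)(x), X_{f ∘ β}) = df(x)`, i.e. `ℓ_{H_f} ∘ (-w) = ℓ_df`. A map into a tangent
  bundle is smooth if its composites with the projection and the `ℓ_df` are
  (`contMDiffAt_tangentBundle_of_dirDeriv`), so `(-w)⁻¹` is smooth.
* `[H_f, H_g] = H_{f, g}`, and `T(β)` maps `H_f` to the Hamiltonian vector field of `f` on `P`.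

Transport the tangent lift along `-w` to a Poisson structure on `A* S`. For the sections `H_f`, the
equations which characterize the Lie-Poisson structure become those which characterize the tangent
lift. Both sides of these equations differ by expressions which are linear over functions in the
sections, and every section agrees at a given point with some `H_f`, so they hold for all sections
(`SymplecticGroupoid.isLiePoisson_transport`). Conversely `-w` carries any Lie-Poisson structure
back to a tangent lift, so its uniqueness follows from that of the tangent lift.

The existence and uniqueness of the tangent lift are instances of a general fact
(`PoissonGenerators.poisson`): a Poisson structure is determined by the brackets of functions whose
differentials span, and brackets prescribed on a Lie algebra of such functions extend, provided that
the value of `[j, k]` at a point depends on `j` only through its differential there. For the tangent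
lift the functions are the `f ∘ p + ℓ_dg`.

Smoothness and tangency on the groupoid are handled through curves (`HasVelocity`), using the normal
form of submersions (`exists_submersion_normalForm`).
-/

noncomputable section

/-! ### Smooth functions with prescribed germs -/

/-- Hadamard's lemma: `H y = ∫₀¹ F'(a + t (y - a)) dt`. -/
theorem exists_contDiff_hadamard {E : Type*} [NormedAddCommGroup E] [NormedSpace ℝ E]
    {F : E → ℝ} (hF : ContDiff ℝ ∞ F) (a : E) :
    ∃ H : E → (E →L[ℝ] ℝ), ContDiff ℝ ∞ H ∧ H a = fderiv ℝ F a ∧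
      ∀ y, F y = F a + H y (y - a) := by
  have hF' : ContDiff ℝ ∞ (fderiv ℝ F) := hF.fderiv_right (by simp)
  let χ : ContDiffBump (0 : ℝ) := ⟨1, 2, one_pos, one_lt_two⟩
  let f : ℝ → ℝ := indicator (Icc 0 1) 1
  let g : E → ℝ → (E →L[ℝ] ℝ) := fun y s ↦ χ s • fderiv ℝ F (a - s • (y - a))
  -- The parametric integral is a convolution at `0`; the cutoff `χ` gives compact support.
  have hg : ContDiff ℝ ∞ (fun q : E × ℝ ↦ g q.1 q.2) := by
    refine (χ.contDiff.comp contDiff_snd).smul (hF'.comp ?_)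
    fun_prop
  have hconv := MeasureTheory.contDiffOn_convolution_right_with_param (μ := MeasureTheory.volume)
    (n := (⊤ : ℕ∞)) (ContinuousLinearMap.lsmul ℝ ℝ : ℝ →L[ℝ] (E →L[ℝ] ℝ) →L[ℝ] (E →L[ℝ] ℝ))
    (f := f) (g := g) isOpen_univ (isCompact_closedBall (0 : ℝ) 2)
    (fun y s _ hs ↦ by
      have : χ s = 0 := χ.zero_of_le_dist (by
        have : 2 < |s| := by simpa using hs
        simpa [χ] using this.le)
      simp [g, this])
    ((MeasureTheory.integrable_indicator_iff measurableSet_Icc).2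
      (MeasureTheory.integrableOn_const (by simp))).locallyIntegrable
    hg.contDiffOn
  have hcontd : ∀ y : E, Continuous fun t : ℝ ↦ fderiv ℝ F (a + t • (y - a)) := fun y ↦
    hF'.continuous.comp (by fun_prop)
  have hH : ContDiff ℝ ∞ fun y : E ↦ ∫ t in (0 : ℝ)..1, fderiv ℝ F (a + t • (y - a)) := by
    rw [univ_prod_univ, contDiffOn_univ] at hconv
    have h2 := hconv.comp (contDiff_prodMk_left (0 : ℝ))
    convert h2 using 1
    funext y
    simp only [Function.comp_apply, MeasureTheory.convolution_def]
    rw [intervalIntegral.integral_of_le zero_le_one, ← MeasureTheory.integral_Icc_eq_integral_Ioc,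
      ← MeasureTheory.integral_indicator measurableSet_Icc]
    congr 1
    funext t
    by_cases ht : t ∈ Icc (0 : ℝ) 1
    · have h3 : χ (0 - t) = 1 := χ.one_of_mem_closedBall (by
        simpa [Metric.mem_closedBall, χ, abs_of_nonneg ht.1] using ht.2)
      rw [indicator_of_mem ht]
      simp only [f, indicator_of_mem ht, g, h3]
      simp
    · rw [indicator_of_notMem ht]
      simp [f, indicator_of_notMem ht]
  refine ⟨_, hH, by simp, fun y ↦ ?_⟩
  have h4 : ∫ t in (0 : ℝ)..1, fderiv ℝ F (a + t • (y - a)) (y - a) = F y - F a := by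
    have h5 := intervalIntegral.integral_eq_sub_of_hasDerivAt (a := (0 : ℝ)) (b := 1)
      (f := fun t : ℝ ↦ F (a + t • (y - a)))
      (f' := fun t : ℝ ↦ fderiv ℝ F (a + t • (y - a)) (y - a)) (fun t _ ↦ ?_)
      ((hcontd y).clm_apply continuous_const).continuousOn.intervalIntegrable
    · simpa using h5
    · have h6 : HasDerivAt (fun t : ℝ ↦ a + t • (y - a)) (y - a) t := by
        simpa using ((hasDerivAt_id t).smul_const (y - a)).const_add a
      exact ((hF.differentiable (by simp) _).hasFDerivAt).comp_hasDerivAt t h6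
  rw [ContinuousLinearMap.intervalIntegral_apply ((hcontd y).intervalIntegrable _ _), h4]
  ring

section

variable {E H : Type*} [NormedAddCommGroup E] [NormedSpace ℝ E] [FiniteDimensional ℝ E]
  [TopologicalSpace H] {I : ModelWithCorners ℝ E H} {M : Type*} [TopologicalSpace M]
  [ChartedSpace H M] [IsManifold I ∞ M]

/-- The differential at `u` of a smooth function, as a linear form on the model space: the
derivative at `u` in the preferred chart there. It is `mfderiv` without its dependent type. -/
def differentialAt [I.Boundaryless] (u : M) : C^∞⟮I, M; ℝ⟯ →ₗ[ℝ] (E →L[ℝ] ℝ) where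
  toFun F := mfderiv I 𝓘(ℝ, ℝ) F u
  map_add' F G := mfderiv_add (F.contMDiff.mdifferentiableAt (by simp))
    (G.contMDiff.mdifferentiableAt (by simp))
  map_smul' c F := const_smul_mfderiv (F.contMDiff.mdifferentiableAt (by simp)) c

theorem differentialAt_eq_fderiv [I.Boundaryless] (u : M) (F : C^∞⟮I, M; ℝ⟯) :
    differentialAt u F =
      fderiv ℝ (fun y ↦ F ((extChartAt I u).symm y)) (extChartAt I u u) := by
  have h : mfderiv I 𝓘(ℝ, ℝ) F u =
      fderivWithin ℝ (writtenInExtChartAt I 𝓘(ℝ, ℝ) u F) (range I) (extChartAt I u u) :=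
    (F.contMDiff.mdifferentiableAt (by simp) : MDifferentiableAt I 𝓘(ℝ, ℝ) F u).mfderiv
  refine h.trans ?_
  rw [I.range_eq_univ, fderivWithin_univ]
  rfl

theorem differentialAt_one [I.Boundaryless] (u : M) :
    differentialAt u (1 : C^∞⟮I, M; ℝ⟯) = 0 := by
  rw [differentialAt_eq_fderiv]
  simp

theorem differentialAt_mul [I.Boundaryless] (u : M) (F G : C^∞⟮I, M; ℝ⟯) :
    differentialAt u (F * G) = F u • differentialAt u G + G u • differentialAt u F :=
  ((F.contMDiff.mdifferentiableAt (by simp)).hasMFDerivAt.mul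
    (G.contMDiff.mdifferentiableAt (by simp)).hasMFDerivAt).mfderiv

section

variable [T2Space M]

theorem exists_contMDiffMap_eventuallyEq {G : Type*} [NormedAddCommGroup G] [NormedSpace ℝ G]
    {c : M} {f : M → G} (hf : ContMDiffOn I 𝓘(ℝ, G) ∞ f (chartAt H c).source) :
    ∃ F : C^∞⟮I, M; 𝓘(ℝ, G), G⟯, F =ᶠ[𝓝 c] f := by
  let χ : SmoothBumpFunction I c := Classical.arbitrary _
  refine ⟨⟨_, χ.contMDiff_smul hf⟩, ?_⟩
  filter_upwards [χ.eventuallyEq_one] with x hx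
  show χ x • f x = f x
  rw [hx, Pi.one_apply, one_smul]

/-- Linear coordinates near a point extend to global smooth functions. -/
theorem exists_contMDiffMap_coord (c : M) (l : E →L[ℝ] ℝ) :
    ∃ F : C^∞⟮I, M; ℝ⟯, F =ᶠ[𝓝 c] fun x ↦ l (extChartAt I c x) :=
  exists_contMDiffMap_eventuallyEq
    (l.contDiff.contMDiff.comp_contMDiffOn (contMDiffOn_extChartAt (x := c)))

/-- A derivation at `u` of the algebra of smooth functions kills every function whose differential
vanishes at `u`. -/
theorem derivation_eq_zero_of_differentialAt_eq_zero [I.Boundaryless] {u : M}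
    (D : C^∞⟮I, M; ℝ⟯ →ₗ[ℝ] ℝ) (hD : ∀ f g, D (f * g) = f u * D g + D f * g u)
    (F : C^∞⟮I, M; ℝ⟯) (hF : differentialAt u F = 0) : D F = 0 := by
  have hD1 : D 1 = 0 := by
    have := hD 1 1
    simp only [mul_one, ContMDiffMap.coe_one, Pi.one_apply, one_mul] at this
    linarith
  -- It suffices to treat functions vanishing at `u`.
  suffices h : ∀ F : C^∞⟮I, M; ℝ⟯, F u = 0 → differentialAt u F = 0 → D F = 0 by
    have h1 : D (F - F u • (1 : C^∞⟮I, M; ℝ⟯)) = 0 := by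
      refine h _ (by simp) ?_
      rw [map_sub, map_smul, differentialAt_one, hF, smul_zero, sub_zero]
    simpa [hD1] using h1
  clear hF F
  intro F hFu hF
  let χ : SmoothBumpFunction I u := Classical.arbitrary _
  set φ := extChartAt I u
  have hball : Metric.closedBall (φ u) χ.rOut ⊆ φ.target := by
    have h := χ.closedBall_subset
    rwa [I.range_eq_univ, inter_univ] at h
  have hsymm : ContDiffOn ℝ ∞ (fun y ↦ F (φ.symm y)) φ.target := by
    rw [← contMDiffOn_iff_contDiffOn]
    exact F.contMDiff.comp_contMDiffOn (contMDiffOn_extChartAt_symm u)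
  have hopen : IsOpen φ.target := isOpen_extChartAt_target u
  -- The function `F` in the chart, cut off to be defined on the whole model space.
  let K : E → ℝ := fun y ↦ χ.toContDiffBump y * F (φ.symm y)
  have hK : ContDiff ℝ ∞ K := by
    rw [contDiff_iff_contDiffAt]
    intro y
    by_cases hy : y ∈ Metric.closedBall (φ u) χ.rOut
    · exact χ.toContDiffBump.contDiffAt.mul (hsymm.contDiffAt (hopen.mem_nhds (hball hy)))
    · have h0 : K =ᶠ[𝓝 y] fun _ ↦ 0 := by
        filter_upwards [Metric.isClosed_closedBall.isOpen_compl.mem_nhds hy] with z hz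
        have : χ.toContDiffBump z = 0 := χ.toContDiffBump.zero_of_le_dist (by
          exact (not_le.1 fun h ↦ hz (Metric.mem_closedBall.2 h)).le)
        exact mul_eq_zero_of_left this _
      exact contDiffAt_const.congr_of_eventuallyEq h0
  have hKd : fderiv ℝ K (φ u) = 0 := by
    have h1 : K =ᶠ[𝓝 (φ u)] fun y ↦ F (φ.symm y) := by
      filter_upwards [χ.toContDiffBump.eventuallyEq_one] with y hy
      simp only [K]
      rw [hy]; simp
    rw [h1.fderiv_eq, ← differentialAt_eq_fderiv, hF]
  obtain ⟨H', hH', hH'u, hKH⟩ := exists_contDiff_hadamard hK (φ u)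
  have hK0 : K (φ u) = 0 := by
    simp only [K, φ]
    rw [extChartAt_to_inv, hFu, mul_zero]
  let b := Module.finBasis ℝ E
  have hφ : ContMDiffOn I 𝓘(ℝ, E) ∞ φ (chartAt H u).source := contMDiffOn_extChartAt
  let c : Fin (Module.finrank ℝ E) → (E →L[ℝ] ℝ) := fun i ↦
    LinearMap.toContinuousLinearMap (b.coord i)
  let U : Fin (Module.finrank ℝ E) → C^∞⟮I, M; ℝ⟯ := fun i ↦
    ⟨fun x ↦ χ x • c i (φ x - φ u), χ.contMDiff_smul
      (((c i).contDiff.comp (contDiff_id.sub contDiff_const)).contMDiff.comp_contMDiffOn hφ)⟩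
  let W : Fin (Module.finrank ℝ E) → C^∞⟮I, M; ℝ⟯ := fun i ↦
    ⟨fun x ↦ χ x • H' (φ x) (b i), χ.contMDiff_smul
      ((hH'.clm_apply contDiff_const).contMDiff.comp_contMDiffOn hφ)⟩
  let X : C^∞⟮I, M; ℝ⟯ := ⟨χ, χ.contMDiff⟩
  have hUu : ∀ i, U i u = 0 := fun i ↦ by
    show χ u • c i (φ u - φ u) = 0
    simp
  have hWu : ∀ i, W i u = 0 := fun i ↦ by
    show χ u • H' (φ u) (b i) = 0
    rw [hH'u, hKd]; simp
  -- Cut off by `χ³`, Hadamard's lemma writes `F` as a sum of products of functions vanishing at `u`.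
  have hprod : X * X * X * F = ∑ i, U i * W i := by
    ext x
    have hsum : (∑ i, U i * W i) x = ∑ i, U i x * W i x := by
      have := map_sum (ContMDiffMap.evalRingHom (n := ∞) (I := I) (R := ℝ) x) (fun i ↦ U i * W i)
        Finset.univ
      exact this
    rw [hsum]
    show χ x * χ x * χ x * F x = ∑ i, (χ x * c i (φ x - φ u)) * (χ x * H' (φ x) (b i))
    by_cases hx : x ∈ (chartAt H u).source
    · have h1 := hKH (φ x)
      rw [hK0, zero_add] at h1
      have h2 : φ x - φ u = ∑ i, c i (φ x - φ u) • b i := (b.sum_repr _).symm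
      have h3 : K (φ x) = χ x * F x := by
        simp only [K]
        rw [φ.left_inv (by simpa [φ] using hx), χ.eqOn_source hx]
        rfl
      rw [h3] at h1
      have h4 : χ x * F x = ∑ i, c i (φ x - φ u) * H' (φ x) (b i) := by
        rw [h1]
        conv_lhs => rw [h2]
        simp
      calc χ x * χ x * χ x * F x = χ x * χ x * (χ x * F x) := by ring
        _ = _ := by
          rw [h4, Finset.mul_sum]
          exact Finset.sum_congr rfl fun i _ ↦ by ring
    · have : χ x = 0 := by
        by_contra h0
        exact hx (χ.support_subset_source h0)
      simp [this]
  have h1 : D (X * X * X * F) = 0 := by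
    rw [hprod, map_sum]
    refine Finset.sum_eq_zero fun i _ ↦ ?_
    rw [hD, hUu, hWu]; ring
  rw [hD, hFu] at h1
  have hXu : (X * X * X) u = 1 := by
    show χ u * χ u * χ u = 1
    simp
  rw [hXu] at h1
  simpa using h1

end

/-- Near `u₀` the differential of a smooth function is a combination, with smooth coefficients, of
the differentials of functions which agree with the coordinates near `u₀`. -/
theorem exists_differentialAt_eq_sum [I.Boundaryless] {u₀ : M} {ι : Type*} [Fintype ι]
    (b : Module.Basis ι ℝ E) (c : ι → C^∞⟮I, M; ℝ⟯)
    (hc : ∀ i, c i =ᶠ[𝓝 u₀] fun x ↦ b.coord i (extChartAt I u₀ x)) (F : C^∞⟮I, M; ℝ⟯) :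
    ∃ a : ι → M → ℝ, (∀ i, ContMDiffAt I 𝓘(ℝ, ℝ) ∞ (a i) u₀) ∧
      ∀ᶠ u in 𝓝 u₀, differentialAt u F = ∑ i, a i u • differentialAt u (c i) := by
  set φ := extChartAt I u₀
  have hopen : IsOpen φ.target := isOpen_extChartAt_target u₀
  have hK : ContDiffOn ℝ ∞ (fun y ↦ F (φ.symm y)) φ.target := by
    rw [← contMDiffOn_iff_contDiffOn]
    exact F.contMDiff.comp_contMDiffOn (contMDiffOn_extChartAt_symm u₀)
  have hK' : ContDiffOn ℝ ∞ (fderiv ℝ fun y ↦ F (φ.symm y)) φ.target :=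
    hK.fderiv_of_isOpen hopen (by simp)
  have hφ : ContMDiffAt I 𝓘(ℝ, E) ∞ φ u₀ := contMDiffAt_extChartAt
  refine ⟨fun i u ↦ fderiv ℝ (fun y ↦ F (φ.symm y)) (φ u) (b i), fun i ↦ ?_, ?_⟩
  · have h1 : ContDiffAt ℝ ∞ (fun y ↦ fderiv ℝ (fun y ↦ F (φ.symm y)) y (b i)) (φ u₀) :=
      (hK'.contDiffAt (hopen.mem_nhds (mem_extChartAt_target u₀))).clm_apply contDiffAt_const
    exact h1.contMDiffAt.comp u₀ hφ
  · have hc' : ∀ᶠ u in 𝓝 u₀, ∀ i, c i =ᶠ[𝓝 u] fun x ↦ b.coord i (φ x) :=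
      eventually_all.2 fun i ↦ (hc i).eventually_nhds
    have hs : ∀ᶠ u in 𝓝 u₀, u ∈ (chartAt H u₀).source :=
      (chartAt H u₀).open_source.mem_nhds (mem_chart_source H u₀)
    filter_upwards [hc', hs] with u hu hus
    have hus' : u ∈ φ.source := by simpa [φ] using hus
    let T : E →L[ℝ] E := mfderiv I 𝓘(ℝ, E) φ u
    let l : ι → (E →L[ℝ] ℝ) := fun i ↦ LinearMap.toContinuousLinearMap (b.coord i)
    have hd : HasMFDerivAt I 𝓘(ℝ, E) φ u T := (mdifferentiableAt_extChartAt hus).hasMFDerivAt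
    have hci : ∀ i, differentialAt u (c i) = (l i).comp T := fun i ↦ by
      have h2 : HasMFDerivAt 𝓘(ℝ, E) 𝓘(ℝ, ℝ) (b.coord i) (φ u) (l i) :=
        (l i).hasFDerivAt.hasMFDerivAt
      exact ((h2.comp u hd).congr_of_eventuallyEq (hu i)).mfderiv
    have hFu : differentialAt u F =
        (fderiv ℝ (fun y ↦ F (φ.symm y)) (φ u)).comp T := by
      have h2 : HasMFDerivAt 𝓘(ℝ, E) 𝓘(ℝ, ℝ) (fun y ↦ F (φ.symm y)) (φ u)
          (fderiv ℝ (fun y ↦ F (φ.symm y)) (φ u)) :=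
        ((hK.contDiffAt (hopen.mem_nhds (φ.map_source hus'))).differentiableAt
          (by simp)).hasFDerivAt.hasMFDerivAt
      refine ((h2.comp u hd).congr_of_eventuallyEq ?_).mfderiv
      filter_upwards [(isOpen_extChartAt_source (I := I) u₀).mem_nhds hus'] with x hx
      exact congrArg F (φ.left_inv hx).symm
    simp only [hci, hFu]
    ext v
    have h3 : T v = ∑ i, l i (T v) • b i := (b.sum_repr (T v)).symm
    rw [ContinuousLinearMap.comp_apply]
    conv_lhs => rw [h3]
    simp [mul_comm]

end

/-! ### Poisson brackets determined by generators -/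

namespace PoissonStructure

variable {E H : Type*} [NormedAddCommGroup E] [NormedSpace ℝ E]
  [TopologicalSpace H] {I : ModelWithCorners ℝ E H} {M : Type*} [TopologicalSpace M]
  [ChartedSpace H M]

theorem ext_bracket {π₁ π₂ : PoissonStructure I M} (h : ∀ f g, π₁.bracket f g = π₂.bracket f g) :
    π₁ = π₂ := by
  cases π₁; cases π₂
  congr
  exact LinearMap.ext fun f ↦ LinearMap.ext fun g ↦ h f g

theorem bracket_swap (π₁ : PoissonStructure I M) (f g : C^∞⟮I, M; ℝ⟯) :
    π₁.bracket f g = -π₁.bracket g f := by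
  have h := π₁.bracket_self (f + g)
  simp only [map_add, LinearMap.add_apply, π₁.bracket_self, zero_add, add_zero] at h
  exact eq_neg_of_add_eq_zero_right h

theorem leibniz_left (π₁ : PoissonStructure I M) (f g h : C^∞⟮I, M; ℝ⟯) :
    π₁.bracket (f * g) h = f * π₁.bracket g h + π₁.bracket f h * g := by
  rw [bracket_swap, leibniz, bracket_swap _ g h, bracket_swap _ f h]
  ring

end PoissonStructure

/-- A Lie algebra `J` of generators for a Poisson bracket on `M`: a linear map `γ` from `J` to the
smooth functions such that every linear coordinate is, near the centre of the chart, of the form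
`γ j`, and such that `γ [j, k]` at a point depends on `j` only through the differential of `γ j`
there. -/
structure PoissonGenerators {E H : Type*} [NormedAddCommGroup E] [NormedSpace ℝ E]
    [FiniteDimensional ℝ E] [TopologicalSpace H] (I : ModelWithCorners ℝ E H) [I.Boundaryless]
    (M : Type*) [TopologicalSpace M] [ChartedSpace H M] [IsManifold I ∞ M] [T2Space M]
    (J : Type*) [AddCommGroup J] [Module ℝ J] where
  br : J →ₗ[ℝ] J →ₗ[ℝ] J
  br_self : ∀ j, br j j = 0
  br_jacobi : ∀ j k l, br j (br k l) + br k (br l j) + br l (br j k) = 0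
  γ : J →ₗ[ℝ] C^∞⟮I, M; ℝ⟯
  γ_br_eq_zero : ∀ u j k, differentialAt u (γ j) = 0 → γ (br j k) u = 0
  exists_coord : ∀ (u : M) (l : E →L[ℝ] ℝ), ∃ j, γ j =ᶠ[𝓝 u] fun x ↦ l (extChartAt I u x)

namespace PoissonGenerators

variable {E H : Type*} [NormedAddCommGroup E] [NormedSpace ℝ E] [FiniteDimensional ℝ E]
  [TopologicalSpace H] {I : ModelWithCorners ℝ E H} [I.Boundaryless] {M : Type*}
  [TopologicalSpace M] [ChartedSpace H M] [IsManifold I ∞ M] [T2Space M]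
  {J : Type*} [AddCommGroup J] [Module ℝ J] (Γ : PoissonGenerators I M J)

theorem br_swap (j k : J) : Γ.br j k = -Γ.br k j := by
  have h := Γ.br_self (j + k)
  simp only [map_add, LinearMap.add_apply, Γ.br_self, zero_add, add_zero] at h
  exact eq_neg_of_add_eq_zero_right h

/-- Locally every differential is a combination of the differentials of finitely many generators. -/
theorem exists_local_combination (u₀ : M) : ∃ c : Fin (Module.finrank ℝ E) → J,
    ∀ F : C^∞⟮I, M; ℝ⟯, ∃ a : Fin (Module.finrank ℝ E) → M → ℝ,
      (∀ i, ContMDiffAt I 𝓘(ℝ, ℝ) ∞ (a i) u₀) ∧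
      ∀ᶠ u in 𝓝 u₀, differentialAt u F = differentialAt u (Γ.γ (∑ i, a i u • c i)) := by
  let b := Module.finBasis ℝ E
  choose c hc using fun i ↦ Γ.exists_coord u₀ (LinearMap.toContinuousLinearMap (b.coord i))
  refine ⟨c, fun F ↦ ?_⟩
  obtain ⟨a, ha, h⟩ := exists_differentialAt_eq_sum b (fun i ↦ Γ.γ (c i)) hc F
  refine ⟨a, ha, h.mono fun u hu ↦ ?_⟩
  rw [hu]
  simp

theorem exists_rep (u : M) (F : C^∞⟮I, M; ℝ⟯) :
    ∃ j, differentialAt u (Γ.γ j) = differentialAt u F := by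
  obtain ⟨c, hc⟩ := Γ.exists_local_combination u
  obtain ⟨a, -, ha⟩ := hc F
  exact ⟨_, ha.self_of_nhds.symm⟩

/-- A generator with the same differential at `u` as `F`. -/
def rep (u : M) (F : C^∞⟮I, M; ℝ⟯) : J := (Γ.exists_rep u F).choose

theorem differentialAt_rep (u : M) (F : C^∞⟮I, M; ℝ⟯) :
    differentialAt u (Γ.γ (Γ.rep u F)) = differentialAt u F := (Γ.exists_rep u F).choose_spec

/-- The value at `u` of the bracket of two smooth functions. -/
def val (u : M) (F G : C^∞⟮I, M; ℝ⟯) : ℝ := Γ.γ (Γ.br (Γ.rep u F) (Γ.rep u G)) u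

theorem γ_br_congr {u : M} {j j' k k' : J}
    (hj : differentialAt u (Γ.γ j) = differentialAt u (Γ.γ j'))
    (hk : differentialAt u (Γ.γ k) = differentialAt u (Γ.γ k')) :
    Γ.γ (Γ.br j k) u = Γ.γ (Γ.br j' k') u := by
  have h1 := Γ.γ_br_eq_zero u (j - j') k (by rw [map_sub, map_sub, hj, sub_self])
  have h2 := Γ.γ_br_eq_zero u (k - k') j' (by rw [map_sub, map_sub, hk, sub_self])
  rw [Γ.br_swap] at h2
  simp only [map_sub, map_neg, LinearMap.sub_apply, ContMDiffMap.coe_sub, ContMDiffMap.coe_neg,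
    Pi.sub_apply, Pi.neg_apply] at h1 h2
  linarith

theorem val_eq {u : M} {F G : C^∞⟮I, M; ℝ⟯} {j k : J}
    (hj : differentialAt u (Γ.γ j) = differentialAt u F)
    (hk : differentialAt u (Γ.γ k) = differentialAt u G) :
    Γ.val u F G = Γ.γ (Γ.br j k) u :=
  Γ.γ_br_congr (by rw [Γ.differentialAt_rep, hj]) (by rw [Γ.differentialAt_rep, hk])

theorem contMDiff_val (F G : C^∞⟮I, M; ℝ⟯) :
    ContMDiff I 𝓘(ℝ, ℝ) ∞ fun u ↦ Γ.val u F G := by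
  intro u₀
  obtain ⟨c, hc⟩ := Γ.exists_local_combination u₀
  obtain ⟨a, ha, hF⟩ := hc F
  obtain ⟨b, hb, hG⟩ := hc G
  have h1 : (fun u ↦ Γ.val u F G) =ᶠ[𝓝 u₀]
      fun u ↦ ∑ i, ∑ k, a i u * b k u * Γ.γ (Γ.br (c i) (c k)) u := by
    filter_upwards [hF, hG] with u hFu hGu
    rw [Γ.val_eq hFu.symm hGu.symm]
    let ev : J →ₗ[ℝ] ℝ :=
      { toFun := fun j ↦ Γ.γ j u
        map_add' := fun j k ↦ by simp
        map_smul' := fun r j ↦ by simp }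
    show ev _ = ∑ i, ∑ k, a i u * b k u * ev _
    simp only [map_sum, LinearMap.sum_apply, map_smul, LinearMap.smul_apply, smul_eq_mul, mul_assoc]
    rw [Finset.sum_comm]
    simp only [Finset.mul_sum]
    exact Finset.sum_congr rfl fun k _ ↦ Finset.sum_congr rfl fun i _ ↦ by ring
  refine ContMDiffAt.congr_of_eventuallyEq ?_ h1
  refine ContMDiffAt.sum fun i _ ↦ ContMDiffAt.sum fun k _ ↦ ?_
  exact ((ha i).mul (hb k)).mul ((Γ.γ (Γ.br (c i) (c k))).contMDiff.contMDiffAt)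

/-- The bracket of smooth functions determined by the brackets of the generators. -/
def bracket : C^∞⟮I, M; ℝ⟯ →ₗ[ℝ] C^∞⟮I, M; ℝ⟯ →ₗ[ℝ] C^∞⟮I, M; ℝ⟯ :=
  LinearMap.mk₂ ℝ (fun F G ↦ ⟨fun u ↦ Γ.val u F G, Γ.contMDiff_val F G⟩)
    (fun F F' G ↦ by
      ext u
      show Γ.val u (F + F') G = Γ.val u F G + Γ.val u F' G
      rw [Γ.val_eq (j := Γ.rep u F + Γ.rep u F') (k := Γ.rep u G)
        (by simp only [map_add, Γ.differentialAt_rep]) (Γ.differentialAt_rep u G)]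
      simp [val])
    (fun r F G ↦ by
      ext u
      show Γ.val u (r • F) G = r * Γ.val u F G
      rw [Γ.val_eq (j := r • Γ.rep u F) (k := Γ.rep u G)
        (by simp only [map_smul, Γ.differentialAt_rep]) (Γ.differentialAt_rep u G)]
      simp [val])
    (fun F G G' ↦ by
      ext u
      show Γ.val u F (G + G') = Γ.val u F G + Γ.val u F G'
      rw [Γ.val_eq (j := Γ.rep u F) (k := Γ.rep u G + Γ.rep u G') (Γ.differentialAt_rep u F)
        (by simp only [map_add, Γ.differentialAt_rep])]
      simp [val])
    (fun r F G ↦ by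
      ext u
      show Γ.val u F (r • G) = r * Γ.val u F G
      rw [Γ.val_eq (j := Γ.rep u F) (k := r • Γ.rep u G) (Γ.differentialAt_rep u F)
        (by simp only [map_smul, Γ.differentialAt_rep])]
      simp [val])

theorem bracket_apply (F G : C^∞⟮I, M; ℝ⟯) (u : M) : Γ.bracket F G u = Γ.val u F G := rfl

theorem bracket_γ (j k : J) : Γ.bracket (Γ.γ j) (Γ.γ k) = Γ.γ (Γ.br j k) := by
  ext u
  exact Γ.val_eq rfl rfl

theorem bracket_self (F : C^∞⟮I, M; ℝ⟯) : Γ.bracket F F = 0 := by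
  ext u
  rw [bracket_apply, val, Γ.br_self]
  simp

theorem bracket_swap (F G : C^∞⟮I, M; ℝ⟯) : Γ.bracket F G = -Γ.bracket G F := by
  have h := Γ.bracket_self (F + G)
  simp only [map_add, LinearMap.add_apply, Γ.bracket_self, zero_add, add_zero] at h
  exact eq_neg_of_add_eq_zero_right h

theorem leibniz (F G K : C^∞⟮I, M; ℝ⟯) :
    Γ.bracket F (G * K) = G * Γ.bracket F K + Γ.bracket F G * K := by
  ext u
  show Γ.val u F (G * K) = G u * Γ.val u F K + Γ.val u F G * K u
  rw [Γ.val_eq (j := Γ.rep u F) (k := G u • Γ.rep u K + K u • Γ.rep u G)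
    (Γ.differentialAt_rep u F)
    (by simp only [map_add, map_smul, Γ.differentialAt_rep, differentialAt_mul])]
  simp [val, mul_comm]

/-- A derivation at a point which vanishes on the generators is zero. -/
theorem derivation_eq_zero {u : M} (D : C^∞⟮I, M; ℝ⟯ →ₗ[ℝ] ℝ)
    (hD : ∀ f g, D (f * g) = f u * D g + D f * g u) (hγ : ∀ j, D (Γ.γ j) = 0)
    (F : C^∞⟮I, M; ℝ⟯) : D F = 0 := by
  have h := derivation_eq_zero_of_differentialAt_eq_zero D hD (F - Γ.γ (Γ.rep u F))
    (by rw [map_sub, Γ.differentialAt_rep, sub_self])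
  rwa [map_sub, hγ, sub_zero] at h

theorem derivation_eq_zero' (D : C^∞⟮I, M; ℝ⟯ →ₗ[ℝ] C^∞⟮I, M; ℝ⟯)
    (hD : ∀ f g, D (f * g) = f * D g + D f * g) (hγ : ∀ j, D (Γ.γ j) = 0) : D = 0 := by
  ext F u
  let ev : C^∞⟮I, M; ℝ⟯ →ₗ[ℝ] ℝ :=
    { toFun := fun f ↦ f u, map_add' := fun _ _ ↦ rfl, map_smul' := fun _ _ ↦ rfl }
  refine Γ.derivation_eq_zero (u := u) (ev ∘ₗ D) (fun f g ↦ ?_) (fun j ↦ ?_) F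
  · rw [LinearMap.comp_apply, hD]; rfl
  · rw [LinearMap.comp_apply, hγ]; rfl

/-- The Jacobiator, as a linear map in its last argument. -/
def jacobiator (F G : C^∞⟮I, M; ℝ⟯) : C^∞⟮I, M; ℝ⟯ →ₗ[ℝ] C^∞⟮I, M; ℝ⟯ :=
  Γ.bracket F ∘ₗ Γ.bracket G - Γ.bracket G ∘ₗ Γ.bracket F - Γ.bracket (Γ.bracket F G)

theorem jacobiator_apply (F G K : C^∞⟮I, M; ℝ⟯) : Γ.jacobiator F G K =
    Γ.bracket F (Γ.bracket G K) + Γ.bracket G (Γ.bracket K F) +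
      Γ.bracket K (Γ.bracket F G) := by
  rw [Γ.bracket_swap K F, Γ.bracket_swap K (Γ.bracket F G)]
  simp only [jacobiator, LinearMap.sub_apply, LinearMap.comp_apply, map_neg]
  ring

theorem jacobiator_rotate (F G K : C^∞⟮I, M; ℝ⟯) :
    Γ.jacobiator F G K = Γ.jacobiator G K F := by
  simp only [jacobiator_apply]; ring

theorem jacobiator_mul (F G K L : C^∞⟮I, M; ℝ⟯) :
    Γ.jacobiator F G (K * L) = K * Γ.jacobiator F G L + Γ.jacobiator F G K * L := by
  simp only [jacobiator, LinearMap.sub_apply, LinearMap.comp_apply, Γ.leibniz, map_add]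
  ring

theorem jacobiator_eq_zero (F G K : C^∞⟮I, M; ℝ⟯) : Γ.jacobiator F G K = 0 := by
  -- The Jacobiator is a derivation in each argument: replace the generators one at a time.
  have h0 : ∀ j k l, Γ.jacobiator (Γ.γ j) (Γ.γ k) (Γ.γ l) = 0 := fun j k l ↦ by
    simp only [jacobiator_apply, bracket_γ, ← map_add, Γ.br_jacobi, map_zero]
  have h1 : ∀ j k F, Γ.jacobiator (Γ.γ j) (Γ.γ k) F = 0 := fun j k F ↦ by
    rw [Γ.derivation_eq_zero' _ (Γ.jacobiator_mul _ _) (h0 j k)]; rfl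
  have h2 : ∀ j F G, Γ.jacobiator (Γ.γ j) F G = 0 := fun j F G ↦ by
    rw [jacobiator_rotate, jacobiator_rotate, Γ.derivation_eq_zero' _ (Γ.jacobiator_mul _ _)
      fun k ↦ by rw [jacobiator_rotate, h1]]
    rfl
  rw [Γ.derivation_eq_zero' _ (Γ.jacobiator_mul F G) fun k ↦ by
    rw [jacobiator_rotate, jacobiator_rotate, h2]]
  rfl

/-- The Poisson structure determined by the brackets of the generators. -/
def poisson : PoissonStructure I M where
  bracket := Γ.bracket
  bracket_self := Γ.bracket_self
  jacobi F G K := by rw [← jacobiator_apply, jacobiator_eq_zero]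
  leibniz := Γ.leibniz

theorem poisson_γ (j k : J) : Γ.poisson.bracket (Γ.γ j) (Γ.γ k) = Γ.γ (Γ.br j k) := Γ.bracket_γ j k

/-- Two Poisson brackets which agree on generators are equal. -/
theorem eq_of_bracket_γ {π₁ π₂ : PoissonStructure I M}
    (h : ∀ j k, π₁.bracket (Γ.γ j) (Γ.γ k) = π₂.bracket (Γ.γ j) (Γ.γ k)) : π₁ = π₂ := by
  have key : ∀ F, (∀ j, π₁.bracket F (Γ.γ j) = π₂.bracket F (Γ.γ j)) →
      π₁.bracket F = π₂.bracket F := fun F hF ↦ by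
    have := Γ.derivation_eq_zero' (π₁.bracket F - π₂.bracket F)
      (fun f g ↦ by simp only [LinearMap.sub_apply, PoissonStructure.leibniz]; ring)
      (fun j ↦ by simp [hF])
    exact sub_eq_zero.1 this
  refine PoissonStructure.ext_bracket fun F G ↦ ?_
  rw [key F fun j ↦ ?_]
  rw [π₁.bracket_swap, π₂.bracket_swap, key (Γ.γ j) (h j)]

end PoissonGenerators

/-! ### Vector fields acting on functions -/

section

variable {E : Type*} [NormedAddCommGroup E] [NormedSpace ℝ E] [FiniteDimensional ℝ E]
  {M : Type*} [TopologicalSpace M] [ChartedSpace E M] [IsManifold 𝓘(ℝ, E) ∞ M]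

/-- The Lie bracket of vector fields acts on functions as the commutator of the derivatives. -/
theorem dirDeriv_mlieBracket {V W : ∀ x : M, TangentSpace 𝓘(ℝ, E) x} {f : M → ℝ} {x : M}
    (hV : MDifferentiableAt 𝓘(ℝ, E) 𝓘(ℝ, E).tangent (fun y ↦ (⟨y, V y⟩ : TangentBundle 𝓘(ℝ, E) M)) x)
    (hW : MDifferentiableAt 𝓘(ℝ, E) 𝓘(ℝ, E).tangent (fun y ↦ (⟨y, W y⟩ : TangentBundle 𝓘(ℝ, E) M)) x)
    (hf : ContMDiffAt 𝓘(ℝ, E) 𝓘(ℝ, ℝ) 2 f x) :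
    dirDeriv f x (VectorField.mlieBracket 𝓘(ℝ, E) V W x) =
      dirDeriv (fun y ↦ dirDeriv f y (W y)) x (V x) -
        dirDeriv (fun y ↦ dirDeriv f y (V y)) x (W x) := by
  set φ := extChartAt 𝓘(ℝ, E) x with hφ
  let B : M → (E →L[ℝ] E) := fun y ↦ mfderiv 𝓘(ℝ, E) 𝓘(ℝ, E) φ y
  let A : E → (E →L[ℝ] E) := fun y ↦ mfderivWithin 𝓘(ℝ, E) 𝓘(ℝ, E) φ.symm (range 𝓘(ℝ, E)) y
  have hx : x ∈ φ.source := mem_extChartAt_source x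
  have hso : IsOpen φ.source := isOpen_extChartAt_source x
  have hBA : ∀ y ∈ φ.source, (B y).comp (A (φ y)) = ContinuousLinearMap.id ℝ E := fun y hy ↦ by
    have h := mfderiv_extChartAt_comp_mfderivWithin_extChartAt_symm (I := 𝓘(ℝ, E)) (x := x)
      (φ.map_source hy)
    rw [← hφ] at h
    have h2 : φ.symm (φ y) = y := φ.left_inv hy
    have h3 : ∀ z, z = y → (B z).comp (A (φ y)) = ContinuousLinearMap.id ℝ E →
        (B y).comp (A (φ y)) = ContinuousLinearMap.id ℝ E := by rintro _ rfl h; exact h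
    exact h3 _ h2 h
  have hAinv : ∀ y ∈ φ.source, (A (φ y)).inverse = B y := fun y hy ↦ by
    obtain ⟨e, he⟩ : (A (φ y)).IsInvertible :=
      isInvertible_mfderivWithin_extChartAt_symm (φ.map_source hy)
    rw [← he, ContinuousLinearMap.inverse_equiv]
    have := hBA y hy
    rw [← he] at this
    ext v
    have h2 := DFunLike.congr_fun this (e.symm v)
    simpa using h2.symm
  have hBinv : ∀ v, B x ((B x).inverse v) = v := fun v ↦ by
    have hB : (B x).IsInvertible := isInvertible_mfderiv_extChartAt hx
    exact hB.self_apply_inverse v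
  -- Functions and vector fields in the chart.
  let g : E → ℝ := fun y ↦ f (φ.symm y)
  let Vh : E → E := fun y ↦ (A y).inverse (V (φ.symm y))
  let Wh : E → E := fun y ↦ (A y).inverse (W (φ.symm y))
  have hg : ContDiffAt ℝ 2 g (φ x) := by
    have h1 : ContMDiffAt 𝓘(ℝ, E) 𝓘(ℝ, E) 2 φ.symm (φ x) :=
      (contMDiffOn_extChartAt_symm x).contMDiffAt (extChartAt_target_mem_nhds x)
    have h2 : ContMDiffAt 𝓘(ℝ, E) 𝓘(ℝ, ℝ) 2 f (φ.symm (φ x)) := by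
      rw [φ.left_inv hx]; exact hf
    exact (h2.comp (φ x) h1).contDiffAt
  have hVh : DifferentiableAt ℝ Vh (φ x) := by
    have h : DifferentiableWithinAt ℝ Vh (φ.symm ⁻¹' univ ∩ range 𝓘(ℝ, E)) (φ x) :=
      hV.mdifferentiableWithinAt (s := univ)
        |>.differentiableWithinAt_mpullbackWithin_vectorField
    rwa [preimage_univ, univ_inter, 𝓘(ℝ, E).range_eq_univ, differentiableWithinAt_univ] at h
  have hWh : DifferentiableAt ℝ Wh (φ x) := by
    have h : DifferentiableWithinAt ℝ Wh (φ.symm ⁻¹' univ ∩ range 𝓘(ℝ, E)) (φ x) :=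
      hW.mdifferentiableWithinAt (s := univ)
        |>.differentiableWithinAt_mpullbackWithin_vectorField
    rwa [preimage_univ, univ_inter, 𝓘(ℝ, E).range_eq_univ, differentiableWithinAt_univ] at h
  have hchain : ∀ (k : E → ℝ) (h : M → ℝ) (y : M) (v : E), y ∈ φ.source →
      DifferentiableAt ℝ k (φ y) → h =ᶠ[𝓝 y] (fun z ↦ k (φ z)) →
      dirDeriv h y v = fderiv ℝ k (φ y) (B y v) := fun k h y v hy hk hh ↦ by
    have h1 : HasMFDerivAt 𝓘(ℝ, E) 𝓘(ℝ, E) φ y (B y) :=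
      (mdifferentiableAt_extChartAt (by simpa [φ] using hy)).hasMFDerivAt
    have h2 := (hk.hasFDerivAt.hasMFDerivAt.comp y h1).congr_of_eventuallyEq hh
    exact DFunLike.congr_fun h2.mfderiv v
  have hfg : ∀ y ∈ φ.source, f =ᶠ[𝓝 y] fun z ↦ g (φ z) := fun y hy ↦ by
    filter_upwards [hso.mem_nhds hy] with z hz
    exact congrArg f (φ.left_inv hz).symm
  have hgd : ∀ᶠ y in 𝓝 x, y ∈ φ.source ∧ DifferentiableAt ℝ g (φ y) := by
    have hs : ∀ᶠ y in 𝓝 x, y ∈ φ.source := hso.mem_nhds hx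
    refine hs.and ?_
    have h1 := hg.eventually (by simp)
    exact (continuousAt_extChartAt (I := 𝓘(ℝ, E)) x).eventually
      (h1.mono fun y hy ↦ hy.differentiableAt (by simp))
  have hder : ∀ U : ∀ x : M, TangentSpace 𝓘(ℝ, E) x,
      (fun y ↦ dirDeriv f y (U y)) =ᶠ[𝓝 x]
        fun y ↦ fderiv ℝ g (φ y) ((A (φ y)).inverse (U (φ.symm (φ y)))) := fun U ↦ by
    filter_upwards [hgd] with y hy
    rw [hchain g f y (U y) hy.1 hy.2 (hfg y hy.1), hAinv y hy.1, φ.left_inv hy.1]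
  have hg' : DifferentiableAt ℝ (fderiv ℝ g) (φ x) :=
    (hg.fderiv_right (m := 1) (by norm_num)).differentiableAt (by simp)
  have hVx : Vh (φ x) = B x (V x) := by
    simp only [Vh]; rw [hAinv x hx, φ.left_inv hx]
  have hWx : Wh (φ x) = B x (W x) := by
    simp only [Wh]; rw [hAinv x hx, φ.left_inv hx]
  refine (hchain g f x _ hx (hg.differentiableAt (by simp)) (hfg x hx)).trans ?_
  rw [hchain (fun y ↦ fderiv ℝ g y (Wh y)) _ x (V x) hx (hg'.clm_apply hWh) (hder W),
    hchain (fun y ↦ fderiv ℝ g y (Vh y)) _ x (W x) hx (hg'.clm_apply hVh) (hder V), ← hVx, ← hWx,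
    fderiv_clm_apply hg' hWh, fderiv_clm_apply hg' hVh]
  have hbr : B x (VectorField.mlieBracket 𝓘(ℝ, E) V W x) =
      VectorField.lieBracket ℝ Vh Wh (φ x) := by
    have h1 : VectorField.mlieBracket 𝓘(ℝ, E) V W x = (B x).inverse
        (VectorField.lieBracketWithin ℝ Vh Wh (φ.symm ⁻¹' univ ∩ range 𝓘(ℝ, E)) (φ x)) := rfl
    rw [preimage_univ, univ_inter, 𝓘(ℝ, E).range_eq_univ, VectorField.lieBracketWithin_univ] at h1
    rw [h1, hBinv]
  have hsymm := (hg.isSymmSndFDerivAt (by simp)).eq (Vh (φ x)) (Wh (φ x))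
  rw [hbr, VectorField.lieBracket_eq]
  simp only [map_sub, add_apply, ContinuousLinearMap.comp_apply,
    ContinuousLinearMap.flip_apply]
  linarith

theorem trivializationAt_tangent_snd {x₀ : M} {z : TangentBundle 𝓘(ℝ, E) M}
    (hz : z.1 ∈ (chartAt E x₀).source) :
    (trivializationAt E (TangentSpace 𝓘(ℝ, E) : M → Type _) x₀ z).2 =
      mfderiv 𝓘(ℝ, E) 𝓘(ℝ, E) (extChartAt 𝓘(ℝ, E) x₀) z.1 z.2 := by
  refine Eq.trans ?_
    (DFunLike.congr_fun (TangentBundle.continuousLinearMapAt_trivializationAt hz) z.2)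
  rw [Trivialization.continuousLinearMapAt_apply, Trivialization.coe_linearMapAt_of_mem _ (by simpa)]

theorem dirDeriv_eq_of_eventuallyEq_coord {x₀ x : M} {f : M → ℝ} {l : E →L[ℝ] ℝ}
    (hf : f =ᶠ[𝓝 x] fun y ↦ l (extChartAt 𝓘(ℝ, E) x₀ y)) (hx : x ∈ (chartAt E x₀).source)
    (v : TangentSpace 𝓘(ℝ, E) x) :
    dirDeriv f x v = l (mfderiv 𝓘(ℝ, E) 𝓘(ℝ, E) (extChartAt 𝓘(ℝ, E) x₀) x v) := by
  have h1 : HasMFDerivAt 𝓘(ℝ, E) 𝓘(ℝ, E) (extChartAt 𝓘(ℝ, E) x₀) x _ :=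
    (mdifferentiableAt_extChartAt hx).hasMFDerivAt
  have h2 : HasMFDerivAt 𝓘(ℝ, E) 𝓘(ℝ, ℝ) l (extChartAt 𝓘(ℝ, E) x₀ x) l :=
    l.hasFDerivAt.hasMFDerivAt
  exact DFunLike.congr_fun ((h2.comp x h1).congr_of_eventuallyEq hf).mfderiv v

section

variable [T2Space M]

/-- A map into a tangent bundle is smooth as soon as its projection is, and its composites with the
fibrewise linear functions `ℓ_df` are. -/
theorem contMDiffAt_tangentBundle_of_dirDeriv {E' H' : Type*} [NormedAddCommGroup E']
    [NormedSpace ℝ E'] [TopologicalSpace H'] {I' : ModelWithCorners ℝ E' H'} {N : Type*}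
    [TopologicalSpace N] [ChartedSpace H' N] {Ψ : N → TangentBundle 𝓘(ℝ, E) M} {n₀ : N}
    (h1 : ContMDiffAt I' 𝓘(ℝ, E) ∞ (fun n ↦ (Ψ n).1) n₀)
    (h2 : ∀ f : C^∞⟮𝓘(ℝ, E), M; ℝ⟯,
      ContMDiffAt I' 𝓘(ℝ, ℝ) ∞ (fun n ↦ dirDeriv f (Ψ n).1 (Ψ n).2) n₀) :
    ContMDiffAt I' 𝓘(ℝ, E).tangent ∞ Ψ n₀ := by
  refine contMDiffAt_totalSpace.2 ⟨h1, ?_⟩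
  let b := Module.finBasis ℝ E
  let l : Fin (Module.finrank ℝ E) → (E →L[ℝ] ℝ) := fun i ↦
    LinearMap.toContinuousLinearMap (b.coord i)
  choose f hf using fun i ↦ exists_contMDiffMap_coord (I := 𝓘(ℝ, E)) (Ψ n₀).1 (l i)
  have hs : ∀ᶠ n in 𝓝 n₀, (Ψ n).1 ∈ (chartAt E (Ψ n₀).1).source :=
    h1.continuousAt.eventually ((chartAt E (Ψ n₀).1).open_source.mem_nhds (mem_chart_source E _))
  have hf' : ∀ᶠ n in 𝓝 n₀, ∀ i, f i =ᶠ[𝓝 (Ψ n).1]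
      fun y ↦ l i (extChartAt 𝓘(ℝ, E) (Ψ n₀).1 y) :=
    eventually_all.2 fun i ↦ h1.continuousAt.eventually (hf i).eventually_nhds
  have h3 : (fun n ↦ (trivializationAt E (TangentSpace 𝓘(ℝ, E) : M → Type _) (Ψ n₀).1 (Ψ n)).2)
      =ᶠ[𝓝 n₀] fun n ↦ ∑ i, dirDeriv (f i) (Ψ n).1 (Ψ n).2 • b i := by
    filter_upwards [hs, hf'] with n hn hfn
    rw [trivializationAt_tangent_snd hn]
    refine (b.sum_repr _).symm.trans (Finset.sum_congr rfl fun i _ ↦ ?_)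
    rw [dirDeriv_eq_of_eventuallyEq_coord (hfn i) hn]
    rfl
  refine ContMDiffAt.congr_of_eventuallyEq ?_ h3
  exact ContMDiffAt.sum fun i _ ↦ (h2 (f i)).smul contMDiffAt_const

/-- Tangent vectors are determined by the derivatives of smooth functions. -/
theorem eq_of_dirDeriv_eq {x : M} {v w : TangentSpace 𝓘(ℝ, E) x}
    (h : ∀ f : C^∞⟮𝓘(ℝ, E), M; ℝ⟯, dirDeriv f x v = dirDeriv f x w) : v = w := by
  have hinj : Function.Injective (mfderiv 𝓘(ℝ, E) 𝓘(ℝ, E) (extChartAt 𝓘(ℝ, E) x) x) :=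
    (isInvertible_mfderiv_extChartAt (mem_extChartAt_source x)).injective
  refine hinj ?_
  let b := Module.finBasis ℝ E
  refine b.ext_elem fun i ↦ ?_
  obtain ⟨f, hf⟩ := exists_contMDiffMap_coord (I := 𝓘(ℝ, E)) x
    (LinearMap.toContinuousLinearMap (b.coord i))
  have h1 := h f
  rw [dirDeriv_eq_of_eventuallyEq_coord hf (mem_chart_source E x),
    dirDeriv_eq_of_eventuallyEq_coord hf (mem_chart_source E x)] at h1
  exact h1

end

/-- The derivative `V f` of a smooth function along a smooth vector field. -/
def lieDerivative (V : Cₛ^∞⟮𝓘(ℝ, E); E, (TangentSpace 𝓘(ℝ, E) : M → Type _)⟯) :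
    C^∞⟮𝓘(ℝ, E), M; ℝ⟯ →ₗ[ℝ] C^∞⟮𝓘(ℝ, E), M; ℝ⟯ where
  toFun f := (differentialFunction f).comp ⟨_, V.contMDiff⟩
  map_add' f g := by
    ext x
    exact DFunLike.congr_fun (map_add (differentialAt (I := 𝓘(ℝ, E)) x) f g) (V x)
  map_smul' r f := by
    ext x
    exact DFunLike.congr_fun (map_smul (differentialAt (I := 𝓘(ℝ, E)) x) r f) (V x)

theorem lieDerivative_apply (V : Cₛ^∞⟮𝓘(ℝ, E); E, (TangentSpace 𝓘(ℝ, E) : M → Type _)⟯)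
    (f : C^∞⟮𝓘(ℝ, E), M; ℝ⟯) (x : M) : lieDerivative V f x = dirDeriv f x (V x) := rfl

theorem dirDeriv_mul (f g : C^∞⟮𝓘(ℝ, E), M; ℝ⟯) (x : M) (v : TangentSpace 𝓘(ℝ, E) x) :
    dirDeriv (f * g : C^∞⟮𝓘(ℝ, E), M; ℝ⟯) x v = f x * dirDeriv g x v + dirDeriv f x v * g x :=
  (DFunLike.congr_fun (differentialAt_mul (I := 𝓘(ℝ, E)) x f g) v).trans
    (congrArg _ (mul_comm _ _))

theorem lieDerivative_mul (V : Cₛ^∞⟮𝓘(ℝ, E); E, (TangentSpace 𝓘(ℝ, E) : M → Type _)⟯)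
    (f g : C^∞⟮𝓘(ℝ, E), M; ℝ⟯) :
    lieDerivative V (f * g) = f * lieDerivative V g + lieDerivative V f * g := by
  ext x
  exact dirDeriv_mul f g x (V x)

/-- The Lie bracket of smooth vector fields. -/
def vectorBracket (V W : Cₛ^∞⟮𝓘(ℝ, E); E, (TangentSpace 𝓘(ℝ, E) : M → Type _)⟯) :
    Cₛ^∞⟮𝓘(ℝ, E); E, (TangentSpace 𝓘(ℝ, E) : M → Type _)⟯ where
  toFun := VectorField.mlieBracket 𝓘(ℝ, E) V W
  contMDiff_toFun x := by
    have : IsManifold 𝓘(ℝ, E) (((⊤ : ℕ∞) : WithTop ℕ∞) + 1) M := by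
      simpa using (inferInstance : IsManifold 𝓘(ℝ, E) ∞ M)
    have : IsManifold 𝓘(ℝ, E) (minSmoothness ℝ 2) M := by
      rw [minSmoothness_of_isRCLikeNormedField]; infer_instance
    exact (V.contMDiff x).mlieBracket_vectorField (m := (⊤ : ℕ∞)) (n := (⊤ : ℕ∞)) (W.contMDiff x)
      (by simp)

theorem vectorBracket_apply (V W : Cₛ^∞⟮𝓘(ℝ, E); E, (TangentSpace 𝓘(ℝ, E) : M → Type _)⟯)
    (x : M) : vectorBracket V W x = VectorField.mlieBracket 𝓘(ℝ, E) V W x := rfl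

theorem lieDerivative_vectorBracket
    (V W : Cₛ^∞⟮𝓘(ℝ, E); E, (TangentSpace 𝓘(ℝ, E) : M → Type _)⟯) (f : C^∞⟮𝓘(ℝ, E), M; ℝ⟯) :
    lieDerivative (vectorBracket V W) f =
      lieDerivative V (lieDerivative W f) - lieDerivative W (lieDerivative V f) := by
  ext x
  exact dirDeriv_mlieBracket (V.contMDiff.mdifferentiableAt (by simp))
    (W.contMDiff.mdifferentiableAt (by simp)) (f.contMDiff.contMDiffAt.of_le ENat.LEInfty.out)

/-- If the vector fields `V`, `W` are related to `V'`, `W'` by `ρ` near a point, then so are their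
Lie brackets at this point. -/
theorem mfderiv_vectorBracket_of_related {E' : Type*} [NormedAddCommGroup E'] [NormedSpace ℝ E']
    [FiniteDimensional ℝ E'] {N : Type*} [TopologicalSpace N] [ChartedSpace E' N]
    [IsManifold 𝓘(ℝ, E') ∞ N] [T2Space N] {ρ : M → N} {x : M}
    (hρ : ContMDiffAt 𝓘(ℝ, E) 𝓘(ℝ, E') ∞ ρ x)
    (V W : Cₛ^∞⟮𝓘(ℝ, E); E, (TangentSpace 𝓘(ℝ, E) : M → Type _)⟯)
    (V' W' : Cₛ^∞⟮𝓘(ℝ, E'); E', (TangentSpace 𝓘(ℝ, E') : N → Type _)⟯)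
    (hV : ∀ᶠ y in 𝓝 x, mfderiv 𝓘(ℝ, E) 𝓘(ℝ, E') ρ y (V y) = V' (ρ y))
    (hW : ∀ᶠ y in 𝓝 x, mfderiv 𝓘(ℝ, E) 𝓘(ℝ, E') ρ y (W y) = W' (ρ y)) :
    mfderiv 𝓘(ℝ, E) 𝓘(ℝ, E') ρ x (vectorBracket V W x) = vectorBracket V' W' (ρ x) := by
  refine eq_of_dirDeriv_eq fun f ↦ ?_
  have hd : ∀ᶠ y in 𝓝 x, MDifferentiableAt 𝓘(ℝ, E) 𝓘(ℝ, E') ρ y := by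
    have h := (contMDiffAt_iff_contMDiffAt_nhds (n := 1) (by simp)).1 (hρ.of_le (by simp))
    exact h.mono fun y hy ↦ hy.mdifferentiableAt (by simp)
  have hchain : ∀ (k : C^∞⟮𝓘(ℝ, E'), N; ℝ⟯) (y : M) (v : TangentSpace 𝓘(ℝ, E) y),
      MDifferentiableAt 𝓘(ℝ, E) 𝓘(ℝ, E') ρ y →
      dirDeriv (fun z ↦ k (ρ z)) y v = dirDeriv k (ρ y) (mfderiv 𝓘(ℝ, E) 𝓘(ℝ, E') ρ y v) :=
    fun k y v hy ↦ DFunLike.congr_fun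
      (mfderiv_comp y (k.contMDiff.mdifferentiableAt (by simp)) hy) v
  -- The derivative of `k ∘ ρ` along `U` is that of `k` along `U'`, composed with `ρ`.
  have hrel : ∀ (U : Cₛ^∞⟮𝓘(ℝ, E); E, (TangentSpace 𝓘(ℝ, E) : M → Type _)⟯)
      (U' : Cₛ^∞⟮𝓘(ℝ, E'); E', (TangentSpace 𝓘(ℝ, E') : N → Type _)⟯),
      (∀ᶠ y in 𝓝 x, mfderiv 𝓘(ℝ, E) 𝓘(ℝ, E') ρ y (U y) = U' (ρ y)) → ∀ k : C^∞⟮𝓘(ℝ, E'), N; ℝ⟯,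
      (fun y ↦ dirDeriv (fun z ↦ k (ρ z)) y (U y)) =ᶠ[𝓝 x]
        fun y ↦ lieDerivative U' k (ρ y) := fun U U' h k ↦ by
    filter_upwards [h, hd] with y hy hdy
    rw [hchain k y _ hdy, hy, lieDerivative_apply]
  have hf : ContMDiffAt 𝓘(ℝ, E) 𝓘(ℝ, ℝ) 2 (fun z ↦ f (ρ z)) x :=
    (f.contMDiff.contMDiffAt.comp x hρ).of_le ENat.LEInfty.out
  have h1 := dirDeriv_mlieBracket (V := V) (W := W) (V.contMDiff.mdifferentiableAt (by simp))
    (W.contMDiff.mdifferentiableAt (by simp)) hf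
  have hcongr : ∀ {g h : M → ℝ} (v : TangentSpace 𝓘(ℝ, E) x), g =ᶠ[𝓝 x] h →
      dirDeriv g x v = dirDeriv h x v := fun v hgh ↦ DFunLike.congr_fun hgh.mfderiv_eq v
  rw [hcongr _ (hrel W W' hW f), hcongr _ (hrel V V' hV f)] at h1
  have h2 : ∀ k : C^∞⟮𝓘(ℝ, E'), N; ℝ⟯, dirDeriv (fun z ↦ k (ρ z)) x (V x) =
      lieDerivative V' k (ρ x) := fun k ↦ (hrel V V' hV k).self_of_nhds
  have h3 : ∀ k : C^∞⟮𝓘(ℝ, E'), N; ℝ⟯, dirDeriv (fun z ↦ k (ρ z)) x (W x) =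
      lieDerivative W' k (ρ x) := fun k ↦ (hrel W W' hW k).self_of_nhds
  rw [h2, h3] at h1
  rw [← hchain f x _ hd.self_of_nhds]
  refine h1.trans ?_
  rw [← lieDerivative_apply, lieDerivative_vectorBracket]
  rfl

end

instance tangentBundle_t2Space {E H M : Type*} [NormedAddCommGroup E] [NormedSpace ℝ E]
    [TopologicalSpace H] {I : ModelWithCorners ℝ E H} [TopologicalSpace M] [ChartedSpace H M]
    [IsManifold I 1 M] [T2Space M] : T2Space (TangentBundle I M) where
  t2 x y hxy := by
    by_cases h : x.1 = y.1
    · let e := trivializationAt E (TangentSpace I : M → Type _) x.1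
      have hx : x ∈ e.source := FiberBundle.mem_trivializationAt_proj_source
      have hy : y ∈ e.source := by
        rw [e.mem_source, ← h]
        exact FiberBundle.mem_baseSet_trivializationAt E _ _
      obtain ⟨u, v, hu, hv, hxu, hyv, huv⟩ := t2_separation (fun h' ↦ hxy (e.injOn hx hy h'))
      exact ⟨e.source ∩ e ⁻¹' u, e.source ∩ e ⁻¹' v,
        e.continuousOn.isOpen_inter_preimage e.open_source hu,
        e.continuousOn.isOpen_inter_preimage e.open_source hv, ⟨hx, hxu⟩, ⟨hy, hyv⟩,
        (huv.preimage e).mono inter_subset_right inter_subset_right⟩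
    · exact separated_by_continuous (FiberBundle.continuous_proj E (TangentSpace I : M → Type _)) h

/-! ### Sections with prescribed germs -/

section

variable {E : Type*} [NormedAddCommGroup E] [NormedSpace ℝ E] [FiniteDimensional ℝ E]
  {M : Type*} [TopologicalSpace M] [ChartedSpace E M] [IsManifold 𝓘(ℝ, E) ∞ M] [T2Space M]
  {F : Type*} [NormedAddCommGroup F] [NormedSpace ℝ F]
  {A : M → Type*} [TopologicalSpace (TotalSpace F A)] [∀ m, AddCommGroup (A m)]
  [∀ m, Module ℝ (A m)] [∀ m, TopologicalSpace (A m)] [FiberBundle F A] [VectorBundle ℝ F A]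
  [ContMDiffVectorBundle ∞ F A 𝓘(ℝ, E)]

theorem exists_section_eventuallyEq {c : M} {U : Set M} (hU : IsOpen U) (hc : c ∈ U)
    {s : ∀ m, A m} (hs : ContMDiffOn 𝓘(ℝ, E) (𝓘(ℝ, E).prod 𝓘(ℝ, F)) ∞
      (fun m ↦ TotalSpace.mk' F m (s m)) U) :
    ∃ X : Cₛ^∞⟮𝓘(ℝ, E); F, A⟯, ∀ᶠ m in 𝓝 c, X m = s m := by
  obtain ⟨χ, -, hχ⟩ := (SmoothBumpFunction.nhds_basis_tsupport (I := 𝓘(ℝ, E)) c).mem_iff.1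
    (hU.mem_nhds hc)
  refine ⟨⟨fun m ↦ χ m • s m,
    ContMDiffOn.smul_section_of_tsupport χ.contMDiff.contMDiffOn hU hχ hs⟩, ?_⟩
  filter_upwards [χ.eventuallyEq_one] with m hm
  show χ m • s m = s m
  rw [hm, Pi.one_apply, one_smul]

theorem exists_section_eq {c : M} (v : A c) : ∃ X : Cₛ^∞⟮𝓘(ℝ, E); F, A⟯, X c = v := by
  obtain ⟨U, hU, hs⟩ := FiberBundle.exists_contMDiffOn_extend (k := ∞) 𝓘(ℝ, E) F v
  obtain ⟨W, hWU, hW, hcW⟩ := mem_nhds_iff.1 hU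
  obtain ⟨X, hX⟩ := exists_section_eventuallyEq hW hcW (hs.mono hWU)
  exact ⟨X, by rw [hX.self_of_nhds]; simp⟩

end

/-! ### The tangent lift of a Poisson structure -/

section

variable {E : Type*} [NormedAddCommGroup E] [NormedSpace ℝ E] [FiniteDimensional ℝ E]
  {M : Type*} [TopologicalSpace M] [ChartedSpace E M] [IsManifold 𝓘(ℝ, E) ∞ M]

theorem dirDeriv_add (f g : C^∞⟮𝓘(ℝ, E), M; ℝ⟯) (x : M) (v : TangentSpace 𝓘(ℝ, E) x) :
    dirDeriv (f + g : C^∞⟮𝓘(ℝ, E), M; ℝ⟯) x v = dirDeriv f x v + dirDeriv g x v :=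
  DFunLike.congr_fun (map_add (differentialAt (I := 𝓘(ℝ, E)) x) f g) v

theorem dirDeriv_smul (r : ℝ) (f : C^∞⟮𝓘(ℝ, E), M; ℝ⟯) (x : M) (v : TangentSpace 𝓘(ℝ, E) x) :
    dirDeriv (r • f : C^∞⟮𝓘(ℝ, E), M; ℝ⟯) x v = r * dirDeriv f x v :=
  DFunLike.congr_fun (map_smul (differentialAt (I := 𝓘(ℝ, E)) x) r f) v

theorem dirDeriv_zero (x : M) (v : TangentSpace 𝓘(ℝ, E) x) :
    dirDeriv (0 : C^∞⟮𝓘(ℝ, E), M; ℝ⟯) x v = 0 :=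
  DFunLike.congr_fun (map_zero (differentialAt (I := 𝓘(ℝ, E)) x)) v

variable (E M) in
/-- The functions `f ∘ p + ℓ_dg` on the tangent bundle. -/
def tangentGenerator : C^∞⟮𝓘(ℝ, E), M; ℝ⟯ × C^∞⟮𝓘(ℝ, E), M; ℝ⟯ →ₗ[ℝ]
    C^∞⟮𝓘(ℝ, E).tangent, TangentBundle 𝓘(ℝ, E) M; ℝ⟯ where
  toFun j := tangentPullback j.1 + differentialFunction j.2
  map_add' j k := by
    ext x
    show (j.1 x.1 + k.1 x.1) + dirDeriv (j.2 + k.2) x.1 x.2 =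
      (j.1 x.1 + dirDeriv j.2 x.1 x.2) + (k.1 x.1 + dirDeriv k.2 x.1 x.2)
    rw [dirDeriv_add]; ring
  map_smul' r j := by
    ext x
    show r * j.1 x.1 + dirDeriv (r • j.2) x.1 x.2 = r * (j.1 x.1 + dirDeriv j.2 x.1 x.2)
    rw [dirDeriv_smul]; ring

theorem tangentGenerator_apply (f g : C^∞⟮𝓘(ℝ, E), M; ℝ⟯) (x : TangentBundle 𝓘(ℝ, E) M) :
    tangentGenerator E M (f, g) x = f x.1 + dirDeriv g x.1 x.2 := rfl

theorem tangentGenerator_inl (f : C^∞⟮𝓘(ℝ, E), M; ℝ⟯) :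
    tangentGenerator E M (f, 0) = tangentPullback f := by
  have : differentialFunction (0 : C^∞⟮𝓘(ℝ, E), M; ℝ⟯) = 0 := by
    ext x
    exact dirDeriv_zero x.1 x.2
  show tangentPullback f + differentialFunction 0 = _
  rw [this, add_zero]

theorem tangentGenerator_inr (g : C^∞⟮𝓘(ℝ, E), M; ℝ⟯) :
    tangentGenerator E M (0, g) = differentialFunction g := by
  ext x
  exact zero_add _

theorem tangentGenerator_eq (f g : C^∞⟮𝓘(ℝ, E), M; ℝ⟯) :
    tangentGenerator E M (f, g) = tangentPullback f + differentialFunction g := rfl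

variable [T2Space M]

theorem exists_tangentGenerator_coord (u : TangentBundle 𝓘(ℝ, E) M) (l : E × E →L[ℝ] ℝ) :
    ∃ j, tangentGenerator E M j =ᶠ[𝓝 u] fun x ↦ l (extChartAt 𝓘(ℝ, E).tangent u x) := by
  let l₁ : E →L[ℝ] ℝ := l.comp (ContinuousLinearMap.inl ℝ E E)
  let l₂ : E →L[ℝ] ℝ := l.comp (ContinuousLinearMap.inr ℝ E E)
  obtain ⟨f, hf⟩ := exists_contMDiffMap_coord (I := 𝓘(ℝ, E)) u.1 l₁
  obtain ⟨g, hg⟩ := exists_contMDiffMap_coord (I := 𝓘(ℝ, E)) u.1 l₂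
  refine ⟨(f, g), ?_⟩
  have hp : ContinuousAt (fun x : TangentBundle 𝓘(ℝ, E) M ↦ x.1) u :=
    (FiberBundle.continuous_proj E (TangentSpace 𝓘(ℝ, E) : M → Type _)).continuousAt
  have hs := hp.eventually ((chartAt E u.1).open_source.mem_nhds (mem_chart_source E u.1))
  filter_upwards [hp.eventually hf, hp.eventually hg.eventually_nhds, hs] with x hfx hgx hx
  have h1 : extChartAt 𝓘(ℝ, E).tangent u x = (extChartAt 𝓘(ℝ, E) u.1 x.1,
      (trivializationAt E (TangentSpace 𝓘(ℝ, E) : M → Type _) u.1 x).2) := by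
    rw [FiberBundle.extChartAt]
    rfl
  have h2 : ∀ a b : E, l (a, 0) + l (0, b) = l (a, b) := fun a b ↦ by
    rw [← map_add, Prod.mk_add_mk, add_zero, zero_add]
  rw [h1, tangentGenerator_apply, hfx, dirDeriv_eq_of_eventuallyEq_coord hgx hx,
    trivializationAt_tangent_snd hx]
  exact h2 _ _

theorem mfderiv_comp_eq_zero {E₁ H₁ E₂ H₂ : Type*} [NormedAddCommGroup E₁] [NormedSpace ℝ E₁]
    [TopologicalSpace H₁] {I₁ : ModelWithCorners ℝ E₁ H₁} {M₁ : Type*} [TopologicalSpace M₁]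
    [ChartedSpace H₁ M₁] [NormedAddCommGroup E₂] [NormedSpace ℝ E₂] [FiniteDimensional ℝ E₂]
    [TopologicalSpace H₂] {I₂ : ModelWithCorners ℝ E₂ H₂} [I₂.Boundaryless] {M₂ : Type*}
    [TopologicalSpace M₂] [ChartedSpace H₂ M₂] [IsManifold I₂ ∞ M₂] {c : M₁ → M₂} {x : M₁}
    (hc : MDifferentiableAt I₁ I₂ c x) {K : C^∞⟮I₂, M₂; ℝ⟯} (hK : differentialAt (c x) K = 0) :
    mfderiv I₁ 𝓘(ℝ, ℝ) (fun y ↦ K (c y)) x = 0 := by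
  have h : HasMFDerivAt I₂ 𝓘(ℝ, ℝ) K (c x) (0 : E₂ →L[ℝ] ℝ) := by
    rw [← hK]
    exact (K.contMDiff.mdifferentiableAt (by simp)).hasMFDerivAt
  refine (h.comp x hc.hasMFDerivAt).mfderiv.trans ?_
  ext v
  rfl

/-- If the differential of `f ∘ p + ℓ_dg` vanishes at a tangent vector `u` then so does the
function `({g, f'} + {f, g'}) ∘ p + ℓ_d{g, g'}`. With a vector field `V` extending `u` and the
Hamiltonian vector field `X` of `g'`, this is the identity `V (X g) = X (V g) + [V, X] g`. -/
theorem tangentGenerator_bracket_eq_zero (π₁ : PoissonStructure 𝓘(ℝ, E) M)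
    (Hm : C^∞⟮𝓘(ℝ, E), M; ℝ⟯ → Cₛ^∞⟮𝓘(ℝ, E); E, (TangentSpace 𝓘(ℝ, E) : M → Type _)⟯)
    (hHm : ∀ f g, π₁.bracket f g = lieDerivative (Hm f) g) (u : TangentBundle 𝓘(ℝ, E) M)
    (f g f' g' : C^∞⟮𝓘(ℝ, E), M; ℝ⟯)
    (h : differentialAt u (tangentGenerator E M (f, g)) = 0) :
    tangentGenerator E M (π₁.bracket g f' + π₁.bracket f g', π₁.bracket g g') u = 0 := by
  obtain ⟨m, v⟩ := u
  -- The differential of `g` vanishes at `m`: differentiate along a vertical line.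
  have hdg : ∀ w : TangentSpace 𝓘(ℝ, E) m, dirDeriv g m w = 0 := fun w ↦ by
    let c : ℝ → TangentBundle 𝓘(ℝ, E) M := fun t ↦ ⟨m, v + t • w⟩
    have haff : ∀ k : C^∞⟮𝓘(ℝ, E), M; ℝ⟯, ∀ t : ℝ,
        dirDeriv k m (v + t • w) = dirDeriv k m v + t * dirDeriv k m w := fun k t ↦ by
      simp [dirDeriv]
      rfl
    have hc : ContMDiffAt 𝓘(ℝ, ℝ) 𝓘(ℝ, E).tangent ∞ c 0 := by
      refine contMDiffAt_tangentBundle_of_dirDeriv contMDiffAt_const fun k ↦ ?_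
      simp only [c, haff]
      exact ContDiffAt.contMDiffAt (by fun_prop)
    have hc0 : c 0 = ⟨m, v⟩ := by simp [c]
    have h1 := mfderiv_comp_eq_zero (hc.mdifferentiableAt (by simp))
      (K := tangentGenerator E M (f, g)) (by rw [hc0]; exact h)
    have h2 : HasDerivAt (fun t ↦ tangentGenerator E M (f, g) (c t)) (dirDeriv g m w) 0 := by
      simp only [tangentGenerator_apply, c, haff]
      simpa using (((hasDerivAt_id (0 : ℝ)).mul_const (dirDeriv g m w)).const_add
        (dirDeriv g m v)).const_add (f m)
    have h3 := DFunLike.congr_fun (h2.hasFDerivAt.hasMFDerivAt.mfderiv.symm.trans h1) 1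
    exact (one_smul ℝ (dirDeriv g m w)).symm.trans h3
  obtain ⟨V, hV⟩ := exists_section_eq (E := E) (F := E) (A := (TangentSpace 𝓘(ℝ, E) : M → Type _)) v
  have hK : ∀ w : TangentSpace 𝓘(ℝ, E) m,
      dirDeriv f m w + dirDeriv (lieDerivative V g) m w = 0 := fun w ↦ by
    rw [← dirDeriv_add]
    have h1 := mfderiv_comp_eq_zero (V.contMDiff.mdifferentiableAt (x := m) (by simp))
      (K := tangentGenerator E M (f, g)) (by rw [hV]; exact h)
    exact DFunLike.congr_fun h1 w
  have hXg : ∀ k, π₁.bracket g k m = 0 := fun k ↦ by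
    rw [π₁.bracket_swap, hHm]
    show -dirDeriv g m _ = 0
    rw [hdg, neg_zero]
  have h1 := congrArg (fun k : C^∞⟮𝓘(ℝ, E), M; ℝ⟯ ↦ k m)
    (lieDerivative_vectorBracket V (Hm g') g)
  have h2 : dirDeriv g m (vectorBracket V (Hm g') m) = dirDeriv (lieDerivative (Hm g') g) m (V m) -
    dirDeriv (lieDerivative V g) m (Hm g' m) := h1
  rw [hdg, hV] at h2
  have h3 : dirDeriv (π₁.bracket g g') m v = -dirDeriv (lieDerivative (Hm g') g) m v := by
    rw [π₁.bracket_swap, hHm]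
    exact DFunLike.congr_fun (map_neg (differentialAt (I := 𝓘(ℝ, E)) m) (lieDerivative (Hm g') g)) v
  have h4 : π₁.bracket f g' m = -dirDeriv f m (Hm g' m) := by
    rw [π₁.bracket_swap, hHm]; rfl
  rw [tangentGenerator_apply]
  show π₁.bracket g f' m + π₁.bracket f g' m + dirDeriv (π₁.bracket g g') m v = 0
  rw [hXg, h4, h3]
  linarith [hK (Hm g' m)]

/-- The generators `f ∘ p + ℓ_dg` of the tangent lift. The pairs `(f, g)` form a semidirect product:
`g` acts on the abelian ideal of the `f` by the Poisson bracket. -/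
def tangentLiftGenerators (π₁ : PoissonStructure 𝓘(ℝ, E) M)
    (Hm : C^∞⟮𝓘(ℝ, E), M; ℝ⟯ → Cₛ^∞⟮𝓘(ℝ, E); E, (TangentSpace 𝓘(ℝ, E) : M → Type _)⟯)
    (hHm : ∀ f g, π₁.bracket f g = lieDerivative (Hm f) g) :
    PoissonGenerators 𝓘(ℝ, E).tangent (TangentBundle 𝓘(ℝ, E) M)
      (C^∞⟮𝓘(ℝ, E), M; ℝ⟯ × C^∞⟮𝓘(ℝ, E), M; ℝ⟯) where
  br := LinearMap.mk₂ ℝ (fun j k ↦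
      (π₁.bracket j.2 k.1 + π₁.bracket j.1 k.2, π₁.bracket j.2 k.2))
    (fun j j' k ↦ by ext1 <;> simp; abel) (fun r j k ↦ by ext1 <;> simp)
    (fun j k k' ↦ by ext1 <;> simp; abel) (fun r j k ↦ by ext1 <;> simp)
  br_self j := by
    ext1
    · simp only [LinearMap.mk₂_apply]
      rw [π₁.bracket_swap j.2 j.1]
      exact neg_add_cancel _
    · exact π₁.bracket_self _
  br_jacobi j k l := by
    have h := π₁.jacobi
    ext1
    · simp only [LinearMap.mk₂_apply, Prod.fst_add, map_add, Prod.fst_zero]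
      linear_combination h j.2 k.2 l.1 + h j.2 k.1 l.2 + h j.1 k.2 l.2
    · exact h j.2 k.2 l.2
  γ := tangentGenerator E M
  γ_br_eq_zero u j k h := tangentGenerator_bracket_eq_zero π₁ Hm hHm u j.1 j.2 k.1 k.2 h
  exists_coord := exists_tangentGenerator_coord

theorem isTangentLift_iff (π₁ : PoissonStructure 𝓘(ℝ, E) M)
    (Hm : C^∞⟮𝓘(ℝ, E), M; ℝ⟯ → Cₛ^∞⟮𝓘(ℝ, E); E, (TangentSpace 𝓘(ℝ, E) : M → Type _)⟯)
    (hHm : ∀ f g, π₁.bracket f g = lieDerivative (Hm f) g)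
    (π₂ : PoissonStructure 𝓘(ℝ, E).tangent (TangentBundle 𝓘(ℝ, E) M)) :
    IsTangentLift π₁ π₂ ↔ ∀ j k, π₂.bracket (tangentGenerator E M j) (tangentGenerator E M k) =
      tangentGenerator E M ((tangentLiftGenerators π₁ Hm hHm).br j k) := by
  have hbr : ∀ j k, (tangentLiftGenerators π₁ Hm hHm).br j k =
    (π₁.bracket j.2 k.1 + π₁.bracket j.1 k.2, π₁.bracket j.2 k.2) := fun j k ↦ rfl
  have hadd : ∀ f g : C^∞⟮𝓘(ℝ, E), M; ℝ⟯,
      tangentPullback (f + g) = tangentPullback f + tangentPullback g := fun f g ↦ rfl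
  have hneg : ∀ f : C^∞⟮𝓘(ℝ, E), M; ℝ⟯, tangentPullback (-f) = -tangentPullback f := fun f ↦ rfl
  constructor
  · rintro ⟨h1, h2, h3⟩ ⟨f, g⟩ ⟨f', g'⟩
    simp only [hbr, tangentGenerator_eq, map_add, LinearMap.add_apply, h1, h2, h3, hadd]
    rw [π₂.bracket_swap (tangentPullback f), h2, π₁.bracket_swap f g', hneg]
    abel
  · intro h
    refine ⟨fun f g ↦ ?_, fun f g ↦ ?_, fun f g ↦ ?_⟩
    · rw [← tangentGenerator_inr, ← tangentGenerator_inr, h, hbr, ← tangentGenerator_inr]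
      simp
    · rw [← tangentGenerator_inr, ← tangentGenerator_inl, h, hbr, ← tangentGenerator_inl]
      simp
    · rw [← tangentGenerator_inl, ← tangentGenerator_inl, h, hbr]
      simp only [map_zero, LinearMap.zero_apply, add_zero]
      exact map_zero (tangentGenerator E M)

theorem exists_isTangentLift (π₁ : PoissonStructure 𝓘(ℝ, E) M)
    (Hm : C^∞⟮𝓘(ℝ, E), M; ℝ⟯ → Cₛ^∞⟮𝓘(ℝ, E); E, (TangentSpace 𝓘(ℝ, E) : M → Type _)⟯)
    (hHm : ∀ f g, π₁.bracket f g = lieDerivative (Hm f) g) :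
    ∃ π₂, IsTheUnique (IsTangentLift π₁) π₂ := by
  let Γ := tangentLiftGenerators π₁ Hm hHm
  refine ⟨Γ.poisson, (isTangentLift_iff π₁ Hm hHm _).2 Γ.poisson_γ, fun π₂ h ↦ ?_⟩
  refine Γ.eq_of_bracket_γ fun j k ↦ ?_
  rw [Γ.poisson_γ]
  exact (isTangentLift_iff π₁ Hm hHm _).1 h j k

end

/-! ### Hamiltonian vector fields of a symplectic form -/

namespace SymplecticForm

variable {E : Type*} [NormedAddCommGroup E] [NormedSpace ℝ E] [FiniteDimensional ℝ E]
  {M : Type*} [TopologicalSpace M] [ChartedSpace E M] [IsManifold 𝓘(ℝ, E) ∞ M]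
  (Ω : SymplecticForm E M)

theorem swap (x : M) (u v : TangentSpace 𝓘(ℝ, E) x) : Ω.form x u v = -Ω.form x v u := by
  have h := Ω.alternating x (u + v)
  simp only [map_add, add_apply, Ω.alternating, zero_add, add_zero] at h
  exact eq_neg_of_add_eq_zero_right h

/-- The symplectic form evaluated on two smooth vector fields along a map is smooth. -/
theorem contMDiffAt_apply {E' H' : Type*} [NormedAddCommGroup E'] [NormedSpace ℝ E']
    [TopologicalSpace H'] {I' : ModelWithCorners ℝ E' H'} {N : Type*} [TopologicalSpace N]
    [ChartedSpace H' N] {b : N → M} {u v : ∀ n, TangentSpace 𝓘(ℝ, E) (b n)} {n₀ : N}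
    (hu : ContMDiffAt I' 𝓘(ℝ, E).tangent ∞
      (fun n ↦ (⟨b n, u n⟩ : TangentBundle 𝓘(ℝ, E) M)) n₀)
    (hv : ContMDiffAt I' 𝓘(ℝ, E).tangent ∞
      (fun n ↦ (⟨b n, v n⟩ : TangentBundle 𝓘(ℝ, E) M)) n₀) :
    ContMDiffAt I' 𝓘(ℝ, ℝ) ∞ (fun n ↦ Ω.form (b n) (u n) (v n)) n₀ := by
  have hb : ContMDiffAt I' 𝓘(ℝ, E) ∞ b n₀ := (contMDiffAt_totalSpace.1 hu).1
  have h := ContMDiffAt.clm_bundle_apply₂ (F₁ := E) (F₂ := E) (F₃ := ℝ)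
    (E₁ := (TangentSpace 𝓘(ℝ, E) : M → Type _)) (E₂ := (TangentSpace 𝓘(ℝ, E) : M → Type _))
    (E₃ := Bundle.Trivial M ℝ) (b := b) (ψ := fun n ↦ Ω.form (b n))
    ((Ω.contMDiff (b n₀)).comp n₀ hb) hu hv
  exact (contMDiffAt_totalSpace.1 h).2

theorem contMDiffAt_apply_section
    (X Y : Cₛ^∞⟮𝓘(ℝ, E); E, (TangentSpace 𝓘(ℝ, E) : M → Type _)⟯) (x : M) :
    ContMDiffAt 𝓘(ℝ, E) 𝓘(ℝ, ℝ) ∞ (fun y ↦ Ω.form y (X y) (Y y)) x :=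
  Ω.contMDiffAt_apply (X.contMDiff x) (Y.contMDiff x)

/-- The Hamiltonian vector at `x` of a smooth function. -/
def sharp (f : C^∞⟮𝓘(ℝ, E), M; ℝ⟯) (x : M) : TangentSpace 𝓘(ℝ, E) x :=
  (Ω.flat x).symm (mfderiv 𝓘(ℝ, E) 𝓘(ℝ, ℝ) f x)

theorem form_sharp (f : C^∞⟮𝓘(ℝ, E), M; ℝ⟯) (x : M) (v : TangentSpace 𝓘(ℝ, E) x) :
    Ω.form x v (Ω.sharp f x) = dirDeriv f x v := by
  have h := DFunLike.congr_fun ((Ω.flat x).apply_symm_apply (mfderiv 𝓘(ℝ, E) 𝓘(ℝ, ℝ) f x)) v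
  rw [flat_apply, ← Ω.swap] at h
  exact h

theorem eq_of_form_eq {x : M} {u u' : TangentSpace 𝓘(ℝ, E) x}
    (h : ∀ v, Ω.form x v u = Ω.form x v u') : u = u' := by
  refine sub_eq_zero.1 (Ω.nondegenerate x _ fun v ↦ ?_)
  rw [Ω.swap, map_sub, h, sub_self, neg_zero]

variable [T2Space M]

/-- Hamiltonian vectors depend smoothly on the point: in a local frame, they are obtained by applying
the inverse of the matrix of the symplectic form to the derivatives of `f` along the frame. -/
theorem contMDiff_sharp (f : C^∞⟮𝓘(ℝ, E), M; ℝ⟯) :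
    ContMDiff 𝓘(ℝ, E) 𝓘(ℝ, E).tangent ∞
      (fun x ↦ (⟨x, Ω.sharp f x⟩ : TangentBundle 𝓘(ℝ, E) M)) := by
  intro x₀
  let b := Module.finBasis ℝ E
  choose X hX using fun i ↦ exists_section_eq (E := E) (F := E)
    (A := (TangentSpace 𝓘(ℝ, E) : M → Type _)) (c := x₀) (b i)
  let c : Fin (Module.finrank ℝ E) → (E →L[ℝ] ℝ) := fun i ↦
    LinearMap.toContinuousLinearMap (b.coord i)
  -- The linear map `E → T_y M` given by the vectors `X i y`, and the form `ω` read through it.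
  let L : ∀ y : M, E →L[ℝ] TangentSpace 𝓘(ℝ, E) y := fun y ↦
    ∑ i, (c i).smulRight (X i y : TangentSpace 𝓘(ℝ, E) y)
  let T : M → (E →L[ℝ] E →L[ℝ] ℝ) := fun y ↦
    ∑ i, ∑ j, Ω.form y (X i y) (X j y) • (c i).smulRight (c j)
  have hL : ∀ y u, L y u = ∑ i, c i u • X i y := fun y u ↦ by simp [L, sum_apply]
  have hT : ∀ y u v, T y u v = Ω.form y (L y u) (L y v) := fun y u v ↦ by
    rw [hL, hL]
    simp only [T, sum_apply, map_sum, map_smul, smul_apply, smul_eq_mul,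
      ContinuousLinearMap.smulRight_apply, Finset.mul_sum]
    rw [Finset.sum_comm]
    refine Finset.sum_congr rfl fun i _ ↦ Finset.sum_congr rfl fun j _ ↦ ?_
    ring
  have hTs : ContMDiffAt 𝓘(ℝ, E) 𝓘(ℝ, E →L[ℝ] E →L[ℝ] ℝ) ∞ T x₀ :=
    ContMDiffAt.sum fun i _ ↦ ContMDiffAt.sum fun j _ ↦
      (Ω.contMDiffAt_apply_section (X i) (X j) x₀).smul contMDiffAt_const
  have hL₀ : ∀ u : E, L x₀ u = u := fun u ↦ by
    rw [hL]
    simp only [hX]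
    exact b.sum_repr u
  have hinv : (T x₀).IsInvertible := by
    have hinj : Function.Injective (T x₀).toLinearMap := by
      rw [injective_iff_map_eq_zero]
      intro u hu
      refine Ω.nondegenerate x₀ u fun v ↦ ?_
      have h := DFunLike.congr_fun hu v
      let w : E := v
      have h' := hT x₀ u w
      rw [hL₀ u, hL₀ w] at h'
      exact h'.symm.trans h
    have hd : Module.finrank ℝ E = Module.finrank ℝ (E →L[ℝ] ℝ) := by
      rw [← (LinearMap.toContinuousLinearMap (𝕜 := ℝ) (E := E) (F' := ℝ)).finrank_eq]
      exact Subspace.dual_finrank_eq.symm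
    exact ⟨(LinearEquiv.ofInjectiveOfFinrankEq _ hinj hd).toContinuousLinearEquiv, by
      ext u v; rfl⟩
  have hinv' : ∀ᶠ y in 𝓝 x₀, (T y).IsInvertible :=
    hTs.continuousAt.eventually (ContinuousLinearEquiv.isOpen.mem_nhds hinv)
  let α : M → (E →L[ℝ] ℝ) := fun y ↦ ∑ j, lieDerivative (X j) f y • c j
  have hα : ∀ y v, α y v = dirDeriv f y (L y v) := fun y v ↦ by
    rw [hL]
    simp only [α, sum_apply, smul_apply, smul_eq_mul, dirDeriv, map_sum,
      map_smul]
    refine Finset.sum_congr rfl fun j _ ↦ ?_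
    exact mul_comm _ _
  let a : M → E := fun y ↦ (T y).inverse (-α y)
  have ha : ContMDiffAt 𝓘(ℝ, E) 𝓘(ℝ, E) ∞ a x₀ := by
    have h1 : ContDiffAt ℝ ∞ ContinuousLinearMap.inverse (T x₀) := by
      obtain ⟨e, he⟩ := hinv
      rw [← he]; exact contDiffAt_map_inverse e
    have h2 : ContMDiffAt 𝓘(ℝ, E) 𝓘(ℝ, E →L[ℝ] ℝ) ∞ α x₀ :=
      ContMDiffAt.sum fun j _ ↦ ((lieDerivative (X j) f).contMDiff x₀).smul contMDiffAt_const
    exact (h1.contMDiffAt.comp x₀ hTs).clm_apply h2.neg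
  have key : ∀ᶠ y in 𝓝 x₀, Ω.sharp f y = L y (a y) := by
    filter_upwards [hinv'] with y hy
    have hLinj : Function.Injective (L y).toLinearMap := by
      rw [injective_iff_map_eq_zero]
      intro u hu
      refine hy.injective ((map_zero (T y)).symm ▸ ?_)
      ext v
      rw [hT, show L y u = 0 from hu, map_zero]
      rfl
    have hLsurj : Function.Surjective (L y).toLinearMap :=
      (LinearMap.injective_iff_surjective_of_finrank_eq_finrank (V₂ := E) rfl).1 hLinj
    refine Ω.eq_of_form_eq fun v ↦ ?_
    obtain ⟨v, rfl⟩ := hLsurj v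
    rw [form_sharp, Ω.swap]
    refine ((hα y v).symm.trans ?_)
    have h1 : T y (a y) v = -α y v := by
      simp only [a]; rw [hy.self_apply_inverse]; rfl
    rw [hT] at h1
    exact (neg_eq_iff_eq_neg.2 h1).symm
  refine contMDiffAt_tangentBundle_of_dirDeriv contMDiffAt_id fun g ↦ ?_
  have h3 : ContMDiffAt 𝓘(ℝ, E) 𝓘(ℝ, ℝ) ∞
      (fun y ↦ ∑ i, c i (a y) * lieDerivative (X i) g y) x₀ :=
    ContMDiffAt.sum fun i _ ↦ ((c i).contDiff.contMDiff.contMDiffAt.comp x₀ ha).mul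
      ((lieDerivative (X i) g).contMDiff x₀)
  refine h3.congr_of_eventuallyEq ?_
  filter_upwards [key] with y hy
  show dirDeriv g y (Ω.sharp f y) = _
  rw [hy, hL]
  simp only [dirDeriv, map_sum, map_smul]
  rfl

/-- The Hamiltonian vector field `X_f`, characterized by `ω(v, X_f) = v f`. -/
def hamiltonian (f : C^∞⟮𝓘(ℝ, E), M; ℝ⟯) :
    Cₛ^∞⟮𝓘(ℝ, E); E, (TangentSpace 𝓘(ℝ, E) : M → Type _)⟯ :=
  ⟨Ω.sharp f, Ω.contMDiff_sharp f⟩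

theorem form_hamiltonian (f : C^∞⟮𝓘(ℝ, E), M; ℝ⟯) (x : M) (v : TangentSpace 𝓘(ℝ, E) x) :
    Ω.form x v (Ω.hamiltonian f x) = dirDeriv f x v := Ω.form_sharp f x v

theorem form_hamiltonian_hamiltonian (f g : C^∞⟮𝓘(ℝ, E), M; ℝ⟯) (x : M) :
    Ω.form x (Ω.hamiltonian f x) (Ω.hamiltonian g x) = lieDerivative (Ω.hamiltonian f) g x :=
  Ω.form_hamiltonian g x _

theorem lieDerivative_hamiltonian_swap (f g : C^∞⟮𝓘(ℝ, E), M; ℝ⟯) :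
    lieDerivative (Ω.hamiltonian f) g = -lieDerivative (Ω.hamiltonian g) f := by
  ext x
  show _ = -lieDerivative (Ω.hamiltonian g) f x
  rw [← form_hamiltonian_hamiltonian, ← form_hamiltonian_hamiltonian, Ω.swap]

/-- The Jacobi identity of the Poisson bracket `{f, g} = X_f g`. For `J` the cyclic sum of
`{f, {g, h}}`, the invariant formula for `dω(X_f, X_g, X_h)` is `J - 2 J`. -/
theorem hamiltonian_jacobi (f g h : C^∞⟮𝓘(ℝ, E), M; ℝ⟯) :
    lieDerivative (Ω.hamiltonian f) (lieDerivative (Ω.hamiltonian g) h) +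
      lieDerivative (Ω.hamiltonian g) (lieDerivative (Ω.hamiltonian h) f) +
      lieDerivative (Ω.hamiltonian h) (lieDerivative (Ω.hamiltonian f) g) = 0 := by
  ext x
  have h1 := Ω.closed (Ω.hamiltonian f) (Ω.hamiltonian g) (Ω.hamiltonian h) x
  simp only [form_hamiltonian_hamiltonian] at h1
  have h2 : ∀ a b c : C^∞⟮𝓘(ℝ, E), M; ℝ⟯,
      Ω.form x (VectorField.mlieBracket 𝓘(ℝ, E) (Ω.hamiltonian a) (Ω.hamiltonian b) x)
        (Ω.hamiltonian c x) = lieDerivative (Ω.hamiltonian a) (lieDerivative (Ω.hamiltonian b) c) x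
          + lieDerivative (Ω.hamiltonian b) (lieDerivative (Ω.hamiltonian c) a) x :=
    fun a b c ↦ by
    rw [form_hamiltonian, Ω.lieDerivative_hamiltonian_swap c a, map_neg]
    have h3 := congrArg (fun k : C^∞⟮𝓘(ℝ, E), M; ℝ⟯ ↦ k x)
      (lieDerivative_vectorBracket (Ω.hamiltonian a) (Ω.hamiltonian b) c)
    refine h3.trans ?_
    exact sub_eq_add_neg _ _
  rw [h2, h2, h2] at h1
  simp only [← lieDerivative_apply] at h1
  show lieDerivative (Ω.hamiltonian f) (lieDerivative (Ω.hamiltonian g) h) x +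
      lieDerivative (Ω.hamiltonian g) (lieDerivative (Ω.hamiltonian h) f) x +
      lieDerivative (Ω.hamiltonian h) (lieDerivative (Ω.hamiltonian f) g) x = 0
  linarith

/-- The Poisson structure of a symplectic form. -/
def poisson : PoissonStructure 𝓘(ℝ, E) M where
  bracket := LinearMap.mk₂ ℝ (fun f g ↦ lieDerivative (Ω.hamiltonian f) g)
    (fun f f' g ↦ by
      rw [lieDerivative_hamiltonian_swap, map_add, Ω.lieDerivative_hamiltonian_swap f g,
        Ω.lieDerivative_hamiltonian_swap f' g]
      abel)
    (fun r f g ↦ by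
      rw [lieDerivative_hamiltonian_swap, map_smul, Ω.lieDerivative_hamiltonian_swap f g, smul_neg])
    (fun f g g' ↦ map_add _ _ _) (fun r f g ↦ map_smul _ _ _)
  bracket_self f := by
    ext x
    exact (Ω.form_hamiltonian_hamiltonian f f x).symm.trans (Ω.alternating x _)
  jacobi := Ω.hamiltonian_jacobi
  leibniz f := lieDerivative_mul (Ω.hamiltonian f)

theorem poisson_bracket (f g : C^∞⟮𝓘(ℝ, E), M; ℝ⟯) :
    Ω.poisson.bracket f g = lieDerivative (Ω.hamiltonian f) g := rfl

theorem isTheUnique_poisson : IsTheUnique Ω.IsAssociatedPoisson Ω.poisson := by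
  have h : Ω.IsAssociatedPoisson Ω.poisson := fun f g x ↦
    (Ω.form_hamiltonian_hamiltonian f g x).symm
  refine ⟨h, fun π₁ h₁ ↦ PoissonStructure.ext_bracket fun f g ↦ ?_⟩
  ext x
  rw [h₁, h]

end SymplecticForm

/-! ### Velocities of curves -/

section

variable {E : Type*} [NormedAddCommGroup E] [NormedSpace ℝ E]
  {M : Type*} [TopologicalSpace M] [ChartedSpace E M]
  {E' : Type*} [NormedAddCommGroup E'] [NormedSpace ℝ E']
  {N : Type*} [TopologicalSpace N] [ChartedSpace E' N]

/-- The curve `c` is smooth at time `0`, with velocity `U` there. -/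
def HasVelocity (c : ℝ → M) (U : TangentBundle 𝓘(ℝ, E) M) : Prop :=
  ContMDiffAt 𝓘(ℝ, ℝ) 𝓘(ℝ, E) ∞ c 0 ∧ U = ⟨c 0, mfderiv 𝓘(ℝ, ℝ) 𝓘(ℝ, E) c 0 (1 : ℝ)⟩

theorem HasVelocity.apply_zero {c : ℝ → M} {U : TangentBundle 𝓘(ℝ, E) M} (h : HasVelocity c U) :
    c 0 = U.1 := by rw [h.2]

theorem HasVelocity.comp {c : ℝ → M} {x : M} {v : TangentSpace 𝓘(ℝ, E) x}
    (h : HasVelocity c ⟨x, v⟩) {ρ : M → N} (hρ : ContMDiffAt 𝓘(ℝ, E) 𝓘(ℝ, E') ∞ ρ x) :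
    HasVelocity (fun t ↦ ρ (c t)) ⟨ρ x, mfderiv 𝓘(ℝ, E) 𝓘(ℝ, E') ρ x v⟩ := by
  obtain ⟨h1, h2⟩ := h
  cases h2
  refine ⟨hρ.comp (0 : ℝ) h1, ?_⟩
  refine congrArg (TotalSpace.mk (ρ (c 0))) ?_
  exact (DFunLike.congr_fun (mfderiv_comp (0 : ℝ) (hρ.mdifferentiableAt (by simp))
    (h1.mdifferentiableAt (by simp))) (1 : ℝ)).symm

theorem HasVelocity.congr {c c' : ℝ → M} {U : TangentBundle 𝓘(ℝ, E) M} (h : HasVelocity c U)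
    (hc : c' =ᶠ[𝓝 0] c) : HasVelocity c' U := by
  refine ⟨h.1.congr_of_eventuallyEq hc, h.2.trans ?_⟩
  have h0 := hc.self_of_nhds
  have h1 := hc.mfderiv_eq (I := 𝓘(ℝ, ℝ)) (I' := 𝓘(ℝ, E))
  have key : ∀ (y z : M) (v w : E), y = z → v = w →
      (⟨y, v⟩ : TangentBundle 𝓘(ℝ, E) M) = ⟨z, w⟩ := by
    rintro y _ v _ rfl rfl; rfl
  exact key _ _ _ _ h0.symm (DFunLike.congr_fun h1.symm (1 : ℝ))

theorem HasVelocity.unique {c : ℝ → M} {U V : TangentBundle 𝓘(ℝ, E) M} (h : HasVelocity c U)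
    (h' : HasVelocity c V) : U = V := h.2.trans h'.2.symm

theorem hasVelocity_const (x : M) : HasVelocity (fun _ ↦ x) (⟨x, 0⟩ : TangentBundle 𝓘(ℝ, E) M) := by
  refine ⟨contMDiffAt_const, ?_⟩
  rw [mfderiv_const]
  rfl

theorem hasVelocity_line (u : E) :
    HasVelocity (fun t : ℝ ↦ t • u) (⟨0, u⟩ : TangentBundle 𝓘(ℝ, E) E) := by
  have h : HasFDerivAt (fun t : ℝ ↦ t • u) (ContinuousLinearMap.toSpanSingleton ℝ u) 0 :=
    (ContinuousLinearMap.toSpanSingleton ℝ u).hasFDerivAt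
  refine ⟨ContDiffAt.contMDiffAt (by fun_prop), ?_⟩
  rw [h.hasMFDerivAt.mfderiv]
  have key : ∀ (y z : E) (v w : E), y = z → v = w →
      (⟨y, v⟩ : TangentBundle 𝓘(ℝ, E) E) = ⟨z, w⟩ := by
    rintro y _ v _ rfl rfl; rfl
  exact key _ _ _ _ (zero_smul ℝ u).symm (one_smul ℝ u).symm

end

/-! ### Submersions -/

section

variable {E : Type*} [NormedAddCommGroup E] [NormedSpace ℝ E] [FiniteDimensional ℝ E]
  {M : Type*} [TopologicalSpace M] [ChartedSpace E M] [IsManifold 𝓘(ℝ, E) ∞ M]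
  {E' : Type*} [NormedAddCommGroup E'] [NormedSpace ℝ E'] [FiniteDimensional ℝ E']
  {N : Type*} [TopologicalSpace N] [ChartedSpace E' N] [IsManifold 𝓘(ℝ, E') ∞ N]

/-- The normal form of a submersion: in suitable coordinates, tangent at `x` to the preferred chart,
it is a linear map. If `g` represents it in the preferred charts around `0`, with derivative `A` and
`A ∘ r = 1`, these coordinates are `z + r (g z - g 0 - A z)`. -/
theorem exists_submersion_normalForm {φ : M → N} (hφ : ContMDiff 𝓘(ℝ, E) 𝓘(ℝ, E') ∞ φ) (x : M)
    {A : E →L[ℝ] E'} (hA : mfderiv 𝓘(ℝ, E) 𝓘(ℝ, E') φ x = A) (hs : Function.Surjective A) :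
    ∃ Ψ : E → M, ContMDiffAt 𝓘(ℝ, E) 𝓘(ℝ, E) ∞ Ψ 0 ∧
      (∀ u : E, (⟨Ψ 0, mfderiv 𝓘(ℝ, E) 𝓘(ℝ, E) Ψ 0 u⟩ : TangentBundle 𝓘(ℝ, E) M) = ⟨x, u⟩) ∧
      ∀ᶠ w in 𝓝 (0 : E), φ (Ψ w) ∈ (extChartAt 𝓘(ℝ, E') (φ x)).source ∧
        extChartAt 𝓘(ℝ, E') (φ x) (φ (Ψ w)) =
          extChartAt 𝓘(ℝ, E') (φ x) (φ x) + A w := by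
  set ξ := extChartAt 𝓘(ℝ, E) x with hξ
  set η := extChartAt 𝓘(ℝ, E') (φ x) with hη
  let g : E → E' := fun z ↦ η (φ (ξ.symm z))
  have hg : ContDiffAt ℝ ∞ g (ξ x) := by
    have h := (contMDiffAt_iff.1 (hφ x)).2
    rwa [𝓘(ℝ, E).range_eq_univ, contDiffWithinAt_univ] at h
  have hAg : A = fderiv ℝ g (ξ x) := by
    refine hA.symm.trans ((hφ.mdifferentiableAt (by simp)).mfderiv.trans ?_)
    rw [𝓘(ℝ, E).range_eq_univ, fderivWithin_univ]
    rfl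
  obtain ⟨r', hr'⟩ := A.toLinearMap.exists_rightInverse_of_surjective
    (LinearMap.range_eq_top.2 hs)
  let r : E' →L[ℝ] E := LinearMap.toContinuousLinearMap r'
  have hr : ∀ y, A (r y) = y := fun y ↦ LinearMap.congr_fun hr' y
  let Θ : E → E := fun z ↦ z - ξ x + r (g z - g (ξ x) - A (z - ξ x))
  have hΘ : ContDiffAt ℝ ∞ Θ (ξ x) := by fun_prop
  have hΘ0 : Θ (ξ x) = 0 := by simp [Θ]
  have hΘ' : HasFDerivAt Θ ((ContinuousLinearEquiv.refl ℝ E : E ≃L[ℝ] E) : E →L[ℝ] E) (ξ x) := by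
    have h1 : HasFDerivAt g A (ξ x) := hAg ▸ (hg.differentiableAt (by simp)).hasFDerivAt
    have h2 : HasFDerivAt (fun z ↦ z - ξ x) (ContinuousLinearMap.id ℝ E) (ξ x) :=
      (hasFDerivAt_id _).sub_const _
    have h3 := h2.add (r.hasFDerivAt.comp (ξ x) ((h1.sub_const (g (ξ x))).sub
      (A.hasFDerivAt.comp (ξ x) h2)))
    refine h3.congr_fderiv ?_
    ext v
    simp
  have hstr := hΘ.hasStrictFDerivAt' hΘ' (by simp)
  let Ψ₀ : E → E := hstr.localInverse Θ _ (ξ x)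
  have hΨ₀ : ContDiffAt ℝ ∞ Ψ₀ 0 := by
    have := hΘ.to_localInverse hΘ' (by simp)
    rwa [hΘ0] at this
  have hΨ₀0 : Ψ₀ 0 = ξ x := by rw [← hΘ0]; exact hstr.localInverse_apply_image
  have hΨ₀' : HasFDerivAt Ψ₀ (ContinuousLinearMap.id ℝ E) 0 := by
    have := hstr.to_localInverse.hasFDerivAt
    rwa [hΘ0] at this
  have hΨ₀r : ∀ᶠ w in 𝓝 (0 : E), Θ (Ψ₀ w) = w := by
    have := hstr.eventually_right_inverse
    rwa [hΘ0] at this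
  have hx : ξ x ∈ ξ.target := mem_extChartAt_target x
  have hΨ0 : ξ.symm (Ψ₀ 0) = x := by rw [hΨ₀0]; exact extChartAt_to_inv x
  have hΨ : ContMDiffAt 𝓘(ℝ, E) 𝓘(ℝ, E) ∞ (fun w ↦ ξ.symm (Ψ₀ w)) 0 := by
    have h1 : ContMDiffAt 𝓘(ℝ, E) 𝓘(ℝ, E) ∞ ξ.symm (Ψ₀ 0) := by
      rw [hΨ₀0]
      exact (contMDiffOn_extChartAt_symm x).contMDiffAt ((isOpen_extChartAt_target x).mem_nhds hx)
    exact h1.comp 0 hΨ₀.contMDiffAt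
  have htgt : ∀ᶠ w in 𝓝 (0 : E), Ψ₀ w ∈ ξ.target :=
    hΨ₀.continuousAt.eventually
      ((isOpen_extChartAt_target x).mem_nhds (by rw [hΨ₀0]; exact hx))
  refine ⟨fun w ↦ ξ.symm (Ψ₀ w), hΨ, fun u ↦ ?_, ?_⟩
  · have h0 : HasFDerivAt (writtenInExtChartAt 𝓘(ℝ, E) 𝓘(ℝ, E) (0 : E) (fun w ↦ ξ.symm (Ψ₀ w)))
        (ContinuousLinearMap.id ℝ E) (extChartAt 𝓘(ℝ, E) (0 : E) 0) := by
      have h2 : writtenInExtChartAt 𝓘(ℝ, E) 𝓘(ℝ, E) (0 : E) (fun w ↦ ξ.symm (Ψ₀ w)) =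
          fun w ↦ ξ (ξ.symm (Ψ₀ w)) := by
        funext w
        simp only [writtenInExtChartAt, Function.comp_apply, hΨ0, extChartAt_model_space_eq_id,
          PartialEquiv.refl_symm, PartialEquiv.refl_coe, id]
        rfl
      have h3 : extChartAt 𝓘(ℝ, E) (0 : E) 0 = 0 := by
        rw [extChartAt_model_space_eq_id]; rfl
      rw [h2, h3]
      refine hΨ₀'.congr_of_eventuallyEq ?_
      filter_upwards [htgt] with w hw
      exact ξ.right_inv hw
    have h1 : HasMFDerivAt 𝓘(ℝ, E) 𝓘(ℝ, E) (fun w ↦ ξ.symm (Ψ₀ w)) 0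
        (ContinuousLinearMap.id ℝ E) := ⟨hΨ.continuousAt, h0.hasFDerivWithinAt⟩
    rw [h1.mfderiv]
    have key : ∀ (y z : M) (v : E), y = z →
        (⟨y, v⟩ : TangentBundle 𝓘(ℝ, E) M) = ⟨z, v⟩ := by
      rintro y _ v rfl; rfl
    exact key _ _ _ hΨ0
  · have hsrc : ∀ᶠ w in 𝓝 (0 : E), φ (ξ.symm (Ψ₀ w)) ∈ η.source := by
      refine (hφ.continuous.continuousAt.comp hΨ.continuousAt).eventually
        ((isOpen_extChartAt_source (φ x)).mem_nhds ?_)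
      simp only [Function.comp_apply, hΨ0]
      exact mem_extChartAt_source _
    filter_upwards [hΨ₀r, hsrc] with w hw hws
    refine ⟨hws, ?_⟩
    have h1 := congrArg A hw
    simp only [Θ, map_add, map_sub, hr] at h1
    have h2 : g (ξ x) = η (φ x) := by
      simp only [g]
      rw [hξ, extChartAt_to_inv]
    rw [h2] at h1
    rw [← h1]
    show g (Ψ₀ w) = _
    abel

/-- A vector tangent to the fibre of a submersion is the velocity of a curve in this fibre. -/
theorem exists_hasVelocity_of_mfderiv_eq_zero {φ : M → N}
    (hφ : ContMDiff 𝓘(ℝ, E) 𝓘(ℝ, E') ∞ φ) {x : M}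
    (hs : Function.Surjective (mfderiv 𝓘(ℝ, E) 𝓘(ℝ, E') φ x)) {u : TangentSpace 𝓘(ℝ, E) x}
    (hu : mfderiv 𝓘(ℝ, E) 𝓘(ℝ, E') φ x u = 0) :
    ∃ c : ℝ → M, HasVelocity c ⟨x, u⟩ ∧ ∀ᶠ t in 𝓝 0, φ (c t) = φ x := by
  obtain ⟨Ψ, h1, h2, h3⟩ := exists_submersion_normalForm hφ x rfl hs
  let u' : E := u
  refine ⟨fun t ↦ Ψ (t • u'), ?_, ?_⟩
  · have h := (hasVelocity_line u').comp h1
    rwa [h2] at h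
  · have hc : Tendsto (fun t : ℝ ↦ t • u') (𝓝 0) (𝓝 (0 : E)) := by
      have h4 : ContinuousAt (fun t : ℝ ↦ t • u') 0 := by fun_prop
      simpa [ContinuousAt] using h4
    refine (hc.eventually h3).mono fun t ht ↦ ?_
    refine (extChartAt 𝓘(ℝ, E') (φ x)).injOn ht.1 (mem_extChartAt_source _) (ht.2.trans ?_)
    let B : E →L[ℝ] E' := mfderiv 𝓘(ℝ, E) 𝓘(ℝ, E') φ x
    have h5 : B (t • u') = 0 := by
      rw [map_smul, show B u' = 0 from hu, smul_zero]
    exact (congrArg _ h5).trans (add_zero _)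

theorem exists_hasVelocity (x : M) (u : TangentSpace 𝓘(ℝ, E) x) :
    ∃ c : ℝ → M, HasVelocity c ⟨x, u⟩ := by
  obtain ⟨Ψ, h1, h2, h3⟩ := exists_submersion_normalForm (φ := (id : M → M))
    (contMDiff_id (I := 𝓘(ℝ, E))) x mfderiv_id Function.surjective_id
  let u' : E := u
  refine ⟨fun t ↦ Ψ (t • u'), ?_⟩
  have h := (hasVelocity_line u').comp h1
  rwa [h2] at h

theorem exists_local_section {φ : M → N} (hφ : ContMDiff 𝓘(ℝ, E) 𝓘(ℝ, E') ∞ φ) (x : M)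
    (hs : Function.Surjective (mfderiv 𝓘(ℝ, E) 𝓘(ℝ, E') φ x)) :
    ∃ σ : N → M, ContMDiffAt 𝓘(ℝ, E') 𝓘(ℝ, E) ∞ σ (φ x) ∧ σ (φ x) = x ∧
      ∀ᶠ y in 𝓝 (φ x), φ (σ y) = y := by
  obtain ⟨Ψ, h1, h2, h3⟩ := exists_submersion_normalForm hφ x rfl hs
  have hΨ0 : Ψ 0 = x := congrArg (fun z : TangentBundle 𝓘(ℝ, E) M ↦ z.1) (h2 0)
  let A : E →L[ℝ] E' := mfderiv 𝓘(ℝ, E) 𝓘(ℝ, E') φ x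
  obtain ⟨r', hr'⟩ := A.toLinearMap.exists_rightInverse_of_surjective (LinearMap.range_eq_top.2 hs)
  let r : E' →L[ℝ] E := LinearMap.toContinuousLinearMap r'
  have hr : ∀ y, A (r y) = y := fun y ↦ LinearMap.congr_fun hr' y
  let η := extChartAt 𝓘(ℝ, E') (φ x)
  let q : N → E := fun y ↦ r (η y - η (φ x))
  have hq0 : q (φ x) = 0 := by simp [q]
  have hq : ContMDiffAt 𝓘(ℝ, E') 𝓘(ℝ, E) ∞ q (φ x) := by
    have h4 : ContDiff ℝ ∞ (fun z : E' ↦ r (z - η (φ x))) := by fun_prop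
    exact h4.contMDiff.contMDiffAt.comp (φ x) contMDiffAt_extChartAt
  refine ⟨fun y ↦ Ψ (q y), ?_, by simp only [hq0, hΨ0], ?_⟩
  · exact ContMDiffAt.comp (φ x) (by rw [hq0]; exact h1) hq
  · have h4 := hq.continuousAt.eventually (by rw [hq0]; exact h3)
    filter_upwards [h4, (isOpen_extChartAt_source (I := 𝓘(ℝ, E')) (φ x)).mem_nhds
      (mem_extChartAt_source _)] with y hy hys
    refine η.injOn hy.1 hys (hy.2.trans ?_)
    refine (congrArg (η (φ x) + ·) (hr (η y - η (φ x)))).trans ?_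
    simp

end

/-! ### Tangent vectors of groupoids -/

section

variable {E : Type*} [NormedAddCommGroup E] [NormedSpace ℝ E]
  {M : Type*} [TopologicalSpace M] [ChartedSpace E M]

theorem tangent_mk_eq {x y : M} {v w : E} (h : x = y) (h' : v = w) :
    (⟨x, v⟩ : TangentBundle 𝓘(ℝ, E) M) = ⟨y, w⟩ := by
  subst h h'; rfl

theorem tangent_snd_eq {x y : M} {v w : E}
    (h : (⟨x, v⟩ : TangentBundle 𝓘(ℝ, E) M) = ⟨y, w⟩) : v = w := by
  cases h; rfl

end

namespace LieGroupoid

variable {E F : Type*} [NormedAddCommGroup E] [NormedSpace ℝ E] [FiniteDimensional ℝ E]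
  [NormedAddCommGroup F] [NormedSpace ℝ F] [FiniteDimensional ℝ F]
  {S P : Type*} [TopologicalSpace S] [ChartedSpace F S] [IsManifold 𝓘(ℝ, F) ∞ S]
  [TopologicalSpace P] [ChartedSpace E P] [IsManifold 𝓘(ℝ, E) ∞ P]
  (G : LieGroupoid E F S P)

theorem contMDiffAt_mul_curve {E' H' : Type*} [NormedAddCommGroup E'] [NormedSpace ℝ E']
    [TopologicalSpace H'] {I' : ModelWithCorners ℝ E' H'} {N : Type*} [TopologicalSpace N]
    [ChartedSpace H' N] {b c : N → S} {n : N} (hb : ContMDiffAt I' 𝓘(ℝ, F) ∞ b n)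
    (hc : ContMDiffAt I' 𝓘(ℝ, F) ∞ c n) (h : ∀ᶠ t in 𝓝 n, G.source (b t) = G.target (c t)) :
    ContMDiffAt I' 𝓘(ℝ, F) ∞ (fun t ↦ G.mul (b t) (c t)) n := by
  have h1 := ContMDiffWithinAt.comp n (G.contMDiffOn_mul (b n, c n) h.self_of_nhds)
    ((hb.prodMk hc).contMDiffWithinAt (s := {t | G.source (b t) = G.target (c t)})) fun t ht ↦ ht
  exact h1.contMDiffAt h

/-- The right translation `T(R_g)` on tangent vectors at `1_{β g}`, as in `rightInvariant`. -/
def rightTranslation (g : S) (u : TangentSpace 𝓘(ℝ, F) (G.one (G.target g))) :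
    TangentSpace 𝓘(ℝ, F) g :=
  mfderivWithin 𝓘(ℝ, F) 𝓘(ℝ, F) (fun h ↦ G.mul h g) (G.source ⁻¹' {G.target g})
    (G.one (G.target g)) u

theorem rightInvariant_apply (X : Cₛ^∞⟮𝓘(ℝ, E); AModel E F, G.A⟯) (g : S) :
    G.rightInvariant X g = G.rightTranslation g (X (G.target g)).1 := rfl

theorem hasVelocity_rightTranslation {g : S} {u : TangentSpace 𝓘(ℝ, F) (G.one (G.target g))}
    {b : ℝ → S} (hb : HasVelocity b ⟨G.one (G.target g), u⟩)
    (hs : ∀ᶠ t in 𝓝 0, G.source (b t) = G.target g) :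
    HasVelocity (fun t ↦ G.mul (b t) g) ⟨g, G.rightTranslation g u⟩ := by
  have hb0 := hb.apply_zero
  refine ⟨G.contMDiffAt_mul_curve hb.1 contMDiffAt_const hs, ?_⟩
  have h1 : MDifferentiableWithinAt 𝓘(ℝ, F) 𝓘(ℝ, F) (fun h ↦ G.mul h g)
      (G.source ⁻¹' {G.target g}) (b 0) := by
    have h2 : ContMDiffWithinAt 𝓘(ℝ, F) 𝓘(ℝ, F) ∞ (fun h ↦ G.mul h g)
        (G.source ⁻¹' {G.target g}) (b 0) :=
      ContMDiffWithinAt.comp (b 0) (G.contMDiffOn_mul (b 0, g) hs.self_of_nhds)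
        (contMDiffWithinAt_id.prodMk contMDiffWithinAt_const) fun h hh ↦ hh
    exact h2.mdifferentiableWithinAt (by simp)
  have h3 := HasMFDerivWithinAt.comp (0 : ℝ) h1.hasMFDerivWithinAt
    ((hb.1.mdifferentiableAt (by simp)).hasMFDerivAt.hasMFDerivWithinAt
      (s := {t | G.source (b t) = G.target g})) fun t ht ↦ ht
  have h4 := (h3.hasMFDerivAt hs).mfderiv
  refine tangent_mk_eq ?_ ?_
  · show g = G.mul (b 0) g
    rw [hb0, G.one_mul]
  · refine Eq.trans ?_ (DFunLike.congr_fun h4 (1 : ℝ)).symm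
    have h5 := hb.2
    clear h4 h3 h1 hs
    show (mfderivWithin 𝓘(ℝ, F) 𝓘(ℝ, F) (fun h ↦ G.mul h g) (G.source ⁻¹' {G.target g})
      (G.one (G.target g)) u : F) = (mfderivWithin 𝓘(ℝ, F) 𝓘(ℝ, F) (fun h ↦ G.mul h g)
      (G.source ⁻¹' {G.target g}) (b 0) (mfderiv 𝓘(ℝ, ℝ) 𝓘(ℝ, F) b 0 (1 : ℝ)) : F)
    have key : ∀ (y z : S) (v : TangentSpace 𝓘(ℝ, F) y) (w : TangentSpace 𝓘(ℝ, F) z),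
        (⟨y, v⟩ : TangentBundle 𝓘(ℝ, F) S) = ⟨z, w⟩ →
        (mfderivWithin 𝓘(ℝ, F) 𝓘(ℝ, F) (fun h ↦ G.mul h g) (G.source ⁻¹' {G.target g}) y v : F) =
        (mfderivWithin 𝓘(ℝ, F) 𝓘(ℝ, F) (fun h ↦ G.mul h g) (G.source ⁻¹' {G.target g}) z w : F) := by
      intro y z v w h
      cases h; rfl
    exact key _ _ _ _ h5

theorem exists_hasVelocity_of_mem_vert {m : P} {u : TangentSpace 𝓘(ℝ, F) (G.one m)}
    (hu : u ∈ G.vert m) : ∃ b : ℝ → S, HasVelocity b ⟨G.one m, u⟩ ∧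
      ∀ᶠ t in 𝓝 0, G.source (b t) = m := by
  obtain ⟨b, hb, hs⟩ := exists_hasVelocity_of_mfderiv_eq_zero G.source.contMDiff
    (G.source_submersion (G.one m)) hu
  exact ⟨b, hb, by simpa only [G.source_one] using hs⟩

theorem mfderiv_source_rightTranslation {g : S} {u : TangentSpace 𝓘(ℝ, F) (G.one (G.target g))}
    (hu : u ∈ G.vert (G.target g)) :
    mfderiv 𝓘(ℝ, F) 𝓘(ℝ, E) G.source g (G.rightTranslation g u) = 0 := by
  obtain ⟨b, hb, hs⟩ := G.exists_hasVelocity_of_mem_vert hu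
  have h1 := (G.hasVelocity_rightTranslation hb hs).comp (G.source.contMDiff g)
  have h2 : HasVelocity (fun t ↦ G.source (G.mul (b t) g)) ⟨G.source g, 0⟩ :=
    (hasVelocity_const (E := E) (G.source g)).congr (hs.mono fun t ht ↦ G.source_mul _ _ ht)
  exact tangent_snd_eq (E := E) (h1.unique h2)

/-- `T(β)` is unchanged by right translations. -/
theorem mfderiv_target_rightTranslation {g : S} {u : TangentSpace 𝓘(ℝ, F) (G.one (G.target g))}
    (hu : u ∈ G.vert (G.target g)) :
    (mfderiv 𝓘(ℝ, F) 𝓘(ℝ, E) G.target g (G.rightTranslation g u) : E) =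
      mfderiv 𝓘(ℝ, F) 𝓘(ℝ, E) G.target (G.one (G.target g)) u := by
  obtain ⟨b, hb, hs⟩ := G.exists_hasVelocity_of_mem_vert hu
  have h1 := (G.hasVelocity_rightTranslation hb hs).comp (G.target.contMDiff g)
  have h2 := (hb.comp (G.target.contMDiff _)).congr
    (c' := fun t ↦ G.target (G.mul (b t) g)) (hs.mono fun t ht ↦ G.target_mul _ _ ht)
  exact tangent_snd_eq (E := E) (h1.unique h2)

/-- Right translation by `1_m` is the identity; `u'` is `u` as a vector at `1_{β(1_m)}`. -/
theorem rightTranslation_one {m : P} {u : TangentSpace 𝓘(ℝ, F) (G.one m)} (hu : u ∈ G.vert m)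
    {u' : TangentSpace 𝓘(ℝ, F) (G.one (G.target (G.one m)))} (huu' : (u : F) = u') :
    (G.rightTranslation (G.one m) u' : F) = u := by
  obtain ⟨b, hb, hs⟩ := G.exists_hasVelocity_of_mem_vert hu
  have hm := G.target_one m
  have hb' : HasVelocity b ⟨G.one (G.target (G.one m)), u'⟩ := by
    rwa [← tangent_mk_eq (E := F) (congrArg G.one hm).symm huu']
  have h1 := G.hasVelocity_rightTranslation hb' (by rw [hm]; exact hs)
  have h2 := hb.congr (c' := fun t ↦ G.mul (b t) (G.one m)) (hs.mono fun t ht ↦ by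
    rw [← ht]; exact G.mul_one (b t))
  exact tangent_snd_eq (E := F) (h1.unique h2)

end LieGroupoid

namespace SymplecticGroupoid

variable {E F : Type*} [NormedAddCommGroup E] [NormedSpace ℝ E] [FiniteDimensional ℝ E]
  [NormedAddCommGroup F] [NormedSpace ℝ F] [FiniteDimensional ℝ F]
  {S P : Type*} [TopologicalSpace S] [ChartedSpace F S] [IsManifold 𝓘(ℝ, F) ∞ S]
  [TopologicalSpace P] [ChartedSpace E P] [IsManifold 𝓘(ℝ, E) ∞ P]
  (G : SymplecticGroupoid E F S P)

/-- Multiplicativity of the symplectic form, for the velocities of products of curves. -/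
theorem form_mul {b c b' c' : ℝ → S} {x y z : S} (hz : G.mul x y = z)
    {u u' : TangentSpace 𝓘(ℝ, F) x} {v v' : TangentSpace 𝓘(ℝ, F) y}
    {w w' : TangentSpace 𝓘(ℝ, F) z} (hb : HasVelocity b ⟨x, u⟩) (hc : HasVelocity c ⟨y, v⟩)
    (hbc : ∀ᶠ t in 𝓝 0, G.source (b t) = G.target (c t))
    (hw : HasVelocity (fun t ↦ G.mul (b t) (c t)) ⟨z, w⟩)
    (hb' : HasVelocity b' ⟨x, u'⟩) (hc' : HasVelocity c' ⟨y, v'⟩)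
    (hbc' : ∀ᶠ t in 𝓝 0, G.source (b' t) = G.target (c' t))
    (hw' : HasVelocity (fun t ↦ G.mul (b' t) (c' t)) ⟨z, w'⟩) :
    G.form.form z w w' = G.form.form x u u' + G.form.form y v v' := by
  have hxy : G.source x = G.target y := by
    have h := hbc.self_of_nhds
    rwa [hb.apply_zero, hc.apply_zero] at h
  have key : ∀ {b c : ℝ → S} {u : TangentSpace 𝓘(ℝ, F) x} {v : TangentSpace 𝓘(ℝ, F) y}
      {w : TangentSpace 𝓘(ℝ, F) z}, HasVelocity b ⟨x, u⟩ → HasVelocity c ⟨y, v⟩ →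
      (∀ᶠ t in 𝓝 0, G.source (b t) = G.target (c t)) →
      HasVelocity (fun t ↦ G.mul (b t) (c t)) ⟨z, w⟩ →
      ((w, (u, v)) : F × (F × F)) ∈ tangentVectors (𝓘(ℝ, F).prod (𝓘(ℝ, F).prod 𝓘(ℝ, F)))
        G.mulGraph (z, x, y) := by
    intro b c u v w hb hc hbc hw
    refine ⟨fun t ↦ (G.mul (b t) (c t), b t, c t), hw.1.prodMk (hb.1.prodMk hc.1),
      hbc.mono fun t ht ↦ ⟨ht, rfl⟩, ?_⟩
    have hbd := hb.1.mdifferentiableAt (n := ∞) (by simp)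
    have hcd := hc.1.mdifferentiableAt (n := ∞) (by simp)
    have hwd := hw.1.mdifferentiableAt (n := ∞) (by simp)
    have h1 := (hwd.hasMFDerivAt.prodMk (hbd.hasMFDerivAt.prodMk hcd.hasMFDerivAt)).mfderiv
    have h2 : ∀ {p q : S × S × S} {k l : F × F × F}, p = q → k = l →
        (⟨p, k⟩ : TangentBundle (𝓘(ℝ, F).prod (𝓘(ℝ, F).prod 𝓘(ℝ, F))) (S × S × S)) = ⟨q, l⟩ := by
      intro p q k l h h'
      subst h h'; rfl
    refine h2 ?_ ((?_ : _ = _).trans (DFunLike.congr_fun h1 (1 : ℝ)).symm)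
    · have hw0 := hw.apply_zero
      exact Prod.ext hw0.symm (Prod.ext hb.apply_zero.symm hc.apply_zero.symm)
    · exact Prod.ext (tangent_snd_eq hw.2) (Prod.ext (tangent_snd_eq hb.2) (tangent_snd_eq hc.2))
  have h := (G.isLagrangian (z, x, y) ⟨hxy, hz.symm⟩).1 _ (key hb hc hbc hw) _
    (key hb' hc' hbc' hw')
  have h' : -G.form.form z w w' + G.form.form x u u' + G.form.form y v v' = 0 := h
  linarith

/-- The identity section is isotropic. -/
theorem form_one_one {m : P} (x y : TangentSpace 𝓘(ℝ, E) m) :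
    G.form.form (G.one m) (mfderiv 𝓘(ℝ, E) 𝓘(ℝ, F) G.one m x)
      (mfderiv 𝓘(ℝ, E) 𝓘(ℝ, F) G.one m y) = 0 := by
  obtain ⟨c, hc⟩ := exists_hasVelocity m x
  obtain ⟨d, hd⟩ := exists_hasVelocity m y
  have hmul : ∀ p, G.mul (G.one p) (G.one p) = G.one p := fun p ↦ by
    have := G.one_mul (G.one p)
    rwa [G.target_one] at this
  have h1 := hc.comp (G.one.contMDiff m)
  have h2 := hd.comp (G.one.contMDiff m)
  have h := G.form_mul (hmul m) h1 h1 (.of_forall fun t ↦ by rw [G.source_one, G.target_one])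
    (by simpa only [hmul] using h1) h2 h2
    (.of_forall fun t ↦ by rw [G.source_one, G.target_one]) (by simpa only [hmul] using h2)
  linarith

/-- At the identities, the tangent spaces to the source and target fibres are orthogonal. -/
theorem form_eq_zero_of_vert {m : P} {u v : TangentSpace 𝓘(ℝ, F) (G.one m)}
    (hu : u ∈ G.vert m) (hv : mfderiv 𝓘(ℝ, F) 𝓘(ℝ, E) G.target (G.one m) v = 0) :
    G.form.form (G.one m) u v = 0 := by
  obtain ⟨b, hb, hbs⟩ := G.exists_hasVelocity_of_mem_vert hu
  obtain ⟨c, hc, hcs⟩ := exists_hasVelocity_of_mfderiv_eq_zero G.target.contMDiff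
    (G.target_submersion (G.one m)) hv
  simp only [G.target_one] at hcs
  have hmul : G.mul (G.one m) (G.one m) = G.one m := by
    have := G.one_mul (G.one m)
    rwa [G.target_one] at this
  have h0 := hasVelocity_const (E := F) (G.one m)
  have h := G.form_mul hmul hb h0 (hbs.mono fun t ht ↦ by rw [ht, G.target_one])
    (hb.congr (hbs.mono fun t ht ↦ by rw [← ht]; exact G.mul_one (b t))) h0 hc
    (hcs.mono fun t ht ↦ by rw [ht, G.source_one])
    (hc.congr (hcs.mono fun t ht ↦ by rw [← ht]; exact G.one_mul (c t)))
  rw [h, map_zero, map_zero]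
  simp

/-- The symplectic form paired with a right-translated vector, from multiplicativity applied to
`1_{β g} g = g`. -/
theorem form_rightTranslation {g : S} {u : TangentSpace 𝓘(ℝ, F) (G.one (G.target g))}
    (hu : u ∈ G.vert (G.target g)) (v : TangentSpace 𝓘(ℝ, F) g) :
    G.form.form g v (G.rightTranslation g u) = G.form.form (G.one (G.target g))
      (mfderiv 𝓘(ℝ, F) 𝓘(ℝ, F) (fun h ↦ G.one (G.target h)) g v) u := by
  obtain ⟨b, hb, hbs⟩ := G.exists_hasVelocity_of_mem_vert hu
  obtain ⟨c, hc⟩ := exists_hasVelocity g v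
  have h1 := hc.comp ((G.one.contMDiff.comp G.target.contMDiff) g)
  have h := G.form_mul (G.one_mul g) h1 hc (.of_forall fun t ↦ G.source_one _)
    (hc.congr (.of_forall fun t ↦ G.one_mul (c t))) hb (hasVelocity_const g) hbs
    (G.hasVelocity_rightTranslation hb hbs)
  rw [h, map_zero, add_zero]
  rfl

end SymplecticGroupoid

/-! ### The Poisson structure on the base of a symplectic groupoid -/

section

variable {E : Type*} [NormedAddCommGroup E] [NormedSpace ℝ E]
  {M : Type*} [TopologicalSpace M] [ChartedSpace E M]
  {E' : Type*} [NormedAddCommGroup E'] [NormedSpace ℝ E']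
  {N : Type*} [TopologicalSpace N] [ChartedSpace E' N]

theorem dirDeriv_comp {φ : M → N} {x : M} (hφ : MDifferentiableAt 𝓘(ℝ, E) 𝓘(ℝ, E') φ x)
    (f : C^∞⟮𝓘(ℝ, E'), N; ℝ⟯) (v : TangentSpace 𝓘(ℝ, E) x) :
    dirDeriv (fun y ↦ f (φ y)) x v = dirDeriv f (φ x) (mfderiv 𝓘(ℝ, E) 𝓘(ℝ, E') φ x v) :=
  DFunLike.congr_fun (mfderiv_comp x (f.contMDiff.mdifferentiableAt (by simp)) hφ) v

theorem dirDeriv_congr_point (f : M → ℝ) {x y : M} {v w : E} (h : x = y) (h' : v = w) :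
    dirDeriv (E := E) f x v = dirDeriv (E := E) f y w := by
  subst h h'; rfl

end

namespace LieGroupoid

variable {E F : Type*} [NormedAddCommGroup E] [NormedSpace ℝ E] [FiniteDimensional ℝ E]
  [NormedAddCommGroup F] [NormedSpace ℝ F] [FiniteDimensional ℝ F]
  {S P : Type*} [TopologicalSpace S] [ChartedSpace F S] [IsManifold 𝓘(ℝ, F) ∞ S]
  [TopologicalSpace P] [ChartedSpace E P] [IsManifold 𝓘(ℝ, E) ∞ P]
  (G : LieGroupoid E F S P)

theorem mfderiv_source_one {m : P} (x : TangentSpace 𝓘(ℝ, E) m) :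
    (mfderiv 𝓘(ℝ, F) 𝓘(ℝ, E) G.source (G.one m) (mfderiv 𝓘(ℝ, E) 𝓘(ℝ, F) G.one m x) : E) = x := by
  obtain ⟨c, hc⟩ := exists_hasVelocity m x
  have h := (hc.comp (G.one.contMDiff m)).comp (G.source.contMDiff _)
  simp only [G.source_one] at h
  exact tangent_snd_eq (E := E) (h.unique hc)

theorem mfderiv_target_one {m : P} (x : TangentSpace 𝓘(ℝ, E) m) :
    (mfderiv 𝓘(ℝ, F) 𝓘(ℝ, E) G.target (G.one m) (mfderiv 𝓘(ℝ, E) 𝓘(ℝ, F) G.one m x) : E) = x := by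
  obtain ⟨c, hc⟩ := exists_hasVelocity m x
  have h := (hc.comp (G.one.contMDiff m)).comp (G.target.contMDiff _)
  simp only [G.target_one] at h
  exact tangent_snd_eq (E := E) (h.unique hc)

theorem comp_target_injective {f g : C^∞⟮𝓘(ℝ, E), P; ℝ⟯}
    (h : f.comp G.target = g.comp G.target) : f = g := by
  ext m
  have h1 := congrArg (fun k : C^∞⟮𝓘(ℝ, F), S; ℝ⟯ ↦ k (G.one m)) h
  have h2 : f (G.target (G.one m)) = g (G.target (G.one m)) := h1
  rwa [G.target_one] at h2

end LieGroupoid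

namespace SymplecticGroupoid

variable {E F : Type*} [NormedAddCommGroup E] [NormedSpace ℝ E] [FiniteDimensional ℝ E]
  [NormedAddCommGroup F] [NormedSpace ℝ F] [FiniteDimensional ℝ F]
  {S P : Type*} [TopologicalSpace S] [ChartedSpace F S] [IsManifold 𝓘(ℝ, F) ∞ S]
  [TopologicalSpace P] [ChartedSpace E P] [IsManifold 𝓘(ℝ, E) ∞ P]
  (G : SymplecticGroupoid E F S P)

/-- The pairing `(x, X) ↦ ω(T(1)(x), X)` of `T_m P` and `A_m S`. -/
def pairing (m : P) : E →ₗ[ℝ] G.vert m →ₗ[ℝ] ℝ :=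
  LinearMap.mk₂ ℝ (fun x X ↦ G.form.form (G.one m) (mfderiv 𝓘(ℝ, E) 𝓘(ℝ, F) G.one m x) X.1)
    (fun x x' X ↦ by
      have h := map_add (mfderiv 𝓘(ℝ, E) 𝓘(ℝ, F) G.one m) (x : TangentSpace 𝓘(ℝ, E) m) x'
      refine (congrArg (fun z ↦ G.form.form (G.one m) z X.1) h).trans ?_
      rw [map_add]; rfl)
    (fun r x X ↦ by
      have h := map_smul (mfderiv 𝓘(ℝ, E) 𝓘(ℝ, F) G.one m) r (x : TangentSpace 𝓘(ℝ, E) m)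
      refine (congrArg (fun z ↦ G.form.form (G.one m) z X.1) h).trans ?_
      rw [map_smul]; rfl)
    (fun x X X' ↦ by simp) (fun r x X ↦ by simp)

theorem pairing_injective (m : P) : Function.Injective (G.pairing m) := by
  rw [injective_iff_map_eq_zero]
  intro x₀ hx
  let x : TangentSpace 𝓘(ℝ, E) m := x₀
  have h1 : mfderiv 𝓘(ℝ, E) 𝓘(ℝ, F) G.one m x = 0 := by
    refine G.form.nondegenerate _ _ fun u ↦ ?_
    -- A vector at `1_m` splits into a vector tangent to the identities and one in `A_m S`.
    let T : F →L[ℝ] E := mfderiv 𝓘(ℝ, F) 𝓘(ℝ, E) G.source (G.one m)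
    let y : TangentSpace 𝓘(ℝ, E) m := T u
    have hu : u - mfderiv 𝓘(ℝ, E) 𝓘(ℝ, F) G.one m y ∈ G.vert m := by
      show T (u - mfderiv 𝓘(ℝ, E) 𝓘(ℝ, F) G.one m y) = 0
      exact (map_sub T _ _).trans (sub_eq_zero.2 (G.mfderiv_source_one y).symm)
    have h2 : G.form.form (G.one m) (mfderiv 𝓘(ℝ, E) 𝓘(ℝ, F) G.one m x)
      (u - mfderiv 𝓘(ℝ, E) 𝓘(ℝ, F) G.one m y) = 0 := LinearMap.congr_fun hx ⟨_, hu⟩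
    rw [map_sub, G.form_one_one, sub_zero] at h2
    exact h2
  refine (G.mfderiv_source_one x).symm.trans ?_
  exact (congrArg (mfderiv 𝓘(ℝ, F) 𝓘(ℝ, E) G.source (G.one m)) h1).trans (map_zero _)

theorem form_eq_of_vert {m : P} {X : TangentSpace 𝓘(ℝ, F) (G.one m)} (hX : X ∈ G.vert m)
    (v : TangentSpace 𝓘(ℝ, F) (G.one m)) {y : TangentSpace 𝓘(ℝ, E) m}
    (hy : (mfderiv 𝓘(ℝ, F) 𝓘(ℝ, E) G.target (G.one m) v : E) = y) :
    G.form.form (G.one m) v X =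
      G.form.form (G.one m) (mfderiv 𝓘(ℝ, E) 𝓘(ℝ, F) G.one m y) X := by
  let T : F →L[ℝ] E := mfderiv 𝓘(ℝ, F) 𝓘(ℝ, E) G.target (G.one m)
  have hv : T (v - mfderiv 𝓘(ℝ, E) 𝓘(ℝ, F) G.one m y) = 0 :=
    (map_sub T _ _).trans (sub_eq_zero.2 (hy.trans (G.mfderiv_target_one y).symm))
  have h := G.form_eq_zero_of_vert hX hv
  rw [G.form.swap, map_sub, neg_eq_zero, sub_apply, sub_eq_zero] at h
  exact h

theorem pairing_flip_injective (m : P) : Function.Injective (G.pairing m).flip := by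
  rw [injective_iff_map_eq_zero]
  intro X hX
  refine Subtype.ext (G.form.nondegenerate _ _ fun v ↦ ?_)
  rw [G.form.swap, G.form_eq_of_vert X.2 v rfl, neg_eq_zero]
  exact LinearMap.congr_fun hX _

theorem finiteDimensional_vert (m : P) : FiniteDimensional ℝ (G.vert m) :=
  haveI : FiniteDimensional ℝ (TangentSpace 𝓘(ℝ, F) (G.one m)) :=
    inferInstanceAs (FiniteDimensional ℝ F)
  inferInstance

/-- Half of the dimension count `dim S = 2 dim P` is the isotropy of the identities, the other half
is the orthogonality at identities of the source and target fibres. -/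
theorem finrank_vert (m : P) : Module.finrank ℝ (G.vert m) = Module.finrank ℝ E := by
  have := G.finiteDimensional_vert m
  refine le_antisymm ?_ ?_
  · rw [← Subspace.dual_finrank_eq (K := ℝ) (V := E)]
    exact LinearMap.finrank_le_finrank_of_injective (G.pairing_flip_injective m)
  · rw [← Subspace.dual_finrank_eq (K := ℝ) (V := G.vert m)]
    exact LinearMap.finrank_le_finrank_of_injective (G.pairing_injective m)

theorem pairing_surjective (m : P) : Function.Surjective (G.pairing m) := by
  have := G.finiteDimensional_vert m
  exact (LinearMap.injective_iff_surjective_of_finrank_eq_finrank (V₂ := Module.Dual ℝ (G.vert m))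
    ((G.finrank_vert m).symm.trans Subspace.dual_finrank_eq.symm)).1 (G.pairing_injective m)

theorem pairing_flip_surjective (m : P) : Function.Surjective (G.pairing m).flip := by
  have := G.finiteDimensional_vert m
  exact (LinearMap.injective_iff_surjective_of_finrank_eq_finrank (V₂ := Module.Dual ℝ E)
    ((G.finrank_vert m).trans Subspace.dual_finrank_eq.symm)).1 (G.pairing_flip_injective m)

theorem dirDeriv_comp_target (f : C^∞⟮𝓘(ℝ, E), P; ℝ⟯) (g : S) (v : TangentSpace 𝓘(ℝ, F) g) :
    dirDeriv (f.comp G.target) g v =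
      dirDeriv f (G.target g) (mfderiv 𝓘(ℝ, F) 𝓘(ℝ, E) G.target g v) :=
  dirDeriv_comp (G.target.contMDiff.mdifferentiableAt (by simp)) f v

/-- At `1_m` the Hamiltonian vector of `f ∘ β` lies in `A_m S`: the element of `A_m S` which pairs
with `T_m P` as `df` does satisfies its defining equation. -/
theorem sharp_comp_target_mem_vert (f : C^∞⟮𝓘(ℝ, E), P; ℝ⟯) (m : P) :
    G.form.sharp (f.comp G.target) (G.one m) ∈ G.vert m := by
  obtain ⟨X, hX⟩ := G.pairing_flip_surjective m (differentialAt (I := 𝓘(ℝ, E)) m f).toLinearMap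
  have h : G.form.sharp (f.comp G.target) (G.one m) = X.1 := by
    refine G.form.eq_of_form_eq fun v ↦ ?_
    rw [G.form.form_sharp, G.form_eq_of_vert X.2 v rfl, dirDeriv_comp_target]
    refine Eq.trans ?_ (LinearMap.congr_fun hX _).symm
    exact dirDeriv_congr_point f (G.target_one m) rfl
  rw [h]
  exact X.2

/-- The Hamiltonian vector fields of functions `f ∘ β` are right-invariant. -/
theorem sharp_comp_target_eq (f : C^∞⟮𝓘(ℝ, E), P; ℝ⟯) (g : S) :
    G.form.sharp (f.comp G.target) g =
      G.rightTranslation g (G.form.sharp (f.comp G.target) (G.one (G.target g))) := by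
  refine G.form.eq_of_form_eq fun v ↦ ?_
  rw [G.form_rightTranslation (G.sharp_comp_target_mem_vert f _), G.form.form_sharp,
    G.form.form_sharp]
  have h := dirDeriv_comp (φ := fun h ↦ G.one (G.target h)) (x := g)
    ((G.one.contMDiff.comp G.target.contMDiff).mdifferentiableAt (by simp)) (f.comp G.target) v
  refine Eq.trans ?_ h
  have h2 : (fun y ↦ (f.comp G.target) (G.one (G.target y))) = f.comp G.target := by
    funext y
    exact congrArg f (G.target_one _)
  rw [h2]

variable [T2Space S]

/-- The bracket `{f, g} = {f ∘ β, g ∘ β} ∘ 1` on the base. -/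
def baseBracket (f g : C^∞⟮𝓘(ℝ, E), P; ℝ⟯) : C^∞⟮𝓘(ℝ, E), P; ℝ⟯ :=
  (G.form.poisson.bracket (f.comp G.target) (g.comp G.target)).comp G.one

theorem baseBracket_comp_target (f g : C^∞⟮𝓘(ℝ, E), P; ℝ⟯) :
    (G.baseBracket f g).comp G.target =
      G.form.poisson.bracket (f.comp G.target) (g.comp G.target) := by
  ext x
  show dirDeriv (g.comp G.target) (G.one (G.target x)) (G.form.sharp (f.comp G.target) _) =
    dirDeriv (g.comp G.target) x (G.form.sharp (f.comp G.target) x)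
  rw [dirDeriv_comp_target, dirDeriv_comp_target, G.sharp_comp_target_eq f x]
  refine dirDeriv_congr_point g (G.target_one _) ?_
  exact (G.mfderiv_target_rightTranslation (G.sharp_comp_target_mem_vert f _)).symm

/-- The Poisson structure on the base of a symplectic groupoid. -/
def basePoisson : PoissonStructure 𝓘(ℝ, E) P where
  bracket := LinearMap.mk₂ ℝ G.baseBracket
    (fun f f' g ↦ G.comp_target_injective <| by
      rw [baseBracket_comp_target]
      show _ = (G.baseBracket f g).comp G.target + (G.baseBracket f' g).comp G.target
      rw [baseBracket_comp_target, baseBracket_comp_target, ← LinearMap.add_apply, ← map_add]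
      rfl)
    (fun r f g ↦ G.comp_target_injective <| by
      rw [baseBracket_comp_target]
      show _ = r • (G.baseBracket f g).comp G.target
      rw [baseBracket_comp_target, ← LinearMap.smul_apply, ← map_smul]
      rfl)
    (fun f g g' ↦ G.comp_target_injective <| by
      rw [baseBracket_comp_target]
      show _ = (G.baseBracket f g).comp G.target + (G.baseBracket f g').comp G.target
      rw [baseBracket_comp_target, baseBracket_comp_target, ← map_add]
      rfl)
    (fun r f g ↦ G.comp_target_injective <| by
      rw [baseBracket_comp_target]
      show _ = r • (G.baseBracket f g).comp G.target
      rw [baseBracket_comp_target, ← map_smul]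
      rfl)
  bracket_self f := G.comp_target_injective <| by
    rw [LinearMap.mk₂_apply, baseBracket_comp_target, G.form.poisson.bracket_self]
    rfl
  jacobi f g h := G.comp_target_injective <| by
    simp only [LinearMap.mk₂_apply]
    show (G.baseBracket f (G.baseBracket g h)).comp G.target +
      (G.baseBracket g (G.baseBracket h f)).comp G.target +
      (G.baseBracket h (G.baseBracket f g)).comp G.target = 0
    simp only [baseBracket_comp_target]
    exact G.form.poisson.jacobi _ _ _
  leibniz f g h := G.comp_target_injective <| by
    simp only [LinearMap.mk₂_apply]
    show _ = g.comp G.target * (G.baseBracket f h).comp G.target +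
      (G.baseBracket f g).comp G.target * h.comp G.target
    simp only [baseBracket_comp_target]
    exact G.form.poisson.leibniz (f.comp G.target) (g.comp G.target) (h.comp G.target)

theorem basePoisson_bracket (f g : C^∞⟮𝓘(ℝ, E), P; ℝ⟯) :
    G.basePoisson.bracket f g = G.baseBracket f g := rfl

theorem isTheUnique_basePoisson :
    IsTheUnique (fun π₁ ↦ IsPoissonMap G.form.poisson π₁ G.target) G.basePoisson := by
  refine ⟨fun f g ↦ (G.baseBracket_comp_target f g).symm, fun π₁ h ↦ ?_⟩
  refine PoissonStructure.ext_bracket fun f g ↦ G.comp_target_injective ?_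
  rw [← h f g, basePoisson_bracket, baseBracket_comp_target]

variable [T2Space P]

/-- The Hamiltonian vector field on the base of a symplectic groupoid, `T(β)(X_{f ∘ β})` along the
identities. -/
def baseHamiltonian (f : C^∞⟮𝓘(ℝ, E), P; ℝ⟯) :
    Cₛ^∞⟮𝓘(ℝ, E); E, (TangentSpace 𝓘(ℝ, E) : P → Type _)⟯ where
  toFun m := (mfderiv 𝓘(ℝ, F) 𝓘(ℝ, E) G.target (G.one m)
    (G.form.sharp (f.comp G.target) (G.one m)) : E)
  contMDiff_toFun m := by
    refine contMDiffAt_tangentBundle_of_dirDeriv contMDiffAt_id fun g ↦ ?_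
    refine (G.baseBracket f g).contMDiff.contMDiffAt.congr_of_eventuallyEq (.of_forall fun p ↦ ?_)
    refine Eq.trans ?_ (G.dirDeriv_comp_target g (G.one p)
      (G.form.sharp (f.comp G.target) (G.one p))).symm
    exact dirDeriv_congr_point g (G.target_one p).symm rfl

theorem lieDerivative_baseHamiltonian (f g : C^∞⟮𝓘(ℝ, E), P; ℝ⟯) :
    G.basePoisson.bracket f g = lieDerivative (G.baseHamiltonian f) g := by
  ext p
  refine (G.dirDeriv_comp_target g (G.one p) (G.form.sharp (f.comp G.target) (G.one p))).trans ?_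
  exact dirDeriv_congr_point g (G.target_one p) rfl

end SymplecticGroupoid

section

variable {E : Type*} [NormedAddCommGroup E] [NormedSpace ℝ E]
  {M : Type*} [TopologicalSpace M] [ChartedSpace E M]
  {E' : Type*} [NormedAddCommGroup E'] [NormedSpace ℝ E']
  {N : Type*} [TopologicalSpace N] [ChartedSpace E' N]

theorem HasVelocity.mfderiv_eq {c : ℝ → M} {x : M} {v : TangentSpace 𝓘(ℝ, E) x}
    (h : HasVelocity c ⟨x, v⟩) {ρ : M → N} (hρ : MDifferentiableAt 𝓘(ℝ, E) 𝓘(ℝ, E') ρ x) {y : N}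
    {w : TangentSpace 𝓘(ℝ, E') y} (h' : HasVelocity (fun t ↦ ρ (c t)) ⟨y, w⟩) :
    (mfderiv 𝓘(ℝ, E) 𝓘(ℝ, E') ρ x v : E') = w := by
  obtain ⟨h1, h2⟩ := h
  cases h2
  refine Eq.trans ?_ (tangent_snd_eq (E := E') h'.2).symm
  exact (DFunLike.congr_fun (mfderiv_comp (0 : ℝ) hρ (h1.mdifferentiableAt (by simp))) (1 : ℝ)).symm

end

/-! ### Sections of the Lie algebroid and right-invariant vector fields -/

namespace LieGroupoid

variable {E F : Type*} [NormedAddCommGroup E] [NormedSpace ℝ E] [FiniteDimensional ℝ E]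
  [NormedAddCommGroup F] [NormedSpace ℝ F] [FiniteDimensional ℝ F]
  {S P : Type*} [TopologicalSpace S] [ChartedSpace F S] [IsManifold 𝓘(ℝ, F) ∞ S]
  [TopologicalSpace P] [ChartedSpace E P] [IsManifold 𝓘(ℝ, E) ∞ P]
  (G : LieGroupoid E F S P)

theorem frame_eq {p₀ p : P} (hp : p ∈ G.locDom p₀) (u : TangentSpace 𝓘(ℝ, F) (G.one p)) :
    G.frame p₀ p u = (trivializationAt F (TangentSpace 𝓘(ℝ, F) : S → Type _) (G.one p₀)
      (⟨G.one p, u⟩ : TangentBundle 𝓘(ℝ, F) S)).2 := by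
  rw [frame, Trivialization.continuousLinearMapAt_apply,
    Trivialization.coe_linearMapAt_of_mem _ (by simpa using hp.2)]

theorem trivializationAt_A (p₀ p : P) (u : G.A p) :
    (trivializationAt (AModel E F) G.A p₀ ⟨p, u⟩).2 = G.compl p₀ (G.frame p₀ p u.1) := rfl

theorem frame_lift {p₀ p : P} (hp : p ∈ G.base p₀) (y : AModel E F) :
    G.frame p₀ p (G.lift p₀ p y) = (G.DQ p₀ p).inverse (0, y) := by
  simp only [lift, ContinuousLinearMap.comp_apply]
  rw [G.frame_frameSymm hp.1]
  rfl

/-- The inclusion of `A S` into the tangent spaces of `S` along the identities is an immersion of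
vector bundles. -/
theorem contMDiffAt_vert_iff {E' H' : Type*} [NormedAddCommGroup E'] [NormedSpace ℝ E']
    [TopologicalSpace H'] {I' : ModelWithCorners ℝ E' H'} {N : Type*} [TopologicalSpace N]
    [ChartedSpace H' N] {b : N → P} {X : ∀ n, G.A (b n)} {n₀ : N}
    (hb : ContMDiffAt I' 𝓘(ℝ, E) ∞ b n₀) :
    ContMDiffAt I' (𝓘(ℝ, E).prod 𝓘(ℝ, AModel E F)) ∞
      (fun n ↦ (⟨b n, X n⟩ : TotalSpace (AModel E F) G.A)) n₀ ↔
    ContMDiffAt I' 𝓘(ℝ, F).tangent ∞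
      (fun n ↦ (⟨G.one (b n), (X n).1⟩ : TangentBundle 𝓘(ℝ, F) S)) n₀ := by
  have hbase : ∀ᶠ n in 𝓝 n₀, b n ∈ G.base (b n₀) :=
    hb.continuousAt.eventually ((G.isOpen_base _).mem_nhds (G.mem_base _))
  have h1 : ContMDiffAt I' 𝓘(ℝ, F) ∞ (fun n ↦ G.one (b n)) n₀ := (G.one.contMDiff _).comp n₀ hb
  constructor
  · intro h
    refine contMDiffAt_totalSpace.2 ⟨h1, ?_⟩
    have h2 : ContMDiffAt I' 𝓘(ℝ, AModel E F) ∞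
        (fun n ↦ G.compl (b n₀) (G.frame (b n₀) (b n) (X n).1)) n₀ := (contMDiffAt_totalSpace.1 h).2
    have h3 : ContMDiffAt I' 𝓘(ℝ, E × AModel E F →L[ℝ] F) ∞
        (fun n ↦ (G.DQ (b n₀) (b n)).inverse) n₀ :=
      ((G.contMDiffOn_inverse (b n₀)).contMDiffAt
        ((G.isOpen_base _).mem_nhds (G.mem_base _))).comp n₀ hb
    have h4 : ContMDiffAt I' 𝓘(ℝ, E × AModel E F) ∞
        (fun n ↦ ContinuousLinearMap.inr ℝ E (AModel E F)
          (G.compl (b n₀) (G.frame (b n₀) (b n) (X n).1))) n₀ :=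
      (ContinuousLinearMap.inr ℝ E (AModel E F)).contMDiff.contMDiffAt.comp n₀ h2
    refine (h3.clm_apply h4).congr_of_eventuallyEq ?_
    filter_upwards [hbase] with n hn
    rw [← G.frame_eq hn.1]
    conv_lhs => rw [← G.lift_compl hn (X n)]
    exact G.frame_lift hn _
  · intro h
    refine contMDiffAt_totalSpace.2 ⟨hb, ?_⟩
    have h2 := (G.compl (b n₀)).contMDiff.contMDiffAt.comp n₀ (contMDiffAt_totalSpace.1 h).2
    refine h2.congr_of_eventuallyEq ?_
    filter_upwards [hbase] with n hn
    rw [trivializationAt_A, G.frame_eq hn.1]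
    rfl

theorem section_congr_point (X : Cₛ^∞⟮𝓘(ℝ, E); AModel E F, G.A⟯) {p q : P} (h : p = q) :
    ((X p).1 : F) = (X q).1 := by
  subst h; rfl

theorem rightInvariant_one (X : Cₛ^∞⟮𝓘(ℝ, E); AModel E F, G.A⟯) (m : P) :
    G.rightInvariant X (G.one m) = (X m).1 :=
  G.rightTranslation_one (X m).2 (G.section_congr_point X (G.target_one m).symm)

theorem mfderiv_source_rightInvariant (X : Cₛ^∞⟮𝓘(ℝ, E); AModel E F, G.A⟯) (g : S) :
    mfderiv 𝓘(ℝ, F) 𝓘(ℝ, E) G.source g (G.rightInvariant X g) = 0 :=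
  G.mfderiv_source_rightTranslation (X (G.target g)).2

end LieGroupoid

namespace SymplecticGroupoid

variable {E F : Type*} [NormedAddCommGroup E] [NormedSpace ℝ E] [FiniteDimensional ℝ E]
  [NormedAddCommGroup F] [NormedSpace ℝ F] [FiniteDimensional ℝ F]
  {S P : Type*} [TopologicalSpace S] [ChartedSpace F S] [IsManifold 𝓘(ℝ, F) ∞ S]
  [TopologicalSpace P] [ChartedSpace E P] [IsManifold 𝓘(ℝ, E) ∞ P]
  (G : SymplecticGroupoid E F S P)

theorem contMDiff_one_section (X : Cₛ^∞⟮𝓘(ℝ, E); LieGroupoid.AModel E F, G.A⟯) :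
    ContMDiff 𝓘(ℝ, E) 𝓘(ℝ, F).tangent ∞
      (fun m ↦ (⟨G.one m, (X m).1⟩ : TangentBundle 𝓘(ℝ, F) S)) := fun m ↦
  (G.contMDiffAt_vert_iff (b := fun m ↦ m) contMDiffAt_id).1 (X.contMDiff m)

variable [T2Space S]

/-- The right-invariant vector field of a section of `A S`. It is smooth because
`ω(X_f, X→) = ω(T(1 β)(X_f), X ∘ β)` is, for all Hamiltonian vector fields `X_f`. -/
def rightInvariantField (X : Cₛ^∞⟮𝓘(ℝ, E); LieGroupoid.AModel E F, G.A⟯) :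
    Cₛ^∞⟮𝓘(ℝ, F); F, (TangentSpace 𝓘(ℝ, F) : S → Type _)⟯ where
  toFun := G.rightInvariant X
  contMDiff_toFun g := by
    refine contMDiffAt_tangentBundle_of_dirDeriv contMDiffAt_id fun f ↦ ?_
    have h1 : ContMDiff 𝓘(ℝ, F) 𝓘(ℝ, F).tangent ∞
        (fun g ↦ tangentMap 𝓘(ℝ, F) 𝓘(ℝ, F) (fun h ↦ G.one (G.target h))
          (⟨g, G.form.sharp f g⟩ : TangentBundle 𝓘(ℝ, F) S)) :=
      ((G.one.contMDiff.comp G.target.contMDiff).contMDiff_tangentMap (by simp)).comp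
        (G.form.contMDiff_sharp f)
    have h2 : ContMDiff 𝓘(ℝ, F) 𝓘(ℝ, F).tangent ∞
        (fun g ↦ (⟨G.one (G.target g), (X (G.target g)).1⟩ : TangentBundle 𝓘(ℝ, F) S)) :=
      (G.contMDiff_one_section X).comp G.target.contMDiff
    refine ((G.form.contMDiffAt_apply (b := fun g ↦ G.one (G.target g)) (h1 g) (h2 g)).neg
      ).congr_of_eventuallyEq (.of_forall fun h ↦ ?_)
    show dirDeriv f h (G.rightInvariant X h) = _
    rw [← G.form.form_sharp, G.form.swap, LieGroupoid.rightInvariant_apply,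
      G.form_rightTranslation (X (G.target h)).2]

theorem rightInvariantField_apply (X : Cₛ^∞⟮𝓘(ℝ, E); LieGroupoid.AModel E F, G.A⟯) (g : S) :
    G.rightInvariantField X g = G.rightInvariant X g := rfl

theorem rightInvariantField_injective : Function.Injective G.rightInvariantField := by
  intro X Y h
  refine ContMDiffSection.ext fun m ↦ Subtype.ext ?_
  rw [← G.rightInvariant_one, ← G.rightInvariant_one]
  exact DFunLike.congr_fun h (G.one m)

theorem rightInvariantField_add (X Y : Cₛ^∞⟮𝓘(ℝ, E); LieGroupoid.AModel E F, G.A⟯) :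
    G.rightInvariantField (X + Y) = G.rightInvariantField X + G.rightInvariantField Y := by
  ext g
  exact map_add (mfderivWithin 𝓘(ℝ, F) 𝓘(ℝ, F) (fun h ↦ G.mul h g) (G.source ⁻¹' {G.target g})
    (G.one (G.target g))) (X (G.target g)).1 (Y (G.target g)).1

theorem rightInvariantField_smul (r : ℝ) (X : Cₛ^∞⟮𝓘(ℝ, E); LieGroupoid.AModel E F, G.A⟯) :
    G.rightInvariantField (r • X) = r • G.rightInvariantField X := by
  ext g
  exact map_smul (mfderivWithin 𝓘(ℝ, F) 𝓘(ℝ, F) (fun h ↦ G.mul h g) (G.source ⁻¹' {G.target g})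
    (G.one (G.target g))) r (X (G.target g)).1

variable [T2Space P]

theorem vectorBracket_one_mem_vert (X Y : Cₛ^∞⟮𝓘(ℝ, E); LieGroupoid.AModel E F, G.A⟯) (m : P) :
    vectorBracket (G.rightInvariantField X) (G.rightInvariantField Y) (G.one m) ∈ G.vert m := by
  have h := mfderiv_vectorBracket_of_related (G.source.contMDiff (G.one m))
    (G.rightInvariantField X) (G.rightInvariantField Y) 0 0
    (.of_forall fun g ↦ G.mfderiv_source_rightInvariant X g)
    (.of_forall fun g ↦ G.mfderiv_source_rightInvariant Y g)
  refine h.trans ?_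
  rw [vectorBracket_apply]
  exact congrFun (VectorField.mlieBracket_zero_left (I := 𝓘(ℝ, E))) _

/-- The bracket of sections of `A S`: the bracket of right-invariant vector fields, along the
identities. -/
def sectionBracket (X Y : Cₛ^∞⟮𝓘(ℝ, E); LieGroupoid.AModel E F, G.A⟯) :
    Cₛ^∞⟮𝓘(ℝ, E); LieGroupoid.AModel E F, G.A⟯ where
  toFun m := ⟨vectorBracket (G.rightInvariantField X) (G.rightInvariantField Y) (G.one m),
    G.vectorBracket_one_mem_vert X Y m⟩
  contMDiff_toFun m := (G.contMDiffAt_vert_iff (b := fun m ↦ m) contMDiffAt_id).2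
    (((vectorBracket (G.rightInvariantField X) (G.rightInvariantField Y)).contMDiff _).comp m
      (G.one.contMDiff m))

theorem sectionBracket_apply (X Y : Cₛ^∞⟮𝓘(ℝ, E); LieGroupoid.AModel E F, G.A⟯) (m : P) :
    (G.sectionBracket X Y m).1 =
      vectorBracket (G.rightInvariantField X) (G.rightInvariantField Y) (G.one m) := rfl

/-- The bracket of right-invariant vector fields is right-invariant. If `σ` is a local section of
the target map through `g`, then `h ↦ h σ(α h)` relates right-invariant vector fields to themselves,
and extends the right translation by `g`. -/
theorem rightInvariantField_sectionBracket
    (X Y : Cₛ^∞⟮𝓘(ℝ, E); LieGroupoid.AModel E F, G.A⟯) :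
    G.rightInvariantField (G.sectionBracket X Y) =
      vectorBracket (G.rightInvariantField X) (G.rightInvariantField Y) := by
  ext g
  obtain ⟨σ, hσ, hσg, hσt⟩ := exists_local_section G.target.contMDiff g (G.target_submersion g)
  let e : S := G.one (G.target g)
  have he : G.source e = G.target g := G.source_one _
  let ρ : S → S := fun h ↦ G.mul h (σ (G.source h))
  have hσs : ∀ᶠ h in 𝓝 e, G.target (σ (G.source h)) = G.source h :=
    (G.source.contMDiff e).continuousAt.eventually (by rw [he]; exact hσt)
  have hρ : ContMDiffAt 𝓘(ℝ, F) 𝓘(ℝ, F) ∞ ρ e :=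
    G.contMDiffAt_mul_curve contMDiffAt_id
      (ContMDiffAt.comp e (by rw [he]; exact hσ) (G.source.contMDiff e))
      (hσs.mono fun h hh ↦ hh.symm)
  have hρe : ρ e = g := by
    show G.mul e (σ (G.source e)) = g
    rw [he, hσg, G.one_mul]
  have hρd : ∀ᶠ h in 𝓝 e, ContMDiffAt 𝓘(ℝ, F) 𝓘(ℝ, F) 1 ρ h :=
    (contMDiffAt_iff_contMDiffAt_nhds (n := 1) (by simp)).1 (hρ.of_le (by simp))
  have hrel : ∀ Z : Cₛ^∞⟮𝓘(ℝ, E); LieGroupoid.AModel E F, G.A⟯, ∀ᶠ h in 𝓝 e,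
      mfderiv 𝓘(ℝ, F) 𝓘(ℝ, F) ρ h (G.rightInvariantField Z h) = G.rightInvariantField Z (ρ h) := by
    intro Z
    filter_upwards [hσs, hρd] with h hh hd
    obtain ⟨b, hb, hbs⟩ := G.exists_hasVelocity_of_mem_vert (Z (G.target h)).2
    have hρt : G.target (ρ h) = G.target h := G.target_mul _ _ hh.symm
    have hb' : HasVelocity b ⟨G.one (G.target (ρ h)), (Z (G.target (ρ h))).1⟩ := by
      rwa [tangent_mk_eq (E := F) (congrArg G.one hρt) (G.section_congr_point Z hρt)]
    refine (G.hasVelocity_rightTranslation hb hbs).mfderiv_eq (hd.mdifferentiableAt (by simp))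
      ((G.hasVelocity_rightTranslation hb' (by rwa [hρt])).congr (hbs.mono fun t ht ↦ ?_))
    show G.mul (G.mul (b t) h) (σ (G.source (G.mul (b t) h))) = G.mul (b t) (ρ h)
    rw [G.source_mul _ _ ht, G.mul_assoc _ _ _ ht hh.symm]
  have h1 := mfderiv_vectorBracket_of_related hρ (G.rightInvariantField X)
    (G.rightInvariantField Y) _ _ (hrel X) (hrel Y)
  obtain ⟨b, hb, hbs⟩ := G.exists_hasVelocity_of_mem_vert (G.sectionBracket X Y (G.target g)).2
  have h2 := hb.mfderiv_eq (hρ.mdifferentiableAt (by simp))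
    ((G.hasVelocity_rightTranslation hb hbs).congr (hbs.mono fun t ht ↦ by
      show G.mul (b t) (σ (G.source (b t))) = G.mul (b t) g
      rw [ht, hσg]))
  refine h2.symm.trans (h1.trans ?_)
  have h3 : ∀ x y : S, x = y → (vectorBracket (G.rightInvariantField X) (G.rightInvariantField Y) x
      : F) = vectorBracket (G.rightInvariantField X) (G.rightInvariantField Y) y := by
    rintro x _ rfl; rfl
  exact h3 _ _ hρe

end SymplecticGroupoid

/-! ### Smooth families of linear maps -/

section

variable {E : Type*} [NormedAddCommGroup E] [NormedSpace ℝ E]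
  {M : Type*} [TopologicalSpace M] [ChartedSpace E M] [IsManifold 𝓘(ℝ, E) ∞ M]
  {F₁ : Type*} [NormedAddCommGroup F₁] [NormedSpace ℝ F₁] [FiniteDimensional ℝ F₁]
  {A₁ : M → Type*} [TopologicalSpace (TotalSpace F₁ A₁)] [∀ m, AddCommGroup (A₁ m)]
  [∀ m, Module ℝ (A₁ m)] [∀ m, TopologicalSpace (A₁ m)] [FiberBundle F₁ A₁] [VectorBundle ℝ F₁ A₁]
  [ContMDiffVectorBundle ∞ F₁ A₁ 𝓘(ℝ, E)]
  {F₂ : Type*} [NormedAddCommGroup F₂] [NormedSpace ℝ F₂]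
  {A₂ : M → Type*} [TopologicalSpace (TotalSpace F₂ A₂)] [∀ m, AddCommGroup (A₂ m)]
  [∀ m, Module ℝ (A₂ m)] [∀ m, TopologicalSpace (A₂ m)] [FiberBundle F₂ A₂] [VectorBundle ℝ F₂ A₂]
  [ContMDiffVectorBundle ∞ F₂ A₂ 𝓘(ℝ, E)]
  [∀ m, IsTopologicalAddGroup (A₂ m)] [∀ m, ContinuousSMul ℝ (A₂ m)]

/-- A family of linear maps between the fibres of vector bundles is smooth if it maps smooth
families of vectors to smooth families. -/
theorem contMDiffAt_hom_of_forall_section {E' H' : Type*} [NormedAddCommGroup E']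
    [NormedSpace ℝ E'] [TopologicalSpace H'] {I' : ModelWithCorners ℝ E' H'} {N : Type*}
    [TopologicalSpace N] [ChartedSpace H' N] {b : N → M} {φ : ∀ n, A₁ (b n) →L[ℝ] A₂ (b n)} {n₀ : N}
    (hb : ContMDiffAt I' 𝓘(ℝ, E) ∞ b n₀)
    (h : ∀ s : ∀ n, A₁ (b n), ContMDiffAt I' (𝓘(ℝ, E).prod 𝓘(ℝ, F₁)) ∞
        (fun n ↦ (⟨b n, s n⟩ : TotalSpace F₁ A₁)) n₀ →
      ContMDiffAt I' (𝓘(ℝ, E).prod 𝓘(ℝ, F₂)) ∞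
        (fun n ↦ (⟨b n, φ n (s n)⟩ : TotalSpace F₂ A₂)) n₀) :
    ContMDiffAt I' (𝓘(ℝ, E).prod 𝓘(ℝ, F₁ →L[ℝ] F₂)) ∞
      (fun n ↦ (⟨b n, φ n⟩ : TotalSpace (F₁ →L[ℝ] F₂) fun m ↦ A₁ m →L[ℝ] A₂ m)) n₀ := by
  refine (contMDiffAt_hom_bundle _).2 ⟨hb, ?_⟩
  let e₁ := trivializationAt F₁ A₁ (b n₀)
  let e₂ := trivializationAt F₂ A₂ (b n₀)
  let β := Module.finBasis ℝ F₁
  have h₁ : ∀ᶠ n in 𝓝 n₀, b n ∈ e₁.baseSet := hb.continuousAt.eventually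
    (e₁.open_baseSet.mem_nhds (FiberBundle.mem_baseSet_trivializationAt' _))
  have h₂ : ∀ᶠ n in 𝓝 n₀, b n ∈ e₂.baseSet := hb.continuousAt.eventually
    (e₂.open_baseSet.mem_nhds (FiberBundle.mem_baseSet_trivializationAt' _))
  have hs : ∀ y : F₁, ContMDiffAt I' 𝓘(ℝ, F₂) ∞
      (fun n ↦ (e₂ ⟨b n, φ n (e₁.symmL ℝ (b n) y)⟩).2) n₀ := fun y ↦ by
    refine (contMDiffAt_totalSpace.1 (h (fun n ↦ e₁.symmL ℝ (b n) y) ?_)).2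
    refine contMDiffAt_totalSpace.2 ⟨hb, (contMDiffAt_const (c := y)).congr_of_eventuallyEq ?_⟩
    filter_upwards [h₁] with n hn
    rw [e₁.symmL_apply hn]
    exact congrArg Prod.snd (e₁.apply_mk_symm hn y)
  have hsum : ContMDiffAt I' 𝓘(ℝ, F₁ →L[ℝ] F₂) ∞ (fun n ↦ ∑ i,
      ContinuousLinearMap.smulRightL ℝ F₁ F₂ (LinearMap.toContinuousLinearMap (β.coord i))
        (e₂ ⟨b n, φ n (e₁.symmL ℝ (b n) (β i))⟩).2) n₀ :=
    ContMDiffAt.sum fun i _ ↦ (ContinuousLinearMap.contMDiff _).contMDiffAt.comp n₀ (hs (β i))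
  refine hsum.congr_of_eventuallyEq ?_
  filter_upwards [h₂] with n hn
  ext y
  simp only [ContinuousLinearMap.inCoordinates, ContinuousLinearMap.comp_apply, sum_apply,
    ContinuousLinearMap.smulRightL_apply_apply]
  conv_lhs => rw [← β.sum_repr y]
  simp only [map_sum, map_smul]
  refine Finset.sum_congr rfl fun i _ ↦ congrArg _ ?_
  rw [Trivialization.continuousLinearMapAt_apply, Trivialization.coe_linearMapAt_of_mem _ hn]

end

/-! ### Algebra of vector fields -/

section

variable {E : Type*} [NormedAddCommGroup E] [NormedSpace ℝ E] [FiniteDimensional ℝ E]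
  {M : Type*} [TopologicalSpace M] [ChartedSpace E M] [IsManifold 𝓘(ℝ, E) ∞ M]

theorem lieDerivative_add_field
    (V W : Cₛ^∞⟮𝓘(ℝ, E); E, (TangentSpace 𝓘(ℝ, E) : M → Type _)⟯) :
    lieDerivative (V + W) = lieDerivative V + lieDerivative W := by
  ext f x
  exact map_add (mfderiv 𝓘(ℝ, E) 𝓘(ℝ, ℝ) f x) (V x) (W x)

theorem lieDerivative_smul_field (r : ℝ)
    (V : Cₛ^∞⟮𝓘(ℝ, E); E, (TangentSpace 𝓘(ℝ, E) : M → Type _)⟯) :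
    lieDerivative (r • V) = r • lieDerivative V := by
  ext f x
  exact map_smul (mfderiv 𝓘(ℝ, E) 𝓘(ℝ, ℝ) f x) r (V x)

theorem lieDerivative_zero_field :
    lieDerivative (0 : Cₛ^∞⟮𝓘(ℝ, E); E, (TangentSpace 𝓘(ℝ, E) : M → Type _)⟯) = 0 := by
  ext f x
  exact map_zero (mfderiv 𝓘(ℝ, E) 𝓘(ℝ, ℝ) f x)

variable [T2Space M]

theorem lieDerivative_injective : Function.Injective
    (lieDerivative : Cₛ^∞⟮𝓘(ℝ, E); E, (TangentSpace 𝓘(ℝ, E) : M → Type _)⟯ → _) := fun V W h ↦ by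
  refine ContMDiffSection.ext fun x ↦ eq_of_dirDeriv_eq fun f ↦ ?_
  exact congrArg (fun k : C^∞⟮𝓘(ℝ, E), M; ℝ⟯ ↦ k x) (LinearMap.congr_fun h f)

variable (U V W : Cₛ^∞⟮𝓘(ℝ, E); E, (TangentSpace 𝓘(ℝ, E) : M → Type _)⟯)

theorem vectorBracket_self : vectorBracket V V = 0 := by
  refine lieDerivative_injective (LinearMap.ext fun f ↦ ?_)
  rw [lieDerivative_vectorBracket, sub_self, lieDerivative_zero_field]
  rfl

theorem vectorBracket_add_left : vectorBracket (U + V) W = vectorBracket U W + vectorBracket V W := by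
  refine lieDerivative_injective (LinearMap.ext fun f ↦ ?_)
  simp only [lieDerivative_add_field, LinearMap.add_apply, lieDerivative_vectorBracket, map_add]
  abel

theorem vectorBracket_add_right :
    vectorBracket U (V + W) = vectorBracket U V + vectorBracket U W := by
  refine lieDerivative_injective (LinearMap.ext fun f ↦ ?_)
  simp only [lieDerivative_add_field, LinearMap.add_apply, lieDerivative_vectorBracket, map_add]
  abel

theorem vectorBracket_smul_left (r : ℝ) : vectorBracket (r • V) W = r • vectorBracket V W := by
  refine lieDerivative_injective (LinearMap.ext fun f ↦ ?_)
  simp only [lieDerivative_smul_field, LinearMap.smul_apply, lieDerivative_vectorBracket, map_smul,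
    smul_sub]

theorem vectorBracket_smul_right (r : ℝ) : vectorBracket V (r • W) = r • vectorBracket V W := by
  refine lieDerivative_injective (LinearMap.ext fun f ↦ ?_)
  simp only [lieDerivative_smul_field, LinearMap.smul_apply, lieDerivative_vectorBracket, map_smul,
    smul_sub]

theorem vectorBracket_jacobi : vectorBracket U (vectorBracket V W) +
    vectorBracket V (vectorBracket W U) + vectorBracket W (vectorBracket U V) = 0 := by
  refine lieDerivative_injective (LinearMap.ext fun f ↦ ?_)
  simp only [lieDerivative_add_field, LinearMap.add_apply, lieDerivative_vectorBracket, map_sub,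
    lieDerivative_zero_field, LinearMap.zero_apply]
  abel

/-- The Leibniz rule for the Lie bracket of vector fields. -/
theorem vectorBracket_mul {W' : Cₛ^∞⟮𝓘(ℝ, E); E, (TangentSpace 𝓘(ℝ, E) : M → Type _)⟯}
    {h : C^∞⟮𝓘(ℝ, E), M; ℝ⟯} (hW : ∀ x, W' x = h x • W x) (x : M) :
    vectorBracket V W' x = h x • vectorBracket V W x + dirDeriv h x (V x) • W x := by
  have h1 : ∀ f, lieDerivative W' f = h * lieDerivative W f := fun f ↦ by
    ext y
    show dirDeriv f y (W' y) = h y * dirDeriv f y (W y)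
    rw [hW]
    exact map_smul (mfderiv 𝓘(ℝ, E) 𝓘(ℝ, ℝ) f y) (h y) (W y)
  refine eq_of_dirDeriv_eq fun f ↦ ?_
  have h2 : ∀ (r r' : ℝ) (u v : TangentSpace 𝓘(ℝ, E) x),
      dirDeriv f x (r • u + r' • v) = r * dirDeriv f x u + r' * dirDeriv f x v := fun r r' u v ↦
    (map_add (mfderiv 𝓘(ℝ, E) 𝓘(ℝ, ℝ) f x) _ _).trans (congrArg₂ (· + ·)
      (map_smul (mfderiv 𝓘(ℝ, E) 𝓘(ℝ, ℝ) f x) r u) (map_smul (mfderiv 𝓘(ℝ, E) 𝓘(ℝ, ℝ) f x) r' v))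
  have h3 : lieDerivative (vectorBracket V W') f = h * lieDerivative (vectorBracket V W) f +
      lieDerivative V h * lieDerivative W f := by
    rw [lieDerivative_vectorBracket, lieDerivative_vectorBracket, h1, h1, lieDerivative_mul]
    ring
  rw [h2]
  exact congrArg (fun k : C^∞⟮𝓘(ℝ, E), M; ℝ⟯ ↦ k x) h3

end

/-! ### The Lie algebroid of a symplectic groupoid -/

namespace SymplecticGroupoid

variable {E F : Type*} [NormedAddCommGroup E] [NormedSpace ℝ E] [FiniteDimensional ℝ E]
  [NormedAddCommGroup F] [NormedSpace ℝ F] [FiniteDimensional ℝ F]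
  {S P : Type*} [TopologicalSpace S] [ChartedSpace F S] [IsManifold 𝓘(ℝ, F) ∞ S]
  [TopologicalSpace P] [ChartedSpace E P] [IsManifold 𝓘(ℝ, E) ∞ P]
  (G : SymplecticGroupoid E F S P)

/-- The anchor, the restriction of `T(β)` to `A_m S`, as a map to `T_m P`. -/
def anchorMap (m : P) : G.A m →L[ℝ] TangentSpace 𝓘(ℝ, E) m :=
  let T : TangentSpace 𝓘(ℝ, F) (G.one m) →L[ℝ] E := mfderiv 𝓘(ℝ, F) 𝓘(ℝ, E) G.target (G.one m)
  T.comp (G.vert m).subtypeL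

theorem contMDiffAt_anchorMap_apply {E' H' : Type*} [NormedAddCommGroup E'] [NormedSpace ℝ E']
    [TopologicalSpace H'] {I' : ModelWithCorners ℝ E' H'} {N : Type*} [TopologicalSpace N]
    [ChartedSpace H' N] {b : N → P} {s : ∀ n, G.A (b n)} {n₀ : N}
    (hs : ContMDiffAt I' (𝓘(ℝ, E).prod 𝓘(ℝ, LieGroupoid.AModel E F)) ∞
      (fun n ↦ (⟨b n, s n⟩ : TotalSpace (LieGroupoid.AModel E F) G.A)) n₀) :
    ContMDiffAt I' 𝓘(ℝ, E).tangent ∞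
      (fun n ↦ (⟨b n, G.anchorMap (b n) (s n)⟩ : TangentBundle 𝓘(ℝ, E) P)) n₀ := by
  have h1 := (G.contMDiffAt_vert_iff (contMDiffAt_totalSpace.1 hs).1).1 hs
  have h2 : ContMDiff 𝓘(ℝ, F).tangent 𝓘(ℝ, E).tangent ∞
      (tangentMap 𝓘(ℝ, F) 𝓘(ℝ, E) G.target) := G.target.contMDiff.contMDiff_tangentMap (by simp)
  refine ((h2 _).comp n₀ h1).congr_of_eventuallyEq (.of_forall fun n ↦ ?_)
  exact tangent_mk_eq (E := E) (G.target_one _).symm rfl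

variable [T2Space S] [T2Space P]

/-- The Lie algebroid of a symplectic groupoid. -/
def lieAlgebroid : LieAlgebroid E (LieGroupoid.AModel E F) G.A where
  bracket := LinearMap.mk₂ ℝ G.sectionBracket
    (fun X X' Y ↦ G.rightInvariantField_injective <| by
      simp only [rightInvariantField_add, rightInvariantField_sectionBracket,
        vectorBracket_add_left])
    (fun r X Y ↦ G.rightInvariantField_injective <| by
      simp only [rightInvariantField_smul, rightInvariantField_sectionBracket,
        vectorBracket_smul_left])
    (fun X Y Y' ↦ G.rightInvariantField_injective <| by
      simp only [rightInvariantField_add, rightInvariantField_sectionBracket,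
        vectorBracket_add_right])
    (fun r X Y ↦ G.rightInvariantField_injective <| by
      simp only [rightInvariantField_smul, rightInvariantField_sectionBracket,
        vectorBracket_smul_right])
  anchor := G.anchorMap
  contMDiff_anchor m := contMDiffAt_hom_of_forall_section (b := fun m ↦ m) contMDiffAt_id
    fun s hs ↦ G.contMDiffAt_anchorMap_apply hs
  bracket_self X := by
    refine ContMDiffSection.ext fun m ↦ Subtype.ext ?_
    rw [LinearMap.mk₂_apply, sectionBracket_apply, vectorBracket_self]
    rfl
  jacobi X Y Z := by
    refine ContMDiffSection.ext fun m ↦ Subtype.ext ?_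
    simp only [LinearMap.mk₂_apply]
    show (G.sectionBracket X (G.sectionBracket Y Z) m).1 +
      (G.sectionBracket Y (G.sectionBracket Z X) m).1 +
      (G.sectionBracket Z (G.sectionBracket X Y) m).1 = 0
    simp only [sectionBracket_apply, rightInvariantField_sectionBracket]
    exact DFunLike.congr_fun (vectorBracket_jacobi (G.rightInvariantField X)
      (G.rightInvariantField Y) (G.rightInvariantField Z)) (G.one m)
  leibniz X Y Z f hZ m := by
    have h1 : ∀ g, G.rightInvariantField Z g =
        (f.comp G.target) g • G.rightInvariantField Y g := fun g ↦ by
      show G.rightTranslation g (Z (G.target g)).1 =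
        f (G.target g) • G.rightTranslation g (Y (G.target g)).1
      rw [hZ]
      exact map_smul (mfderivWithin 𝓘(ℝ, F) 𝓘(ℝ, F) (fun h ↦ G.mul h g)
        (G.source ⁻¹' {G.target g}) (G.one (G.target g))) (f (G.target g)) (Y (G.target g)).1
    refine Subtype.ext ?_
    simp only [LinearMap.mk₂_apply]
    show (G.sectionBracket X Z m).1 = f m • (G.sectionBracket X Y m).1 +
      dirDeriv f m (G.anchorMap m (X m)) • (Y m).1
    rw [sectionBracket_apply, vectorBracket_mul _ _ h1, sectionBracket_apply]
    have h2 : (f.comp G.target) (G.one m) = f m := congrArg f (G.target_one m)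
    have h3 : dirDeriv (f.comp G.target) (G.one m) (G.rightInvariantField X (G.one m)) =
        dirDeriv f m (G.anchorMap m (X m)) := by
      rw [rightInvariantField_apply, G.rightInvariant_one, dirDeriv_comp_target]
      exact dirDeriv_congr_point f (G.target_one m) rfl
    rw [h2, h3, G.rightInvariantField_apply Y, G.rightInvariant_one]
  anchor_bracket X Y m := by
    let aX : Cₛ^∞⟮𝓘(ℝ, E); E, (TangentSpace 𝓘(ℝ, E) : P → Type _)⟯ :=
      ⟨fun p ↦ G.anchorMap p (X p), fun p ↦ G.contMDiffAt_anchorMap_apply (X.contMDiff p)⟩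
    let aY : Cₛ^∞⟮𝓘(ℝ, E); E, (TangentSpace 𝓘(ℝ, E) : P → Type _)⟯ :=
      ⟨fun p ↦ G.anchorMap p (Y p), fun p ↦ G.contMDiffAt_anchorMap_apply (Y.contMDiff p)⟩
    have h := mfderiv_vectorBracket_of_related (G.target.contMDiff (G.one m))
      (G.rightInvariantField X) (G.rightInvariantField Y) aX aY
      (.of_forall fun g ↦ G.mfderiv_target_rightTranslation (X (G.target g)).2)
      (.of_forall fun g ↦ G.mfderiv_target_rightTranslation (Y (G.target g)).2)
    have h1 : ∀ p q : P, p = q → (vectorBracket aX aY p : E) = vectorBracket aX aY q := by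
      rintro p _ rfl; rfl
    exact Eq.trans h (h1 _ _ (G.target_one m))

theorem lieAlgebroid_bracket (X Y : Cₛ^∞⟮𝓘(ℝ, E); LieGroupoid.AModel E F, G.A⟯) :
    G.lieAlgebroid.bracket X Y = G.sectionBracket X Y := rfl

theorem isTheUnique_lieAlgebroid : IsTheUnique G.IsLieAlgebroidOf G.lieAlgebroid := by
  have h : G.IsLieAlgebroidOf G.lieAlgebroid := by
    refine ⟨fun X Y g ↦ ?_, fun m u ↦ rfl⟩
    exact DFunLike.congr_fun (G.rightInvariantField_sectionBracket X Y) g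
  refine ⟨h, fun L hL ↦ ?_⟩
  have h1 : L.bracket = G.lieAlgebroid.bracket := by
    refine LinearMap.ext fun X ↦ LinearMap.ext fun Y ↦ G.rightInvariantField_injective ?_
    refine ContMDiffSection.ext fun g ↦ ?_
    rw [rightInvariantField_apply, rightInvariantField_apply, hL.1, h.1]
  have h2 : L.anchor = G.lieAlgebroid.anchor := by
    funext m
    ext u
    exact (hL.2 m u).trans (h.2 m u).symm
  cases L
  simp only at h1 h2
  subst h1 h2
  rfl

end SymplecticGroupoid

/-! ### Tensoriality -/

section

variable {E : Type*} [NormedAddCommGroup E] [NormedSpace ℝ E] [FiniteDimensional ℝ E]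
  {M : Type*} [TopologicalSpace M] [ChartedSpace E M] [IsManifold 𝓘(ℝ, E) ∞ M] [T2Space M]
  {F : Type*} [NormedAddCommGroup F] [NormedSpace ℝ F] [FiniteDimensional ℝ F]
  {A : M → Type*} [TopologicalSpace (TotalSpace F A)] [∀ m, AddCommGroup (A m)]
  [∀ m, Module ℝ (A m)] [∀ m, TopologicalSpace (A m)] [FiberBundle F A] [VectorBundle ℝ F A]
  [ContMDiffVectorBundle ∞ F A 𝓘(ℝ, E)]

/-- A linear functional on sections which is linear over functions, evaluated at `m`, depends only
on the values of sections at `m`. With a local frame `s i`, coefficients `c i` of `Y`, and a bump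
function `χ`, one has `χ² Y = ∑ i, (χ c i) (χ s i)`. -/
theorem eq_zero_of_tensorial {m : M} (D : Cₛ^∞⟮𝓘(ℝ, E); F, A⟯ →ₗ[ℝ] ℝ)
    (hD : ∀ (f : C^∞⟮𝓘(ℝ, E), M; ℝ⟯) (Y Z : Cₛ^∞⟮𝓘(ℝ, E); F, A⟯),
      (∀ p, Z p = f p • Y p) → D Z = f m * D Y)
    {Y : Cₛ^∞⟮𝓘(ℝ, E); F, A⟯} (hY : Y m = 0) : D Y = 0 := by
  let e := trivializationAt F A m
  let b := Module.finBasis ℝ F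
  have hm : m ∈ e.baseSet := FiberBundle.mem_baseSet_trivializationAt' m
  obtain ⟨χ, -, hχ⟩ := (SmoothBumpFunction.nhds_basis_tsupport (I := 𝓘(ℝ, E)) m).mem_iff.1
    (e.open_baseSet.mem_nhds hm)
  let s : Fin (Module.finrank ℝ F) → ∀ p, A p := fun i p ↦ e.symmL ℝ p (b i)
  let c : Fin (Module.finrank ℝ F) → M → ℝ := fun i p ↦ b.coord i (e ⟨p, Y p⟩).2
  have hs : ∀ i, ContMDiffOn 𝓘(ℝ, E) (𝓘(ℝ, E).prod 𝓘(ℝ, F)) ∞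
      (fun p ↦ TotalSpace.mk' F p (s i p)) e.baseSet := fun i p hp ↦ by
    rw [e.contMDiffWithinAt_section _ hp]
    refine (contMDiffWithinAt_const (c := b i)).congr (fun q hq ↦ ?_) ?_
    · rw [show s i q = e.symm q (b i) from e.symmL_apply hq _]
      exact congrArg Prod.snd (e.apply_mk_symm hq (b i))
    · rw [show s i p = e.symm p (b i) from e.symmL_apply hp _]
      exact congrArg Prod.snd (e.apply_mk_symm hp (b i))
  have hc : ∀ i, ContMDiffOn 𝓘(ℝ, E) 𝓘(ℝ, ℝ) ∞ (c i) e.baseSet := fun i p hp ↦ by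
    have h1 := (e.contMDiffWithinAt_section e.baseSet hp).1 (Y.contMDiff.contMDiffOn p hp)
    exact (LinearMap.toContinuousLinearMap (b.coord i)).contMDiff.contMDiffAt.comp_contMDiffWithinAt
      p h1
  let X : Fin (Module.finrank ℝ F) → Cₛ^∞⟮𝓘(ℝ, E); F, A⟯ := fun i ↦ ⟨fun p ↦ χ p • s i p,
    ContMDiffOn.smul_section_of_tsupport χ.contMDiff.contMDiffOn e.open_baseSet hχ (hs i)⟩
  let a : Fin (Module.finrank ℝ F) → C^∞⟮𝓘(ℝ, E), M; ℝ⟯ := fun i ↦ ⟨fun p ↦ χ p * c i p,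
    contMDiff_of_tsupport fun p hp ↦ by
      have hp' : p ∈ e.baseSet := hχ (tsupport_mul_subset_left hp)
      exact χ.contMDiffAt.mul ((hc i).contMDiffAt (e.open_baseSet.mem_nhds hp'))⟩
  have hfun : ∀ f : C^∞⟮𝓘(ℝ, E), M; ℝ⟯, ∀ Z : Cₛ^∞⟮𝓘(ℝ, E); F, A⟯,
      ∃ Z' : Cₛ^∞⟮𝓘(ℝ, E); F, A⟯, ∀ p, Z' p = f p • Z p := fun f Z ↦
    ⟨⟨fun p ↦ f p • Z p, f.contMDiff.smul_section Z.contMDiff⟩, fun p ↦ rfl⟩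
  choose W hW using fun i ↦ hfun (a i) (X i)
  let χ₂ : C^∞⟮𝓘(ℝ, E), M; ℝ⟯ := ⟨fun p ↦ χ p * χ p, χ.contMDiff.mul χ.contMDiff⟩
  have hsum : ∀ p, (∑ i, W i) p = χ₂ p • Y p := fun p ↦ by
    have h1 : (∑ i, W i) p = ∑ i, W i p := by
      have h := congrFun (map_sum (ContMDiffSection.coeAddHom 𝓘(ℝ, E) F ∞ A) W Finset.univ) p
      rw [Finset.sum_apply] at h
      exact h
    rw [h1]
    show _ = (χ p * χ p) • Y p
    by_cases hp : χ p = 0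
    · rw [hp, zero_mul, zero_smul]
      refine Finset.sum_eq_zero fun i _ ↦ ?_
      rw [hW]
      show (χ p * c i p) • χ p • s i p = 0
      rw [hp, zero_mul, zero_smul]
    · have hp' : p ∈ e.baseSet := hχ (subset_tsupport _ hp)
      have h2 : Y p = ∑ i, c i p • s i p := by
        have h3 : e.symmL ℝ p (e ⟨p, Y p⟩).2 = Y p := by
          rw [e.symmL_apply hp']
          exact e.symm_apply_apply_mk hp' (Y p)
        rw [← h3]
        conv_lhs => rw [← b.sum_repr (e ⟨p, Y p⟩).2]
        simp only [map_sum, map_smul]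
        refine Finset.sum_congr rfl fun i _ ↦ ?_
        simp only [c, s]
        rfl
      rw [h2, Finset.smul_sum]
      refine Finset.sum_congr rfl fun i _ ↦ ?_
      rw [hW]
      show (χ p * c i p) • χ p • s i p = _
      rw [smul_smul, smul_smul]
      congr 1
      ring
  have h1 := hD χ₂ Y _ hsum
  have h2 : χ₂ m = 1 := by
    show χ m * χ m = 1
    simp
  rw [h2, one_mul, map_sum] at h1
  rw [← h1]
  refine Finset.sum_eq_zero fun i _ ↦ ?_
  rw [hD _ _ _ (hW i)]
  have h3 : a i m = 0 := by
    have h4 : (e ⟨m, (0 : A m)⟩).2 = 0 := by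
      have := (e.continuousLinearMapAt ℝ m).map_zero
      rwa [Trivialization.continuousLinearMapAt_apply,
        Trivialization.coe_linearMapAt_of_mem _ hm] at this
    show χ m * b.coord i (e ⟨m, Y m⟩).2 = 0
    rw [hY, h4, map_zero, mul_zero]
  rw [h3, zero_mul]

/-- Two functionals on sections whose difference is linear over functions agree at `X` as soon as
they agree at some `Y` with the same value at `m`. -/
theorem eq_of_tensorial {m : M} {D D' : Cₛ^∞⟮𝓘(ℝ, E); F, A⟯ →ₗ[ℝ] ℝ}
    (hD : ∀ (f : C^∞⟮𝓘(ℝ, E), M; ℝ⟯) (Y Z : Cₛ^∞⟮𝓘(ℝ, E); F, A⟯),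
      (∀ p, Z p = f p • Y p) → D Z - D' Z = f m * (D Y - D' Y))
    {X Y : Cₛ^∞⟮𝓘(ℝ, E); F, A⟯} (hXY : X m = Y m) (hY : D Y = D' Y) : D X = D' X := by
  have h := eq_zero_of_tensorial (D - D') (m := m) hD (Y := X - Y) (by
    show X m - Y m = 0
    rw [hXY, sub_self])
  simp only [map_sub, LinearMap.sub_apply, hY] at h
  linarith

end

/-! ### Transport of Poisson structures -/

namespace PoissonStructure

variable {E H : Type*} [NormedAddCommGroup E] [NormedSpace ℝ E] [TopologicalSpace H]
  {I : ModelWithCorners ℝ E H} {M : Type*} [TopologicalSpace M] [ChartedSpace H M]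
  {E' H' : Type*} [NormedAddCommGroup E'] [NormedSpace ℝ E'] [TopologicalSpace H']
  {I' : ModelWithCorners ℝ E' H'} {N : Type*} [TopologicalSpace N] [ChartedSpace H' N]

/-- The Poisson structure `{F, G} = {F ∘ Φ, G ∘ Φ} ∘ Φ⁻¹` transported along a diffeomorphism. -/
def transport (π₁ : PoissonStructure I M) (Φ : Diffeomorph I I' M N ∞) :
    PoissonStructure I' N where
  bracket := LinearMap.mk₂ ℝ (fun f g ↦ (π₁.bracket (f.comp ⟨Φ, Φ.contMDiff⟩)
      (g.comp ⟨Φ, Φ.contMDiff⟩)).comp ⟨Φ.symm, Φ.symm.contMDiff⟩)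
    (fun f f' g ↦ by
      ext x
      exact congrArg (fun k : C^∞⟮I, M; ℝ⟯ ↦ k (Φ.symm x)) (LinearMap.map_add₂ π₁.bracket
        (f.comp ⟨Φ, Φ.contMDiff⟩) (f'.comp ⟨Φ, Φ.contMDiff⟩) (g.comp ⟨Φ, Φ.contMDiff⟩)))
    (fun r f g ↦ by
      ext x
      exact congrArg (fun k : C^∞⟮I, M; ℝ⟯ ↦ k (Φ.symm x)) (LinearMap.map_smul₂ π₁.bracket
        r (f.comp ⟨Φ, Φ.contMDiff⟩) (g.comp ⟨Φ, Φ.contMDiff⟩)))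
    (fun f g g' ↦ by
      ext x
      exact congrArg (fun k : C^∞⟮I, M; ℝ⟯ ↦ k (Φ.symm x)) (map_add (π₁.bracket
        (f.comp ⟨Φ, Φ.contMDiff⟩)) (g.comp ⟨Φ, Φ.contMDiff⟩) (g'.comp ⟨Φ, Φ.contMDiff⟩)))
    (fun r f g ↦ by
      ext x
      exact congrArg (fun k : C^∞⟮I, M; ℝ⟯ ↦ k (Φ.symm x)) (map_smul (π₁.bracket
        (f.comp ⟨Φ, Φ.contMDiff⟩)) r (g.comp ⟨Φ, Φ.contMDiff⟩)))
  bracket_self f := by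
    ext x
    exact congrArg (fun k : C^∞⟮I, M; ℝ⟯ ↦ k (Φ.symm x))
      (π₁.bracket_self (f.comp ⟨Φ, Φ.contMDiff⟩))
  jacobi f g h := by
    have hk : ∀ k : C^∞⟮I, M; ℝ⟯,
        (k.comp ⟨Φ.symm, Φ.symm.contMDiff⟩ : C^∞⟮I', N; ℝ⟯).comp ⟨Φ, Φ.contMDiff⟩ = k := fun k ↦ by
      ext y
      exact congrArg k (Φ.symm_apply_apply y)
    ext x
    simp only [LinearMap.mk₂_apply, hk]
    exact congrArg (fun k : C^∞⟮I, M; ℝ⟯ ↦ k (Φ.symm x))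
      (π₁.jacobi (f.comp ⟨Φ, Φ.contMDiff⟩) (g.comp ⟨Φ, Φ.contMDiff⟩) (h.comp ⟨Φ, Φ.contMDiff⟩))
  leibniz f g h := by
    ext x
    have h1 := congrArg (fun k : C^∞⟮I, M; ℝ⟯ ↦ k (Φ.symm x)) (π₁.leibniz
      (f.comp ⟨Φ, Φ.contMDiff⟩) (g.comp ⟨Φ, Φ.contMDiff⟩) (h.comp ⟨Φ, Φ.contMDiff⟩))
    refine h1.trans ?_
    show g (Φ (Φ.symm x)) * _ + _ * h (Φ (Φ.symm x)) = g x * _ + _ * h x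
    rw [Φ.apply_symm_apply]
    rfl

theorem isPoissonMap_transport (π₁ : PoissonStructure I M) (Φ : Diffeomorph I I' M N ∞) :
    IsPoissonMap π₁ (π₁.transport Φ) ⟨Φ, Φ.contMDiff⟩ := fun f g ↦ by
  ext x
  exact congrArg (π₁.bracket (f.comp ⟨Φ, Φ.contMDiff⟩) (g.comp ⟨Φ, Φ.contMDiff⟩))
    (Φ.symm_apply_apply x).symm

/-- Since `Φ` is a bijection, `Φ` being Poisson determines the structure on its target. -/
theorem eq_transport {π₁ : PoissonStructure I M} {Φ : Diffeomorph I I' M N ∞}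
    {π₂ : PoissonStructure I' N} (h : IsPoissonMap π₁ π₂ ⟨Φ, Φ.contMDiff⟩) :
    π₂ = π₁.transport Φ := by
  refine ext_bracket fun f g ↦ ?_
  ext x
  have h1 := congrArg (fun k : C^∞⟮I, M; ℝ⟯ ↦ k (Φ.symm x)) (h f g)
  exact (congrArg (π₂.bracket f g) (Φ.apply_symm_apply x)).symm.trans h1.symm

/-- If `Φ⁻¹` carries `π₂` to `π₁`, then `Φ` is a Poisson map. -/
theorem isPoissonMap_of_transport_symm {π₁ : PoissonStructure I M} {Φ : Diffeomorph I I' M N ∞}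
    {π₂ : PoissonStructure I' N} (h : π₂.transport Φ.symm = π₁) :
    IsPoissonMap π₁ π₂ ⟨Φ, Φ.contMDiff⟩ := fun f g ↦ by
  have hk : ∀ k : C^∞⟮I', N; ℝ⟯,
      (k.comp ⟨Φ, Φ.contMDiff⟩ : C^∞⟮I, M; ℝ⟯).comp ⟨Φ.symm, Φ.symm.contMDiff⟩ = k := fun k ↦ by
    ext y
    exact congrArg k (Φ.apply_symm_apply y)
  have h1 := isPoissonMap_transport π₂ Φ.symm (f.comp ⟨Φ, Φ.contMDiff⟩) (g.comp ⟨Φ, Φ.contMDiff⟩)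
  rw [h, hk, hk] at h1
  ext x
  rw [h1]
  exact congrArg (π₁.bracket (f.comp ⟨Φ, Φ.contMDiff⟩) (g.comp ⟨Φ, Φ.contMDiff⟩))
    (Φ.symm_apply_apply x).symm

end PoissonStructure

/-! ### The diffeomorphism between `TP` and `A*S` -/

section

variable {E : Type*} [NormedAddCommGroup E] [NormedSpace ℝ E] [FiniteDimensional ℝ E]
  {M : Type*} [TopologicalSpace M] [ChartedSpace E M] [IsManifold 𝓘(ℝ, E) ∞ M] [T2Space M]

/-- Every cotangent vector is the differential of a global smooth function. -/
theorem exists_dirDeriv_eq (m : M) (l : TangentSpace 𝓘(ℝ, E) m →ₗ[ℝ] ℝ) :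
    ∃ f : C^∞⟮𝓘(ℝ, E), M; ℝ⟯, ∀ v, dirDeriv f m v = l v := by
  obtain ⟨e, he⟩ := isInvertible_mfderiv_extChartAt (I := 𝓘(ℝ, E))
    (mem_extChartAt_source (I := 𝓘(ℝ, E)) m)
  let e' : E ≃L[ℝ] E := e
  let l' : E →ₗ[ℝ] ℝ := l
  obtain ⟨f, hf⟩ := exists_contMDiffMap_coord (I := 𝓘(ℝ, E)) m
    (LinearMap.toContinuousLinearMap (l' ∘ₗ e'.symm.toLinearMap))
  refine ⟨f, fun v ↦ ?_⟩
  rw [dirDeriv_eq_of_eventuallyEq_coord hf (mem_chart_source E m), ← he]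
  exact congrArg l' (e'.symm_apply_apply v)

end

namespace SymplecticGroupoid

variable {E F : Type*} [NormedAddCommGroup E] [NormedSpace ℝ E] [FiniteDimensional ℝ E]
  [NormedAddCommGroup F] [NormedSpace ℝ F] [FiniteDimensional ℝ F]
  {S P : Type*} [TopologicalSpace S] [ChartedSpace F S] [IsManifold 𝓘(ℝ, F) ∞ S]
  [TopologicalSpace P] [ChartedSpace E P] [IsManifold 𝓘(ℝ, E) ∞ P]
  (G : SymplecticGroupoid E F S P)

theorem negW_snd_apply (x : TangentBundle 𝓘(ℝ, E) P) (X : G.A x.1) :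
    (G.negW x).2 X = G.pairing x.1 x.2 X := neg_neg _

theorem negW_bijective : Function.Bijective G.negW := by
  constructor
  · rintro ⟨m, v⟩ ⟨m', v'⟩ h
    obtain rfl : m = m' := congrArg TotalSpace.proj h
    have h1 : (G.negW ⟨m, v⟩).2 = (G.negW ⟨m, v'⟩).2 := eq_of_heq (TotalSpace.mk.inj h).2
    refine congrArg (TotalSpace.mk m) (G.pairing_injective m (LinearMap.ext fun X ↦ ?_))
    exact ((G.negW_snd_apply ⟨m, v⟩ X).symm.trans (DFunLike.congr_fun h1 X)).trans
      (G.negW_snd_apply ⟨m, v'⟩ X)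
  · rintro ⟨m, φ⟩
    obtain ⟨v, hv⟩ := G.pairing_surjective m φ.toLinearMap
    refine ⟨⟨m, v⟩, congrArg (TotalSpace.mk m) (ContinuousLinearMap.ext fun X ↦ ?_)⟩
    exact (G.negW_snd_apply ⟨m, v⟩ X).trans (LinearMap.congr_fun hv X)

theorem contMDiff_negW : ContMDiff 𝓘(ℝ, E).tangent
    (𝓘(ℝ, E).prod 𝓘(ℝ, LieGroupoid.AModel E F →L[ℝ] ℝ)) ∞ G.negW := by
  intro x₀
  have hb : ContMDiffAt 𝓘(ℝ, E).tangent 𝓘(ℝ, E) ∞ (fun x : TangentBundle 𝓘(ℝ, E) P ↦ x.1) x₀ :=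
    contMDiff_proj (TangentSpace 𝓘(ℝ, E)) x₀
  refine contMDiffAt_hom_of_forall_section (A₁ := G.A) (A₂ := Bundle.Trivial P ℝ)
    (b := fun x : TangentBundle 𝓘(ℝ, E) P ↦ x.1) (φ := fun x ↦ (G.negW x).2) hb fun s hs ↦ ?_
  have h1 := (G.contMDiffAt_vert_iff hb).1 hs
  have h2 : ContMDiff 𝓘(ℝ, E).tangent 𝓘(ℝ, F).tangent ∞ (tangentMap 𝓘(ℝ, E) 𝓘(ℝ, F) G.one) :=
    G.one.contMDiff.contMDiff_tangentMap (by simp)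
  refine contMDiffAt_totalSpace.2 ⟨hb, ?_⟩
  refine (G.form.contMDiffAt_apply (b := fun x : TangentBundle 𝓘(ℝ, E) P ↦ G.one x.1)
    (u := fun x ↦ mfderiv 𝓘(ℝ, E) 𝓘(ℝ, F) G.one x.1 x.2) (h2 x₀) h1).congr_of_eventuallyEq
    (.of_forall fun x ↦ ?_)
  exact G.negW_snd_apply x (s x)

variable [T2Space S] [T2Space P]

/-- The section `m ↦ X_{f ∘ β}(1_m)` of `A S`, where `X_{f ∘ β}` is the Hamiltonian vector field of
`f ∘ β`. -/
def hamiltonianSection (f : C^∞⟮𝓘(ℝ, E), P; ℝ⟯) :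
    Cₛ^∞⟮𝓘(ℝ, E); LieGroupoid.AModel E F, G.A⟯ where
  toFun m := ⟨G.form.sharp (f.comp G.target) (G.one m), G.sharp_comp_target_mem_vert f m⟩
  contMDiff_toFun m := (G.contMDiffAt_vert_iff (b := fun m ↦ m) contMDiffAt_id).2
    ((G.form.contMDiff_sharp (f.comp G.target) _).comp m (G.one.contMDiff m))

theorem pairing_hamiltonianSection (f : C^∞⟮𝓘(ℝ, E), P; ℝ⟯) {m : P} (v : TangentSpace 𝓘(ℝ, E) m) :
    G.pairing m v (G.hamiltonianSection f m) = dirDeriv f m v := by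
  refine (G.form.form_sharp (f.comp G.target) (G.one m)
    (mfderiv 𝓘(ℝ, E) 𝓘(ℝ, F) G.one m v)).trans ?_
  rw [dirDeriv_comp_target]
  exact dirDeriv_congr_point f (G.target_one m) (G.mfderiv_target_one v)

/-- Under `-w`, the fibrewise linear function of `X_{f ∘ β}` corresponds to that of `df`. -/
theorem linearFunction_hamiltonianSection_negW (f : C^∞⟮𝓘(ℝ, E), P; ℝ⟯)
    (x : TangentBundle 𝓘(ℝ, E) P) :
    linearFunction (G.hamiltonianSection f) (G.negW x) = differentialFunction f x :=
  (G.negW_snd_apply x _).trans (G.pairing_hamiltonianSection f x.2)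

/-- Every section agrees at a given point with some `X_{f ∘ β}`. -/
theorem exists_hamiltonianSection_eq {m : P} (u : G.A m) :
    ∃ f, G.hamiltonianSection f m = u := by
  obtain ⟨f, hf⟩ := exists_dirDeriv_eq m ((G.pairing m).flip u)
  refine ⟨f, G.pairing_flip_injective m (LinearMap.ext fun v ↦ ?_)⟩
  exact (G.pairing_hamiltonianSection f v).trans (hf v)

/-- The map `-w` as a diffeomorphism. -/
def negWDiffeomorph : Diffeomorph 𝓘(ℝ, E).tangent
    (𝓘(ℝ, E).prod 𝓘(ℝ, LieGroupoid.AModel E F →L[ℝ] ℝ)) (TangentBundle 𝓘(ℝ, E) P)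
    (DualBundle (LieGroupoid.AModel E F) G.A) ∞ where
  toEquiv := Equiv.ofBijective G.negW G.negW_bijective
  contMDiff_toFun := G.contMDiff_negW
  contMDiff_invFun φ₀ := by
    let e := Equiv.ofBijective G.negW G.negW_bijective
    have he : ∀ φ, G.negW (e.symm φ) = φ := e.apply_symm_apply
    refine contMDiffAt_tangentBundle_of_dirDeriv (Ψ := e.symm) ?_ fun f ↦ ?_
    · refine (contMDiff_proj (fun m : P ↦ G.A m →L[ℝ] ℝ) φ₀).congr_of_eventuallyEq
        (.of_forall fun φ ↦ ?_)
      exact congrArg TotalSpace.proj (he φ)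
    · refine ((linearFunction (G.hamiltonianSection f)).contMDiff φ₀).congr_of_eventuallyEq
        (.of_forall fun φ ↦ ?_)
      refine (G.linearFunction_hamiltonianSection_negW f (e.symm φ)).symm.trans ?_
      rw [he]

theorem negWDiffeomorph_apply (x : TangentBundle 𝓘(ℝ, E) P) :
    G.negWDiffeomorph x = G.negW x := rfl

/-! ### Brackets of the sections `X_{f ∘ β}` -/

theorem rightInvariantField_hamiltonianSection (f : C^∞⟮𝓘(ℝ, E), P; ℝ⟯) :
    G.rightInvariantField (G.hamiltonianSection f) = G.form.hamiltonian (f.comp G.target) :=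
  ContMDiffSection.ext fun g ↦ (G.sharp_comp_target_eq f g).symm

/-- In terms of right-invariant vector fields, this is `[X_F, X_G] = X_{F, G}` for `F = f ∘ β` and
`G = g ∘ β`. -/
theorem bracket_hamiltonianSection (f g : C^∞⟮𝓘(ℝ, E), P; ℝ⟯) :
    G.lieAlgebroid.bracket (G.hamiltonianSection f) (G.hamiltonianSection g) =
      G.hamiltonianSection (G.basePoisson.bracket f g) := by
  refine G.rightInvariantField_injective (lieDerivative_injective (LinearMap.ext fun k ↦ ?_))
  rw [lieAlgebroid_bracket, rightInvariantField_sectionBracket, lieDerivative_vectorBracket,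
    rightInvariantField_hamiltonianSection, rightInvariantField_hamiltonianSection,
    rightInvariantField_hamiltonianSection, basePoisson_bracket, baseBracket_comp_target,
    SymplecticForm.poisson_bracket]
  have h := G.form.hamiltonian_jacobi (f.comp G.target) (g.comp G.target) k
  rw [G.form.lieDerivative_hamiltonian_swap k (f.comp G.target),
    G.form.lieDerivative_hamiltonian_swap k, map_neg] at h
  linear_combination h

theorem dirDeriv_anchor_hamiltonianSection (f g : C^∞⟮𝓘(ℝ, E), P; ℝ⟯) (m : P) :
    dirDeriv g m (G.lieAlgebroid.anchor m (G.hamiltonianSection f m)) =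
      G.basePoisson.bracket f g m := by
  rw [lieDerivative_baseHamiltonian]
  rfl

end SymplecticGroupoid

/-! ### The Lie-Poisson structure -/

/-- Evaluation of smooth functions at a point. -/
def evalAt {E H : Type*} [NormedAddCommGroup E] [NormedSpace ℝ E] [TopologicalSpace H]
    (I : ModelWithCorners ℝ E H) {M : Type*} [TopologicalSpace M] [ChartedSpace H M] (x : M) :
    C^∞⟮I, M; ℝ⟯ →ₗ[ℝ] ℝ where
  toFun f := f x
  map_add' _ _ := rfl
  map_smul' _ _ := rfl

namespace SymplecticGroupoid

variable {E F : Type*} [NormedAddCommGroup E] [NormedSpace ℝ E] [FiniteDimensional ℝ E]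
  [NormedAddCommGroup F] [NormedSpace ℝ F] [FiniteDimensional ℝ F]
  {S P : Type*} [TopologicalSpace S] [ChartedSpace F S] [IsManifold 𝓘(ℝ, F) ∞ S]
  [TopologicalSpace P] [ChartedSpace E P] [IsManifold 𝓘(ℝ, E) ∞ P]
  (G : SymplecticGroupoid E F S P) [T2Space S] [T2Space P]

/-- The function `ℓ_X ∘ (-w)` on `TP`, depending linearly on the section `X`. -/
def tangentLinearFunction : Cₛ^∞⟮𝓘(ℝ, E); LieGroupoid.AModel E F, G.A⟯ →ₗ[ℝ]
    C^∞⟮𝓘(ℝ, E).tangent, TangentBundle 𝓘(ℝ, E) P; ℝ⟯ where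
  toFun X := (linearFunction X).comp ⟨G.negWDiffeomorph, G.negWDiffeomorph.contMDiff⟩
  map_add' X Y := by
    ext x
    exact map_add (G.negW x).2 (X x.1) (Y x.1)
  map_smul' r X := by
    ext x
    exact map_smul (G.negW x).2 r (X x.1)

theorem tangentLinearFunction_apply (X : Cₛ^∞⟮𝓘(ℝ, E); LieGroupoid.AModel E F, G.A⟯)
    (x : TangentBundle 𝓘(ℝ, E) P) : G.tangentLinearFunction X x = G.pairing x.1 x.2 (X x.1) :=
  G.negW_snd_apply x (X x.1)

theorem tangentLinearFunction_hamiltonianSection (f : C^∞⟮𝓘(ℝ, E), P; ℝ⟯) :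
    G.tangentLinearFunction (G.hamiltonianSection f) = differentialFunction f := by
  ext x
  exact G.linearFunction_hamiltonianSection_negW f x

theorem tangentLinearFunction_mul {f : C^∞⟮𝓘(ℝ, E), P; ℝ⟯}
    {X Y : Cₛ^∞⟮𝓘(ℝ, E); LieGroupoid.AModel E F, G.A⟯} (h : ∀ p, Y p = f p • X p) :
    G.tangentLinearFunction Y = tangentPullback f * G.tangentLinearFunction X := by
  ext x
  exact (congrArg (G.negW x).2 (h x.1)).trans (map_smul (G.negW x).2 (f x.1) (X x.1))

variable {G} {π₁ : PoissonStructure 𝓘(ℝ, E).tangent (TangentBundle 𝓘(ℝ, E) P)}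

/-- Both sides are linear over functions in `X`, and they agree for `X = X_{f ∘ β}`. -/
theorem bracket_tangentLinearFunction_tangentPullback (h₁ : IsTangentLift G.basePoisson π₁)
    (X : Cₛ^∞⟮𝓘(ℝ, E); LieGroupoid.AModel E F, G.A⟯) (g : C^∞⟮𝓘(ℝ, E), P; ℝ⟯) :
    π₁.bracket (G.tangentLinearFunction X) (tangentPullback g) =
      tangentPullback (lieDerivative
        (⟨fun m ↦ G.lieAlgebroid.anchor m (X m),
          fun m ↦ G.contMDiffAt_anchorMap_apply (b := fun m ↦ m) (X.contMDiff m)⟩) g) := by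
  ext x
  let D : Cₛ^∞⟮𝓘(ℝ, E); LieGroupoid.AModel E F, G.A⟯ →ₗ[ℝ] ℝ :=
    evalAt _ x ∘ₗ π₁.bracket.flip (tangentPullback g) ∘ₗ G.tangentLinearFunction
  let D' : Cₛ^∞⟮𝓘(ℝ, E); LieGroupoid.AModel E F, G.A⟯ →ₗ[ℝ] ℝ :=
    { toFun := fun X ↦ dirDeriv g x.1 (G.lieAlgebroid.anchor x.1 (X x.1))
      map_add' := fun X Y ↦ (congrArg (dirDeriv g x.1)
        (map_add (G.lieAlgebroid.anchor x.1) (X x.1) (Y x.1))).trans (map_add _ _ _)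
      map_smul' := fun r X ↦ (congrArg (dirDeriv g x.1)
        (map_smul (G.lieAlgebroid.anchor x.1) r (X x.1))).trans (map_smul _ _ _) }
  obtain ⟨f, hf⟩ := G.exists_hamiltonianSection_eq (X x.1)
  refine eq_of_tensorial (m := x.1) (D := D) (D' := D') (fun f Y Z hZ ↦ ?_) hf.symm ?_
  · have h2 : D Z = f x.1 * D Y := by
      show π₁.bracket (G.tangentLinearFunction Z) (tangentPullback g) x =
        f x.1 * π₁.bracket (G.tangentLinearFunction Y) (tangentPullback g) x
      rw [G.tangentLinearFunction_mul hZ, π₁.leibniz_left, h₁.2.2, zero_mul, add_zero]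
      rfl
    have h3 : D' Z = f x.1 * D' Y := by
      show dirDeriv g x.1 (G.lieAlgebroid.anchor x.1 (Z x.1)) = _
      rw [hZ, map_smul]
      exact map_smul (mfderiv 𝓘(ℝ, E) 𝓘(ℝ, ℝ) g x.1) _ _
    rw [h2, h3, mul_sub]
  · show π₁.bracket (G.tangentLinearFunction (G.hamiltonianSection f)) (tangentPullback g) x =
      dirDeriv g x.1 (G.lieAlgebroid.anchor x.1 (G.hamiltonianSection f x.1))
    rw [dirDeriv_anchor_hamiltonianSection, tangentLinearFunction_hamiltonianSection, h₁.2.1]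
    rfl

/-- `{ℓ_X, ℓ_Y} - ℓ_[X, Y]`, pulled back to `TP`, is linear over functions in `Y`. -/
theorem tangentLinearFunction_bracket_mul
    {f : C^∞⟮𝓘(ℝ, E), P; ℝ⟯} {X Y Z : Cₛ^∞⟮𝓘(ℝ, E); LieGroupoid.AModel E F, G.A⟯}
    (hZ : ∀ p, Z p = f p • Y p) (h₁ : IsTangentLift G.basePoisson π₁) (x : TangentBundle 𝓘(ℝ, E) P) :
    π₁.bracket (G.tangentLinearFunction X) (G.tangentLinearFunction Z) x -
        G.tangentLinearFunction (G.lieAlgebroid.bracket X Z) x =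
      f x.1 * (π₁.bracket (G.tangentLinearFunction X) (G.tangentLinearFunction Y) x -
        G.tangentLinearFunction (G.lieAlgebroid.bracket X Y) x) := by
  have h1 : G.tangentLinearFunction (G.lieAlgebroid.bracket X Z) x =
      f x.1 * G.tangentLinearFunction (G.lieAlgebroid.bracket X Y) x +
        dirDeriv f x.1 (G.lieAlgebroid.anchor x.1 (X x.1)) * G.tangentLinearFunction Y x := by
    simp only [tangentLinearFunction_apply]
    rw [G.lieAlgebroid.leibniz X Y Z f hZ, map_add, map_smul, map_smul]
    rfl
  have h2 : π₁.bracket (G.tangentLinearFunction X) (G.tangentLinearFunction Z) x =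
      f x.1 * π₁.bracket (G.tangentLinearFunction X) (G.tangentLinearFunction Y) x +
        dirDeriv f x.1 (G.lieAlgebroid.anchor x.1 (X x.1)) * G.tangentLinearFunction Y x := by
    rw [G.tangentLinearFunction_mul hZ, π₁.leibniz,
      bracket_tangentLinearFunction_tangentPullback h₁]
    rfl
  rw [h1, h2]
  ring

/-- The difference of the two sides is linear over functions in `Y`, hence by antisymmetry in `X`,
and it vanishes for `X = X_{f ∘ β}` and `Y = X_{g ∘ β}`. -/
theorem bracket_tangentLinearFunction (h₁ : IsTangentLift G.basePoisson π₁)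
    (X Y : Cₛ^∞⟮𝓘(ℝ, E); LieGroupoid.AModel E F, G.A⟯) :
    π₁.bracket (G.tangentLinearFunction X) (G.tangentLinearFunction Y) =
      G.tangentLinearFunction (G.lieAlgebroid.bracket X Y) := by
  ext x
  have hswap : ∀ X Y : Cₛ^∞⟮𝓘(ℝ, E); LieGroupoid.AModel E F, G.A⟯,
      G.lieAlgebroid.bracket X Y = -G.lieAlgebroid.bracket Y X := fun X Y ↦ by
    have h := G.lieAlgebroid.bracket_self (X + Y)
    simp only [map_add, LinearMap.add_apply, G.lieAlgebroid.bracket_self, zero_add, add_zero] at h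
    exact eq_neg_of_add_eq_zero_right h
  let D (X : Cₛ^∞⟮𝓘(ℝ, E); LieGroupoid.AModel E F, G.A⟯) :
      Cₛ^∞⟮𝓘(ℝ, E); LieGroupoid.AModel E F, G.A⟯ →ₗ[ℝ] ℝ :=
    evalAt _ x ∘ₗ π₁.bracket (G.tangentLinearFunction X) ∘ₗ G.tangentLinearFunction
  let D' (X : Cₛ^∞⟮𝓘(ℝ, E); LieGroupoid.AModel E F, G.A⟯) :
      Cₛ^∞⟮𝓘(ℝ, E); LieGroupoid.AModel E F, G.A⟯ →ₗ[ℝ] ℝ :=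
    evalAt _ x ∘ₗ G.tangentLinearFunction ∘ₗ G.lieAlgebroid.bracket X
  have key : ∀ X Y Y' : Cₛ^∞⟮𝓘(ℝ, E); LieGroupoid.AModel E F, G.A⟯, Y x.1 = Y' x.1 →
      D X Y' = D' X Y' → D X Y = D' X Y := fun X Y Y' hY h ↦
    eq_of_tensorial (fun f Y Z hZ ↦ tangentLinearFunction_bracket_mul hZ h₁ x) hY h
  have hD : ∀ X Y, D X Y = D' X Y → D Y X = D' Y X := fun X Y h ↦ by
    have h2 : D Y X = -D X Y := by
      show π₁.bracket _ _ x = -π₁.bracket _ _ x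
      rw [π₁.bracket_swap]
      rfl
    have h3 : D' Y X = -D' X Y := by
      show G.tangentLinearFunction _ x = -G.tangentLinearFunction _ x
      rw [hswap, map_neg]
      rfl
    rw [h2, h3, h]
  obtain ⟨f, hf⟩ := G.exists_hamiltonianSection_eq (X x.1)
  obtain ⟨g, hg⟩ := G.exists_hamiltonianSection_eq (Y x.1)
  refine key X Y (G.hamiltonianSection g) hg.symm
    (hD _ _ (key _ X (G.hamiltonianSection f) hf.symm ?_))
  show π₁.bracket _ _ x = G.tangentLinearFunction _ x
  rw [tangentLinearFunction_hamiltonianSection, tangentLinearFunction_hamiltonianSection, h₁.1,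
    bracket_hamiltonianSection, tangentLinearFunction_hamiltonianSection]

/-- The diffeomorphism `-w` carries the tangent lift of the base to a Lie-Poisson structure. -/
theorem isLiePoisson_transport (h₁ : IsTangentLift G.basePoisson π₁) :
    IsLiePoisson G.lieAlgebroid (π₁.transport G.negWDiffeomorph) := by
  have hk : ∀ φ, G.negW (G.negWDiffeomorph.symm φ) = φ := G.negWDiffeomorph.apply_symm_apply
  have hp : ∀ φ, (G.negWDiffeomorph.symm φ).1 = φ.1 := fun φ ↦ congrArg TotalSpace.proj (hk φ)
  refine ⟨fun X Y ↦ ?_, fun X f φ ↦ ?_, fun f g ↦ ?_⟩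
  · ext φ
    have h := congrArg (evalAt _ (G.negWDiffeomorph.symm φ)) (bracket_tangentLinearFunction h₁ X Y)
    exact h.trans (congrArg (linearFunction (G.lieAlgebroid.bracket X Y)) (hk φ))
  · have h := congrArg (evalAt _ (G.negWDiffeomorph.symm φ))
      (bracket_tangentLinearFunction_tangentPullback h₁ X f)
    refine h.trans ?_
    exact congrArg (fun m ↦ dirDeriv f m (G.lieAlgebroid.anchor m (X m))) (hp φ)
  · ext φ
    exact congrArg (evalAt _ (G.negWDiffeomorph.symm φ)) (h₁.2.2 f g)

/-- The diffeomorphism `-w` carries every Lie-Poisson structure back to a tangent lift, because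
`ℓ_df` corresponds to the function of the section `X_{f ∘ β}`. -/
theorem isTangentLift_transport
    {π₂ : PoissonStructure (𝓘(ℝ, E).prod 𝓘(ℝ, LieGroupoid.AModel E F →L[ℝ] ℝ))
      (DualBundle (LieGroupoid.AModel E F) G.A)} (h₂ : IsLiePoisson G.lieAlgebroid π₂) :
    IsTangentLift G.basePoisson (π₂.transport G.negWDiffeomorph.symm) := by
  have hk : ∀ φ, G.negW (G.negWDiffeomorph.symm φ) = φ := G.negWDiffeomorph.apply_symm_apply
  have hd : ∀ f : C^∞⟮𝓘(ℝ, E), P; ℝ⟯, (differentialFunction f).comp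
      ⟨G.negWDiffeomorph.symm, G.negWDiffeomorph.symm.contMDiff⟩ =
        linearFunction (G.hamiltonianSection f) := fun f ↦ by
    ext φ
    exact (G.linearFunction_hamiltonianSection_negW f _).symm.trans (congrArg _ (hk φ))
  have hp : ∀ f : C^∞⟮𝓘(ℝ, E), P; ℝ⟯, (tangentPullback f).comp
      ⟨G.negWDiffeomorph.symm, G.negWDiffeomorph.symm.contMDiff⟩ =
        pullbackFunction (F := LieGroupoid.AModel E F) (A := G.A) f := fun f ↦ by
    ext φ
    exact congrArg (fun φ ↦ f φ.1) (hk φ)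
  refine ⟨fun f g ↦ ?_, fun f g ↦ ?_, fun f g ↦ ?_⟩
  · ext x
    show π₂.bracket ((differentialFunction f).comp _) ((differentialFunction g).comp _)
      (G.negW x) = _
    erw [hd, hd, h₂.1, bracket_hamiltonianSection]
    exact G.linearFunction_hamiltonianSection_negW _ x
  · ext x
    show π₂.bracket ((differentialFunction f).comp _) ((tangentPullback g).comp _)
      (G.negW x) = _
    erw [hd, hp, h₂.2.1]
    exact G.dirDeriv_anchor_hamiltonianSection f g x.1
  · ext x
    show π₂.bracket ((tangentPullback f).comp _) ((tangentPullback g).comp _) (G.negW x) = _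
    erw [hp, hp, h₂.2.2]
    rfl

end SymplecticGroupoid

theorem proposition2p6 {E F : Type*} [NormedAddCommGroup E] [NormedSpace ℝ E]
    [FiniteDimensional ℝ E] [NormedAddCommGroup F] [NormedSpace ℝ F] [FiniteDimensional ℝ F]
    {S P : Type*} [TopologicalSpace S] [ChartedSpace F S] [IsManifold 𝓘(ℝ, F) ∞ S] [T2Space S]
    [SecondCountableTopology S] [TopologicalSpace P] [ChartedSpace E P] [IsManifold 𝓘(ℝ, E) ∞ P]
    [T2Space P] [SecondCountableTopology P] (G : SymplecticGroupoid E F S P) :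
    ∃ (πS : PoissonStructure 𝓘(ℝ, F) S) (πP : PoissonStructure 𝓘(ℝ, E) P)
      (πTP : PoissonStructure 𝓘(ℝ, E).tangent (TangentBundle 𝓘(ℝ, E) P))
      (L : LieAlgebroid E (LieGroupoid.AModel E F) G.toLieGroupoid.A)
      (πA : PoissonStructure (𝓘(ℝ, E).prod 𝓘(ℝ, LieGroupoid.AModel E F →L[ℝ] ℝ))
        (DualBundle (LieGroupoid.AModel E F) G.toLieGroupoid.A)),
      IsTheUnique G.form.IsAssociatedPoisson πS ∧
      IsTheUnique (fun π₁ ↦ IsPoissonMap πS π₁ G.target) πP ∧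
      IsTheUnique (IsTangentLift πP) πTP ∧
      IsTheUnique G.toLieGroupoid.IsLieAlgebroidOf L ∧
      IsTheUnique (IsLiePoisson L) πA ∧
      ∃ Φ : Diffeomorph 𝓘(ℝ, E).tangent (𝓘(ℝ, E).prod 𝓘(ℝ, LieGroupoid.AModel E F →L[ℝ] ℝ))
          (TangentBundle 𝓘(ℝ, E) P)
          (DualBundle (LieGroupoid.AModel E F) G.toLieGroupoid.A) ∞,
        (∀ x, Φ x = G.negW x) ∧ IsPoissonMap πTP πA ⟨Φ, Φ.contMDiff⟩ := by
  obtain ⟨πTP, hTP⟩ := exists_isTangentLift G.basePoisson G.baseHamiltonian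
    G.lieDerivative_baseHamiltonian
  refine ⟨G.form.poisson, G.basePoisson, πTP, G.lieAlgebroid, πTP.transport G.negWDiffeomorph,
    G.form.isTheUnique_poisson, G.isTheUnique_basePoisson, hTP, G.isTheUnique_lieAlgebroid,
    ⟨SymplecticGroupoid.isLiePoisson_transport hTP.1, fun π₂ h₂ ↦ ?_⟩,
    G.negWDiffeomorph, G.negWDiffeomorph_apply, πTP.isPoissonMap_transport _⟩
  have h := hTP.2 _ (SymplecticGroupoid.isTangentLift_transport h₂)
  exact PoissonStructure.eq_transport (PoissonStructure.isPoissonMap_of_transport_symm h)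

end
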